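/- **Notation.** Let $\mathbb T=\mathbb R/2\pi\mathbb Z$, $d\in\mathbb N$ ($d\ge1$), and let $L_p=L_p(\mathbb T^d)$ (complex-valued functions, Lebesgue measure) with norm $\|\cdot\|_p$; for $p=\infty$ this is the essential supremum norm. Put $x_+=\max\{x,0\}$, $1/\infty=0$, $1/p+1/p'=1$, $|\mathbf j|_1=j_1+\dots+j_d$ for $\mathbf j\in\mathbb Z_+^d$, and $$\widehat f(\mathbf k)=(2\pi)^{-d}\int_{\mathbb T^d}f(\mathbf x)e^{-i(\mathbf k,\mathbf x)}\,d\mathbf x .$$ *Besov spaces.* Fix $C^\infty$ functions $\phi_j:\mathbb R\to\mathbb C$, $j\in\mathbb Z_+$, with $\operatorname{supp}\phi_0\subset\{|\xi|\le2\}$, $\operatorname{supp}\phi_j\subset\{2^{j-1}\le|\xi|\le2^{j+1}\}$ for $j\ge1$, $\sup_{\xi,j}2^{j\ell}|\phi_j^{(\ell)}(\xi)|<\infty$ for every $\ell\in\mathbb Z_+$, and $\sum_j\phi_j(\xi)=1$ for all $\xi$. For $f\in L_1(\mathbb T^d)$ let $\delta_{\mathbf j}(f)(\mathbf x)=\sum_{\mathbf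 k\in\mathbb Z^d}\phi_{j_1}(k_1)\cdots\phi_{j_d}(k_d)\widehat f(\mathbf k)e^{i(\mathbf k,\mathbf x)}$. Then $\mathbf B^r_{p,\theta}(\mathbb T^d)$ is the set of $f\in L_1(\mathbb T^d)$ with $$\|f\|_{\mathbf B^r_{p,\theta}}=\Big(\sum_{\mathbf j\in\mathbb Z_+^d}2^{r\theta|\mathbf j|_1}\|\delta_{\mathbf j}(f)\|_p^\theta\Big)^{1/\theta}<\infty$$ (supremum over $\mathbf j$ if $\theta=\infty$). *Multipliers.* For $\lambda=(\lambda_k)_{k\in\mathbb Z}$, $\|\lambda\|_{M_p}$ is the norm of the operator on $L_p(\mathbb T)$ that multiplies the $k$-th Fourier coefficient by $\lambda_k$ for every $k$ ($\infty$ if this is not a bounded operator on $L_p(\mathbb T)$). *Operators.* Let $A_j=[-2^{j-1},2^{j-1})\cap\mathbb Z$, $x_k^j=2\pi k/2^j$, and $(f*g)(x)=\frac1{2\pi}\int_{\mathbb T}f(x-t)g(t)\,dt$. For families $\varphi=(\varphi_j)_{j\in\mathbb Z_+}$ of trigonometric polynomials and $\widetilde\varphi=(\widetilde\varphi_j)_{j\in\mathbb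 Z_+}$ of functions on $\mathbb T$ put $$Q_j(f)(x)=2^{-j}\sum_{k\in A_j}(f*\widetilde\varphi_j)(x_k^j)\,\varphi_j(x-x_k^j),\qquad Q_{-1}=0,$$ $$T_n^Q=\sum_{\mathbf j\in\mathbb Z_+^d,\ |\mathbf j|_1\le n}\ \prod_{i=1}^d\big(Q^i_{j_i}-Q^i_{j_i-1}\big),$$ where $Q_j^i$ is $Q_j$ acting in the variable $x_i$. Put $$\|g\|_{\mathcal L_{q,j}}=\Big(2^j\int_{[-\pi2^{-j},\pi2^{-j})}\Big(2^{-j}\sum_{k\in A_j}|g(x-x_k^j)|\Big)^q dx\Big)^{1/q},$$ with the essential supremum over $x$ of the inner expression $2^{-j}\sum_{k\in A_j}|g(x-x_k^j)|$ if $q=\infty$. **Theorem.** Let $1\le p,q,\theta\le\infty$ and $(1/p-1/q)_+<r<s$. Suppose that 1. $\varphi_j\in\operatorname{span}\{e^{ikx}:k\in[-2^j,2^j)\cap\mathbb Z\}$ for all $j$; there is $\rho<1$ such that $\widehat{\varphi_j}(k)=0$ for all $j\in\mathbb Z_+$ and all $k\in\mathbb Z$ with $|k|>\rho2^j$; and $\sup_j\|(\widehat{\varphi_j}(k))_k\|_{M_p}<\infty$;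 2. $\widetilde\varphi_j\in L_{p'}(\mathbb T)$ for all $j$, and $\sup_j\|\widetilde\varphi_j\|_{\mathcal L_{p',j}}<\infty$; 3. $\widehat{\varphi_j}(0)\widehat{\widetilde\varphi_j}(0)=1$ for all $j$, and there is $\delta>0$ such that $$\sup_j\Big\|\Big(\frac{1-\widehat{\varphi_j}(k)\widehat{\widetilde\varphi_j}(k)}{(2^{-j}k)^s}\,\phi_0(\delta2^{-j}k)\Big)_k\Big\|_{M_p}<\infty,$$ where the entry at $k=0$ is read as $0$ and the power of a negative number is the principal one. Then there is a constant $C>0$, independent of $f$ and $n$, such that for every $f\in\mathbf B^r_{p,\theta}(\mathbb T^d)$ and every $n\in\mathbb N$ ($n\ge1$) one has $f-T_n^Q(f)\in L_q(\mathbb T^d)$ and $$\|f-T_n^Q(f)\|_q\le C\,\|f\|_{\mathbf B^r_{p,\theta}}\begin{cases}2^{-rn}\,n^{(d-1)(1-\frac1\theta)},&q\le p,\\ 2^{-(r-\frac1p+\frac1q)n}\,n^{(d-1)(\frac1q-\frac1\theta)_+},&p<q<\infty,\\ 2^{-(r-\frac1p)n}\,n^{(d-1)(1-\frac1\theta)},&p<q=\infty.\end{cases}$$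 -/

import Mathlib

open MeasureTheory
open scoped ENNReal

noncomputable section

namespace Smolyak

/-- The circle `𝕋 = ℝ / 2πℤ`; `volume` is Lebesgue measure, of total mass `2π`. -/
abbrev Circ : Type := AddCircle (2 * Real.pi)

instance instTwoPiPos : Fact (0 < 2 * Real.pi) := ⟨Real.two_pi_pos⟩

/-- The torus `𝕋ᵈ`, with the (product) Lebesgue measure `volume`. -/
abbrev Torus (d : ℕ) : Type := Fin d → Circ

/-- The `ℓ¹`-norm of a multi-index. -/
def norm1 {d : ℕ} (j : Fin d → ℕ) : ℕ := ∑ i, j i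

/-! ### Function spaces -/

/-- The character `x ↦ exp (i (k, x))` of `𝕋ᵈ`. -/
def character {d : ℕ} (k : Fin d → ℤ) (x : Torus d) : ℂ := ∏ i, fourier (k i) (x i)

/-- The Fourier coefficient `(2π)⁻ᵈ ∫ f(x) exp (-i (k, x)) dx`. -/
def coeff {d : ℕ} (f : Torus d → ℂ) (k : Fin d → ℤ) : ℂ :=
  ((2 * Real.pi : ℝ) : ℂ)⁻¹ ^ d * ∫ x, f x * character (-k) x

/-- Smooth dyadic resolutions of unity, the class `Φ(ℝ)`.  (Compactness of the supports is
contained in the two support conditions.) -/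
structure IsResolution (φ : ℕ → ℝ → ℂ) : Prop where
  smooth : ∀ j, ContDiff ℝ (⊤ : ℕ∞) (φ j)
  supp_zero : tsupport (φ 0) ⊆ {ξ | |ξ| ≤ 2}
  supp_pos : ∀ j : ℕ, 1 ≤ j →
    tsupport (φ j) ⊆ {ξ | (2 : ℝ) ^ (j - 1) ≤ |ξ| ∧ |ξ| ≤ 2 ^ (j + 1)}
  deriv_bound : ∀ l : ℕ, ∃ c : ℝ, ∀ (j : ℕ) (ξ : ℝ),
    (2 : ℝ) ^ (j * l) * ‖iteratedDeriv l (φ j) ξ‖ ≤ c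
  sum_eq_one : ∀ ξ : ℝ, HasSum (fun j => φ j ξ) 1

/-- The dyadic block `δ_j(f)`; only finitely many terms of the series are nonzero. -/
def block {d : ℕ} (φ : ℕ → ℝ → ℂ) (j : Fin d → ℕ) (f : Torus d → ℂ) (x : Torus d) : ℂ :=
  ∑' k : Fin d → ℤ, (∏ i, φ (j i) (k i : ℝ)) * coeff f k * character k x

/-- The `ℓ_θ`-norm of a family of extended nonnegative numbers. -/
def ellNorm {ι : Type*} (θ : ℝ≥0∞) (a : ι → ℝ≥0∞) : ℝ≥0∞ :=
  if θ = ∞ then ⨆ j, a j else (∑' j, a j ^ θ.toReal) ^ (1 / θ.toReal)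

/-- The norm of the Besov space of dominating mixed smoothness `B^r_{p,θ}(𝕋ᵈ)`. -/
def besovNorm {d : ℕ} (φ : ℕ → ℝ → ℂ) (r : ℝ) (p θ : ℝ≥0∞) (f : Torus d → ℂ) : ℝ≥0∞ :=
  ellNorm θ fun j : Fin d → ℕ =>
    ENNReal.ofReal ((2 : ℝ) ^ (r * (norm1 j : ℝ))) * eLpNorm (block φ j f) p volume

/-- Membership in `B^r_{p,θ}(𝕋ᵈ)`. -/
def MemBesov {d : ℕ} (φ : ℕ → ℝ → ℂ) (r : ℝ) (p θ : ℝ≥0∞) (f : Torus d → ℂ) : Prop :=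
  Integrable f volume ∧ besovNorm φ r p θ f < ∞

/-! ### Univariate notions -/

/-- The convolution `(f * g)(x) = (2π)⁻¹ ∫ f(x - t) g(t) dt` on the circle. -/
def conv (f g : Circ → ℂ) (x : Circ) : ℂ :=
  ((2 * Real.pi : ℝ) : ℂ)⁻¹ * ∫ t, f (x - t) * g t

/-- The index set `A_j = [-2^{j-1}, 2^{j-1}) ∩ ℤ`. -/
def indexSet (j : ℕ) : Finset ℤ :=
  (Finset.Ico (-(2 : ℤ) ^ j) (2 ^ j)).filter
    fun k => -((2 : ℝ) ^ j / 2) ≤ (k : ℝ) ∧ (k : ℝ) < (2 : ℝ) ^ j / 2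

/-- The node `x_k^j = π k / 2^{j-1} = 2 π k / 2^j`, as a real number. -/
def node (j : ℕ) (k : ℤ) : ℝ := 2 * Real.pi * k / 2 ^ j

/-- The trigonometric polynomials `span {exp (i k x) : k ∈ [-2^j, 2^j) ∩ ℤ}`. -/
def trigPoly (j : ℕ) : Submodule ℂ (Circ → ℂ) :=
  Submodule.span ℂ ((fun (k : ℤ) (x : Circ) => fourier k x) '' Set.Ico (-(2 : ℤ) ^ j) (2 ^ j))

/-- The norm of a sequence as a Fourier multiplier in `L_p(𝕋)`: the least constant `C` such that
every `f ∈ L_p` has an image `g ∈ L_p` with `ĝ = l f̂` and `‖g‖_p ≤ C ‖f‖_p`;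
it is `∞` when the sequence is not a multiplier. -/
def multiplierNorm (p : ℝ≥0∞) (l : ℤ → ℂ) : ℝ≥0∞ :=
  sInf {C : ℝ≥0∞ | ∀ f : Circ → ℂ, MemLp f p volume →
    ∃ g : Circ → ℂ, MemLp g p volume ∧ (∀ k, fourierCoeff g k = l k * fourierCoeff f k) ∧
      eLpNorm g p volume ≤ C * eLpNorm f p volume}

/-- The norm of `𝓛_{q,j}(𝕋)`, that is
`(2^j ∫_{2^{-j}𝕋} (2^{-j} ∑_{k ∈ A_j} |g(x - x_k^j)|)^q dx)^{1/q}`, and the essential supremum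
of the inner sum for `q = ∞` (the inner sum is periodic with period `2π / 2^j`). -/
def scaledNorm (q : ℝ≥0∞) (j : ℕ) (g : Circ → ℂ) : ℝ≥0∞ :=
  eLpNorm
    (fun x : ℝ => ((2 : ℝ) ^ j)⁻¹ * ∑ k ∈ indexSet j, ‖g ((x - node j k : ℝ) : Circ)‖) q
    ((2 : ℝ≥0∞) ^ j •
      (volume : Measure ℝ).restrict (Set.Ico (-(Real.pi / 2 ^ j)) (Real.pi / 2 ^ j)))

/-- The compatibility condition of order `s`: for some `δ > 0` the sequences
`(1 - v̂_j(k) ŵ_j(k)) / (2^{-j} k)^s * φ₀(δ 2^{-j} k)` are Fourier multipliers in `L_p(𝕋)`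
with uniformly bounded norms.  The power is the principal one.  At `k = 0` the quotient is
meaningful only if its numerator vanishes, which is the first clause; it is then read as `0`. -/
def Compatible (p : ℝ≥0∞) (s : ℝ) (φ₀ : ℝ → ℂ) (v w : ℕ → Circ → ℂ) : Prop :=
  (∀ j, fourierCoeff (v j) 0 * fourierCoeff (w j) 0 = 1) ∧
  ∃ δ : ℝ, 0 < δ ∧
    (⨆ j : ℕ, multiplierNorm p (fun k : ℤ =>
      (1 - fourierCoeff (v j) k * fourierCoeff (w j) k) /
        (((k : ℝ) / 2 ^ j : ℝ) : ℂ) ^ (s : ℂ) * φ₀ (δ * ((k : ℝ) / 2 ^ j)))) < ∞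

/-! ### The operators -/

/-- The quasi-interpolation operator
`Q_j(f)(x) = 2^{-j} ∑_{k ∈ A_j} (f * w_j)(x_k^j) v_j(x - x_k^j)`. -/
def quasiInterp (v w : ℕ → Circ → ℂ) (j : ℕ) (f : Circ → ℂ) (x : Circ) : ℂ :=
  ((2 : ℂ) ^ j)⁻¹ *
    ∑ k ∈ indexSet j, conv f (w j) ((node j k : ℝ) : Circ) * v j (x - ((node j k : ℝ) : Circ))

/-- `Y_j - Y_{j-1}`, with `Y_{-1} = 0`. -/
def increment (Y : ℕ → (Circ → ℂ) → Circ → ℂ) : ℕ → (Circ → ℂ) → Circ → ℂ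
  | 0 => Y 0
  | j + 1 => fun f => Y (j + 1) f - Y j f

/-- The univariate operator `A` acting on functions on `𝕋ᵈ` in the variable `x_i`. -/
def inVariable {d : ℕ} (i : Fin d) (A : (Circ → ℂ) → Circ → ℂ) (F : Torus d → ℂ)
    (x : Torus d) : ℂ :=
  A (fun t => F (Function.update x i t)) (x i)

/-- `Δ_j^Y = ∏_{i=1}^d (Y_{j_i}^i - Y_{j_i-1}^i)`, a composition of operators. -/
def tensorIncrement {d : ℕ} (Y : ℕ → (Circ → ℂ) → Circ → ℂ) (j : Fin d → ℕ)
    (f : Torus d → ℂ) : Torus d → ℂ :=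
  (List.finRange d).foldr (fun i F => inVariable i (increment Y (j i)) F) f

/-- The Smolyak algorithm `T_n^Y = ∑_{|j|₁ ≤ n} Δ_j^Y`. -/
def smolyak {d : ℕ} (Y : ℕ → (Circ → ℂ) → Circ → ℂ) (n : ℕ) (f : Torus d → ℂ) : Torus d → ℂ :=
  ∑ j ∈ (Fintype.piFinset fun _ : Fin d => Finset.range (n + 1)).filter (fun j => norm1 j ≤ n),
    tensorIncrement Y j f

/-- The rate of convergence; `(1 / p).toReal` is `1/p`, with the value `0` for `p = ∞`. -/
def rate (d : ℕ) (p q θ : ℝ≥0∞) (r : ℝ) (n : ℕ) : ℝ :=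
  if q ≤ p then
    (2 : ℝ) ^ (-r * n) * (n : ℝ) ^ (((d : ℝ) - 1) * (1 - (1 / θ).toReal))
  else if q < ∞ then
    (2 : ℝ) ^ (-(r - (1 / p).toReal + (1 / q).toReal) * n) *
      (n : ℝ) ^ (((d : ℝ) - 1) * max ((1 / q).toReal - (1 / θ).toReal) 0)
  else
    (2 : ℝ) ^ (-(r - (1 / p).toReal) * n) * (n : ℝ) ^ (((d : ℝ) - 1) * (1 - (1 / θ).toReal))

end Smolyak

end

/-!
The error `f - T_n^Q f` is the sum of the increments `Δ_j f`, `Δ_j = ∏_i (Q_{j_i} - Q_{j_i - 1})`,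
over `|j|₁ > n`.  The proof shows that the increments have the same decay as the dyadic blocks of
`f`, and that they can be summed in `L_q` as if they were dyadic blocks.

*One variable.*  The operators `Q_j` are uniformly bounded in `L_p`
(`exists_eLpNorm_quasiInterp_le`): with `φ_j` replaced by a kernel that reproduces the polynomials
of degree `2^j`, and that has a Fejér majorant, `Q_j` is dominated by a positive kernel to which a
weighted Schur test applies, the weight being the mean over the nodes that defines the scaled norm
of `φ̃_j` (`exists_eLpNorm_sampling_le`); the multiplier `(φ̂_j(k))_k` then restores `φ_j`.  On
frequencies of size `2^k`, small against `2^j`, there is no aliasing, because of the band limitation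
of `φ_j`, and `I - Q_j` is the multiplier of the compatibility condition after a fractional
derivative of order `s`, scaled by `2^{-js}`.  With Bernstein's inequality on the block
(`exists_eLpNorm_cpow_le`), this yields the norm `O(2^{-s(j-k)_+})` of `Q_j - Q_{j-1}` on the block
(`exists_eLpNorm_increment_le`).  The structure `IsDyadicScheme` records what is needed later.

*Several variables.*  The univariate bounds multiply (`eLpNorm_tensor_le`), so that
`‖Δ_j δ_k f‖_p ≲ ∏_i 2^{-s(j_i-k_i)_+} ‖δ_k f‖_p`.  As `0 < r < s`, the matrix
`∏_i 2^{-s(j_i-k_i)_+ + r(j_i-k_i)}` is bounded on `ℓ_θ` (`ellNorm_decay_le`), and the majorants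
`G_j = ∑_k |Δ_j δ_k f|` of the increments satisfy `‖(2^{r|j|₁} ‖G_j‖_p)_j‖_{ℓ_θ} ≲ ‖f‖_B`
(`exists_eLpNorm_incrementMajorant_le`).  Almost everywhere, the error is at most
`∑_{|j|₁ > n} G_j` (`ae_enorm_sub_smolyak_le`).

*Summation.*  For `q ≤ p` the triangle inequality in `L_p` suffices.  For `q > p`, each `G_j` is
dominated by its image under a tensor product of Fejér kernels of degrees `2^{j_i}`, which gives
the Nikolskii inequality, hence the case `q = ∞`.  For `p < q < ∞` it gives the embedding of
`B^{1/p-1/q}_{p,q}` into `L_q` for nonnegative functions instead of dyadic blocks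
(`kernelEmbedding_torus`): in one variable the `q`-th power of the sum is expanded along partial
sums (`lintegral_tsum_rpow_le`), and Minkowski's inequality passes to products
(`KernelEmbedding.prod`).  In all cases there remains the norm of a weighted sequence over
`|j|₁ > n`, and the power of `n` comes from Hölder's inequality and the number of multi-indices of a
given length (`eLpNorm_tail_le`).
-/

namespace Smolyak

/-! ### Integral inequalities -/

section Toolbox

variable {X Y : Type*} [MeasurableSpace X] [MeasurableSpace Y]

theorem eLpNorm_eq_lintegral_rpow {μ : Measure X} {p : ℝ} (hp : 0 < p) (f : X → ℝ≥0∞) :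
    eLpNorm f (ENNReal.ofReal p) μ = (∫⁻ x, f x ^ p ∂μ) ^ (1 / p) := by
  rw [eLpNorm_eq_lintegral_rpow_enorm_toReal (by simpa using hp) ENNReal.ofReal_ne_top,
    ENNReal.toReal_ofReal hp.le]
  simp

theorem le_of_rpow_le_rpow_mul {p p' : ℝ} (h : p.HolderConjugate p') {I M : ℝ≥0∞} (hI : I ≠ ∞)
    (hle : I ≤ I ^ (1 / p') * M) : I ^ (1 / p) ≤ M := by
  have hp0 := h.pos
  have hp0' := h.symm.pos
  rcases eq_or_ne I 0 with h0 | h0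
  · simp [h0, hp0]
  have hsum : (1 : ℝ) = 1 / p' + 1 / p := by
    have := h.inv_add_inv_eq_one
    simp only [one_div]; linarith
  have h1 : I ^ (1 / p') ≠ 0 := by simp [h0, hI]
  have h2 : I ^ (1 / p') ≠ ∞ := by simp [h0, hI]
  have h3 : I = I ^ (1 / p') * I ^ (1 / p) := by
    rw [← ENNReal.rpow_add _ _ h0 hI, ← hsum, ENNReal.rpow_one]
  have h4 : I ^ (1 / p') * I ^ (1 / p) ≤ I ^ (1 / p') * M := h3 ▸ hle
  exact (ENNReal.mul_le_mul_iff_right h1 h2).1 h4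

/-- Minkowski's integral inequality for nonnegative functions. -/
theorem lintegral_rpow_lintegral_le {μ : Measure X} [IsFiniteMeasure μ] {ν : Measure Y} [SFinite ν]
    {p : ℝ} (hp : 1 ≤ p) {G : X → Y → ℝ≥0∞} (hG : Measurable (Function.uncurry G)) :
    (∫⁻ x, (∫⁻ u, G x u ∂ν) ^ p ∂μ) ^ (1 / p) ≤ ∫⁻ u, (∫⁻ x, G x u ^ p ∂μ) ^ (1 / p) ∂ν := by
  rcases hp.eq_or_lt with rfl | hp1
  · simp only [ENNReal.rpow_one, div_one]
    exact (lintegral_lintegral_swap hG.aemeasurable).le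
  have hp0 : 0 < p := by linarith
  have hconj := Real.HolderConjugate.conjExponent hp1
  set p' := p.conjExponent
  have hpp : (p - 1) * p' = p := hconj.sub_one_mul_conj
  set M := ∫⁻ u, (∫⁻ x, G x u ^ p ∂μ) ^ (1 / p) ∂ν
  set S : X → ℝ≥0∞ := fun x => ∫⁻ u, G x u ∂ν
  have hS : Measurable S := hG.lintegral_prod_right'
  -- the truncations make the integral that is to be divided out finite
  set T : ℕ → X → ℝ≥0∞ := fun n x => min (S x) n
  have hT : ∀ n, Measurable (T n) := fun n => hS.min measurable_const
  have key : ∀ n, ∫⁻ x, T n x ^ p ∂μ ≤ M ^ p := by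
    intro n
    have hfin : ∫⁻ x, T n x ^ p ∂μ ≠ ∞ := by
      refine ne_top_of_le_ne_top ?_ (lintegral_mono (g := fun _ => (n : ℝ≥0∞) ^ p) fun x =>
        ENNReal.rpow_le_rpow (min_le_right _ _) hp0.le)
      rw [lintegral_const]
      exact ENNReal.mul_ne_top (by simp [hp0.le]) (measure_ne_top _ _)
    have h1 : ∫⁻ x, T n x ^ p ∂μ ≤ (∫⁻ x, T n x ^ p ∂μ) ^ (1 / p') * M := by
      calc ∫⁻ x, T n x ^ p ∂μ ≤ ∫⁻ x, ∫⁻ u, T n x ^ (p - 1) * G x u ∂ν ∂μ := by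
            refine lintegral_mono fun x => ?_
            have hGx : Measurable (G x) := hG.comp measurable_prodMk_left
            simp only [lintegral_const_mul _ hGx]
            calc T n x ^ p = T n x ^ (p - 1) * T n x := by
                  nth_rewrite 3 [← ENNReal.rpow_one (T n x)]
                  rw [← ENNReal.rpow_add_of_nonneg _ _ (by linarith) zero_le_one]
                  simp
              _ ≤ _ := mul_le_mul_right (min_le_left _ _) _
        _ = ∫⁻ u, ∫⁻ x, T n x ^ (p - 1) * G x u ∂μ ∂ν := by
            refine lintegral_lintegral_swap (Measurable.aemeasurable ?_)
            exact (((hT n).pow_const _).comp measurable_fst).mul hG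
        _ ≤ ∫⁻ u, (∫⁻ x, T n x ^ p ∂μ) ^ (1 / p') * (∫⁻ x, G x u ^ p ∂μ) ^ (1 / p) ∂ν := by
            refine lintegral_mono fun u => ?_
            have hGu : Measurable fun x => G x u := hG.comp measurable_prodMk_right
            refine (ENNReal.lintegral_mul_le_Lp_mul_Lq μ hconj.symm
              ((hT n).pow_const (p - 1)).aemeasurable hGu.aemeasurable).trans_eq ?_
            simp only [← ENNReal.rpow_mul, hpp]
        _ = _ := by
            rw [lintegral_const_mul]
            exact Measurable.pow_const
              ((hG.pow_const p).lintegral_prod_left') _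
    have h2 := le_of_rpow_le_rpow_mul hconj hfin h1
    calc ∫⁻ x, T n x ^ p ∂μ = ((∫⁻ x, T n x ^ p ∂μ) ^ (1 / p)) ^ p := by
          rw [← ENNReal.rpow_mul]; simp [hp0.ne']
      _ ≤ _ := ENNReal.rpow_le_rpow h2 hp0.le
  have hmono : ∀ x, Monotone fun n => T n x ^ p := fun x m n hmn =>
    ENNReal.rpow_le_rpow (min_le_min le_rfl (by exact_mod_cast hmn)) hp0.le
  have hsup : ∀ x, ⨆ n, T n x ^ p = S x ^ p := by
    intro x
    apply le_antisymm
    · exact iSup_le fun n => ENNReal.rpow_le_rpow (min_le_left _ _) hp0.le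
    · rcases eq_or_ne (S x) ∞ with h | h
      · have : ∀ n : ℕ, ((n : ℝ≥0∞)) ≤ ⨆ n, T n x := fun n => le_iSup_of_le n (by simp [T, h])
        have htop : ⨆ n, T n x = ∞ := by
          refine ENNReal.eq_top_of_forall_nnreal_le fun r => ?_
          obtain ⟨n, hn⟩ := exists_nat_ge r
          exact le_trans (by exact_mod_cast hn) (this n)
        have hm := (ENNReal.orderIsoRpow p hp0).map_iSup fun n => T n x
        simp only [ENNReal.orderIsoRpow_apply] at hm
        rw [← hm, htop, h]
      · obtain ⟨n, hn⟩ := ENNReal.exists_nat_gt h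
        refine le_iSup_of_le n ?_
        simp [T, hn.le]
  have hfinal : ∫⁻ x, S x ^ p ∂μ ≤ M ^ p := by
    calc ∫⁻ x, S x ^ p ∂μ = ∫⁻ x, ⨆ n, T n x ^ p ∂μ := by simp_rw [hsup]
      _ = ⨆ n, ∫⁻ x, T n x ^ p ∂μ := lintegral_iSup (fun n => (hT n).pow_const p)
          (fun m n hmn x => hmono x hmn)
      _ ≤ M ^ p := iSup_le key
  calc (∫⁻ x, S x ^ p ∂μ) ^ (1 / p) ≤ (M ^ p) ^ (1 / p) :=
        ENNReal.rpow_le_rpow hfinal (by positivity)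
    _ = M := by rw [← ENNReal.rpow_mul]; simp [hp0.ne']

/-- The Schur test with a weight on one side, for `1 < p < ∞`: Hölder's inequality in `t` for
`N(x, t) f(t) = (N^{1/p'} ω^{1/p}) (N^{1/p} ω^{-1/p} f)`, followed by Fubini's theorem. -/
theorem lintegral_rpow_kernel_le {μ : Measure X} [SFinite μ] {ν : Measure Y} [SFinite ν]
    {p p' : ℝ} (hp : p.HolderConjugate p') {N : X → Y → ℝ≥0∞} {f ω : Y → ℝ≥0∞}
    (hN : Measurable (Function.uncurry N)) (hf : Measurable f) (hω : Measurable ω)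
    (hω0 : ∀ t, ω t ≠ 0) (hωt : ∀ t, ω t ≠ ∞) {A B : ℝ≥0∞}
    (hA : ∀ x, ∫⁻ t, N x t * ω t ^ (p' - 1) ∂ν ≤ A) (hB : ∀ t, ∫⁻ x, N x t ∂μ ≤ B * ω t) :
    ∫⁻ x, (∫⁻ t, N x t * f t ∂ν) ^ p ∂μ ≤ A ^ (p - 1) * B * ∫⁻ t, f t ^ p ∂ν := by
  have hp0 := hp.pos
  have hp0' := hp.symm.pos
  have hsum : 1 / p + 1 / p' = 1 := by simpa [one_div] using hp.inv_add_inv_eq_one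
  have e1 : (1 / p') * p = p - 1 := by
    have : 1 / p' = 1 - 1 / p := by linarith
    rw [this]; field_simp
  have e2 : (1 / p) * p' = p' - 1 := by
    have : 1 / p = 1 - 1 / p' := by linarith
    rw [this]; field_simp
  have hNx : ∀ x, Measurable (N x) := fun x => hN.comp measurable_prodMk_left
  have h1 : ∀ x, (∫⁻ t, N x t * f t ∂ν) ^ p ≤
      A ^ (p - 1) * ∫⁻ t, N x t * (f t ^ p * (ω t)⁻¹) ∂ν := by
    intro x
    have hsplit : ∀ t, N x t * f t =
        (N x t ^ (1 / p) * f t * (ω t)⁻¹ ^ (1 / p)) * (N x t ^ (1 / p') * ω t ^ (1 / p)) := by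
      intro t
      have a1 : N x t ^ (1 / p) * N x t ^ (1 / p') = N x t := by
        rw [← ENNReal.rpow_add_of_nonneg _ _ (by positivity) (by positivity), hsum,
          ENNReal.rpow_one]
      have a2 : (ω t)⁻¹ ^ (1 / p) * ω t ^ (1 / p) = 1 := by
        rw [← ENNReal.mul_rpow_of_nonneg _ _ (by positivity),
          ENNReal.inv_mul_cancel (hω0 t) (hωt t), ENNReal.one_rpow]
      calc N x t * f t = (N x t ^ (1 / p) * N x t ^ (1 / p')) * f t *
            ((ω t)⁻¹ ^ (1 / p) * ω t ^ (1 / p)) := by rw [a1, a2, mul_one]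
        _ = _ := by ring
    have hH := ENNReal.lintegral_mul_le_Lp_mul_Lq ν hp
      (f := fun t => N x t ^ (1 / p) * f t * (ω t)⁻¹ ^ (1 / p))
      (g := fun t => N x t ^ (1 / p') * ω t ^ (1 / p))
      ((((hNx x).pow_const _).mul hf).mul (hω.inv.pow_const _)).aemeasurable
      (((hNx x).pow_const _).mul (hω.pow_const _)).aemeasurable
    simp only [Pi.mul_apply, ← hsplit] at hH
    have b1 : ∀ t, (N x t ^ (1 / p) * f t * (ω t)⁻¹ ^ (1 / p)) ^ p =
        N x t * (f t ^ p * (ω t)⁻¹) := by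
      intro t
      rw [ENNReal.mul_rpow_of_nonneg _ _ hp0.le, ENNReal.mul_rpow_of_nonneg _ _ hp0.le,
        ← ENNReal.rpow_mul, ← ENNReal.rpow_mul, one_div_mul_cancel hp0.ne', ENNReal.rpow_one,
        ENNReal.rpow_one, mul_assoc]
    have b2 : ∀ t, (N x t ^ (1 / p') * ω t ^ (1 / p)) ^ p' = N x t * ω t ^ (p' - 1) := by
      intro t
      rw [ENNReal.mul_rpow_of_nonneg _ _ hp0'.le, ← ENNReal.rpow_mul, ← ENNReal.rpow_mul,
        one_div_mul_cancel hp0'.ne', ENNReal.rpow_one, e2]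
    simp only [b1, b2] at hH
    calc (∫⁻ t, N x t * f t ∂ν) ^ p
        ≤ ((∫⁻ t, N x t * (f t ^ p * (ω t)⁻¹) ∂ν) ^ (1 / p) * A ^ (1 / p')) ^ p :=
          ENNReal.rpow_le_rpow (hH.trans (mul_le_mul_right
            (ENNReal.rpow_le_rpow (hA x) (by positivity)) _)) hp0.le
      _ = _ := by
          rw [ENNReal.mul_rpow_of_nonneg _ _ hp0.le, ← ENNReal.rpow_mul, ← ENNReal.rpow_mul,
            one_div_mul_cancel hp0.ne', ENNReal.rpow_one, e1, mul_comm]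
  have hm : Measurable fun t => f t ^ p * (ω t)⁻¹ := (hf.pow_const p).mul hω.inv
  calc ∫⁻ x, (∫⁻ t, N x t * f t ∂ν) ^ p ∂μ
      ≤ ∫⁻ x, A ^ (p - 1) * ∫⁻ t, N x t * (f t ^ p * (ω t)⁻¹) ∂ν ∂μ := lintegral_mono h1
    _ = A ^ (p - 1) * ∫⁻ x, ∫⁻ t, N x t * (f t ^ p * (ω t)⁻¹) ∂ν ∂μ := by
        rw [lintegral_const_mul]
        exact (hN.mul (hm.comp measurable_snd)).lintegral_prod_right'
    _ = A ^ (p - 1) * ∫⁻ t, ∫⁻ x, N x t * (f t ^ p * (ω t)⁻¹) ∂μ ∂ν := by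
        rw [lintegral_lintegral_swap (hN.mul (hm.comp measurable_snd)).aemeasurable]
    _ ≤ A ^ (p - 1) * ∫⁻ t, B * f t ^ p ∂ν := by
        refine mul_le_mul_right (lintegral_mono fun t => ?_) _
        have hNt : Measurable fun x => N x t := hN.comp measurable_prodMk_right
        rw [lintegral_mul_const _ hNt]
        calc (∫⁻ x, N x t ∂μ) * (f t ^ p * (ω t)⁻¹) ≤ B * ω t * (f t ^ p * (ω t)⁻¹) :=
              mul_le_mul_left (hB t) _
          _ = B * f t ^ p * (ω t * (ω t)⁻¹) := by ring
          _ = B * f t ^ p := by rw [ENNReal.mul_inv_cancel (hω0 t) (hωt t), mul_one]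
    _ = _ := by rw [lintegral_const_mul _ (hf.pow_const p), mul_assoc]

/-- The Schur test for `p = 1`. -/
theorem lintegral_kernel_le {μ : Measure X} [SFinite μ] {ν : Measure Y} [SFinite ν]
    {N : X → Y → ℝ≥0∞} {f : Y → ℝ≥0∞} (hN : Measurable (Function.uncurry N)) (hf : Measurable f)
    {B : ℝ≥0∞} (hB : ∀ᵐ t ∂ν, ∫⁻ x, N x t ∂μ ≤ B) :
    ∫⁻ x, ∫⁻ t, N x t * f t ∂ν ∂μ ≤ B * ∫⁻ t, f t ∂ν := by
  rw [lintegral_lintegral_swap (hN.mul (hf.comp measurable_snd)).aemeasurable,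
    ← lintegral_const_mul _ hf]
  refine lintegral_mono_ae (hB.mono fun t ht => ?_)
  have hNt : Measurable fun x => N x t := hN.comp measurable_prodMk_right
  rw [lintegral_mul_const _ hNt]
  exact mul_le_mul_left ht _

/-- The Schur test for `p = ∞`. -/
theorem essSup_kernel_le {μ : Measure X} {ν : Measure Y}
    {N : X → Y → ℝ≥0∞} {f : Y → ℝ≥0∞} (hN : ∀ x, Measurable (N x))
    {A : ℝ≥0∞} (hA : ∀ x, ∫⁻ t, N x t ∂ν ≤ A) :
    eLpNorm (fun x => ∫⁻ t, N x t * f t ∂ν) ∞ μ ≤ A * eLpNorm f ∞ ν := by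
  rw [eLpNorm_exponent_top, eLpNorm_exponent_top]
  refine eLpNormEssSup_le_of_ae_enorm_bound (Filter.Eventually.of_forall fun x => ?_)
  simp only [enorm_eq_self]
  calc ∫⁻ t, N x t * f t ∂ν ≤ ∫⁻ t, N x t * eLpNormEssSup f ν ∂ν := by
        refine lintegral_mono_ae ?_
        filter_upwards [enorm_ae_le_eLpNormEssSup f ν] with t ht
        exact mul_le_mul_right (by simpa using ht) _
    _ = (∫⁻ t, N x t ∂ν) * eLpNormEssSup f ν := lintegral_mul_const _ (hN x)
    _ ≤ _ := mul_le_mul_left (hA x) _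

/-- The Schur test: a kernel with bounded marginals acts on `L_p`, `1 ≤ p ≤ ∞`. -/
theorem eLpNorm_kernel_le {μ : Measure X} [SFinite μ] {ν : Measure Y} [SFinite ν]
    {p : ℝ≥0∞} (hp : 1 ≤ p) {N : X → Y → ℝ≥0∞} {f : Y → ℝ≥0∞}
    (hN : Measurable (Function.uncurry N)) (hf : Measurable f) {A : ℝ≥0∞}
    (hA : ∀ x, ∫⁻ t, N x t ∂ν ≤ A) (hB : ∀ t, ∫⁻ x, N x t ∂μ ≤ A) :
    eLpNorm (fun x => ∫⁻ t, N x t * f t ∂ν) p μ ≤ A * eLpNorm f p ν := by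
  rcases eq_or_ne p ∞ with rfl | hpt
  · exact essSup_kernel_le (fun x => hN.comp measurable_prodMk_left) hA
  rcases hp.eq_or_lt with rfl | hp1
  · simp only [eLpNorm_one_eq_lintegral_enorm, enorm_eq_self]
    exact lintegral_kernel_le hN hf (Filter.Eventually.of_forall hB)
  have hp1' : 1 < p.toReal := by
    rw [← ENNReal.toReal_one]; exact (ENNReal.toReal_lt_toReal ENNReal.one_ne_top hpt).2 hp1
  have hp0 : 0 < p.toReal := by linarith
  have hconj := Real.HolderConjugate.conjExponent hp1'
  have h := lintegral_rpow_kernel_le (μ := μ) (ν := ν) hconj hN hf (ω := fun _ => 1)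
    measurable_const (by simp) (by simp) (A := A) (B := A) (by simpa using hA) (by simpa using hB)
  rw [← ENNReal.ofReal_toReal hpt, eLpNorm_eq_lintegral_rpow hp0, eLpNorm_eq_lintegral_rpow hp0]
  have hAA : A ^ (p.toReal - 1) * A = A ^ p.toReal := by
    nth_rewrite 2 [← ENNReal.rpow_one A]
    rw [← ENNReal.rpow_add_of_nonneg _ _ (by linarith) zero_le_one]; simp
  rw [hAA] at h
  calc _ ≤ (A ^ p.toReal * ∫⁻ t, f t ^ p.toReal ∂ν) ^ (1 / p.toReal) :=
        ENNReal.rpow_le_rpow h (by positivity)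
    _ = _ := by
        rw [ENNReal.mul_rpow_of_nonneg _ _ (by positivity), ← ENNReal.rpow_mul,
          mul_one_div_cancel hp0.ne', ENNReal.rpow_one]

/-- Countable triangle inequality in `L_p` for nonnegative functions. -/
theorem eLpNorm_tsum_le {ι : Type*} [Countable ι] {μ : Measure X} [IsFiniteMeasure μ] {p : ℝ≥0∞}
    (hp : 1 ≤ p) {G : ι → X → ℝ≥0∞} (hG : ∀ i, Measurable (G i)) :
    eLpNorm (fun x => ∑' i, G i x) p μ ≤ ∑' i, eLpNorm (G i) p μ := by
  rcases eq_or_ne p ∞ with rfl | hpt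
  · simp only [eLpNorm_exponent_top]
    refine eLpNormEssSup_le_of_ae_enorm_bound ?_
    have : ∀ᵐ x ∂μ, ∀ i, ‖G i x‖ₑ ≤ eLpNormEssSup (G i) μ :=
      ae_all_iff.2 fun i => enorm_ae_le_eLpNormEssSup (G i) μ
    filter_upwards [this] with x hx
    simpa using ENNReal.tsum_le_tsum hx
  have hp1 : 1 ≤ p.toReal := by
    rw [← ENNReal.toReal_one]; exact (ENNReal.toReal_le_toReal ENNReal.one_ne_top hpt).2 hp
  have hp0 : 0 < p.toReal := by linarith
  let _ : MeasurableSpace ι := ⊤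
  have : MeasurableSingletonClass ι := ⟨fun _ => trivial⟩
  have hm : Measurable (Function.uncurry fun x i => G i x) :=
    measurable_from_prod_countable_left hG
  have h := lintegral_rpow_lintegral_le (μ := μ) (ν := (Measure.count : Measure ι)) hp1 hm
  simp only [lintegral_count] at h
  rw [← ENNReal.ofReal_toReal hpt]
  simpa only [eLpNorm_eq_lintegral_rpow hp0] using h

end Toolbox

/-! ### Sums of functions balanced around an exponent -/

/-- The tangent of the convex function `x ↦ x^q` at `a + b` lies below the graph at `a`. -/
theorem add_rpow_le_rpow_add_mul {q : ℝ} (hq : 1 ≤ q) (a b : ℝ≥0∞) :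
    (a + b) ^ q ≤ a ^ q + ENNReal.ofReal q * (b * (a + b) ^ (q - 1)) := by
  have hq0 : 0 < q := by linarith
  rcases eq_or_ne a ∞ with rfl | ha
  · simp [hq0]
  rcases eq_or_ne b ∞ with rfl | hb
  · have h2 : (∞ : ℝ≥0∞) ^ (q - 1) ≠ 0 := by
      simp only [ne_eq, ENNReal.rpow_eq_zero_iff, ENNReal.top_ne_zero, true_and, false_and,
        false_or, not_lt]
      linarith
    have h3 : ENNReal.ofReal q ≠ 0 := by simpa using hq0
    rw [add_top, ENNReal.top_mul h2, ENNReal.mul_top h3, add_top]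
    exact le_top
  lift a to NNReal using ha
  lift b to NNReal using hb
  rcases eq_or_ne (a + b) 0 with h0 | h0
  · obtain ⟨rfl, rfl⟩ := add_eq_zero.1 h0
    simp [hq0]
  have hx : (0 : ℝ) < a + b := lt_of_le_of_ne (by positivity) (by exact_mod_cast h0.symm)
  have hreal : ((a : ℝ) + b) ^ q ≤ (a : ℝ) ^ q + q * (b * ((a : ℝ) + b) ^ (q - 1)) := by
    have hB := one_add_mul_self_le_rpow_one_add (s := -(b / (a + b) : ℝ)) (by
      rw [neg_le_neg_iff, div_le_one hx]; linarith [a.coe_nonneg]) hq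
    have h1 : 1 + -(b / (a + b) : ℝ) = a / (a + b) := by field_simp; ring
    rw [h1, Real.div_rpow a.coe_nonneg hx.le] at hB
    have hxq : 0 < ((a : ℝ) + b) ^ q := Real.rpow_pos_of_pos hx q
    rw [le_div_iff₀ hxq] at hB
    have h2 : ((a : ℝ) + b) ^ q = (a + b) * ((a : ℝ) + b) ^ (q - 1) := by
      rw [← Real.rpow_one_add' hx.le (by linarith)]; congr 1; ring
    have h3 : (1 + q * -(b / (a + b) : ℝ)) * ((a : ℝ) + b) ^ q =
        ((a : ℝ) + b) ^ q - q * (b * ((a : ℝ) + b) ^ (q - 1)) := by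
      rw [h2]; field_simp; ring
    linarith
  have e1 : ((a : ℝ≥0∞) + b) = ((a + b : NNReal) : ℝ≥0∞) := by push_cast; rfl
  rw [e1, ← ENNReal.coe_rpow_of_nonneg _ hq0.le, ← ENNReal.coe_rpow_of_nonneg _ hq0.le,
    ← ENNReal.coe_rpow_of_nonneg _ (by linarith : 0 ≤ q - 1), ENNReal.ofReal,
    ← ENNReal.coe_mul, ← ENNReal.coe_mul, ← ENNReal.coe_add, ENNReal.coe_le_coe,
    ← NNReal.coe_le_coe]
  push_cast
  rwa [Real.coe_toNNReal _ hq0.le]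

/-- The discrete form of `S^q = ∫ q S^{q-1} dS`: the `q`-th power of a sum in terms of the
partial sums. -/
theorem sum_rpow_le {q : ℝ} (hq : 1 ≤ q) (g : ℕ → ℝ≥0∞) (N : ℕ) :
    (∑ j ∈ Finset.range N, g j) ^ q ≤ ENNReal.ofReal q *
      ∑ J ∈ Finset.range N, g J * (∑ j ∈ Finset.range (J + 1), g j) ^ (q - 1) := by
  induction N with
  | zero => simp; linarith
  | succ N ih =>
    rw [Finset.sum_range_succ (fun J => g J * _), mul_add]
    nth_rewrite 1 [Finset.sum_range_succ]
    refine (add_rpow_le_rpow_add_mul hq _ _).trans (add_le_add ih ?_)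
    rw [Finset.sum_range_succ g]

theorem two_rpow_add (x y : ℝ) : (2 : ℝ≥0∞) ^ (x + y) = 2 ^ x * 2 ^ y :=
  ENNReal.rpow_add _ _ (by simp) (by simp)

theorem tsum_two_rpow_ne_top {ε : ℝ} (hε : 0 < ε) : ∑' l : ℕ, (2 : ℝ≥0∞) ^ (-(ε * l)) ≠ ∞ := by
  have h : ∀ l : ℕ, (2 : ℝ≥0∞) ^ (-(ε * l)) = ((2 : ℝ≥0∞) ^ (-ε)) ^ l := by
    intro l
    rw [← ENNReal.rpow_natCast, ← ENNReal.rpow_mul]; congr 1; ring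
  simp_rw [h]
  rw [ENNReal.tsum_geometric]
  have : (2 : ℝ≥0∞) ^ (-ε) < 1 := ENNReal.rpow_lt_one_of_one_lt_of_neg (by norm_num) (by linarith)
  simpa [tsub_eq_zero_iff_le] using this

/-- Row sums of the matrix `2^{-ε (J - j)}`, `j ≤ J`. -/
theorem tsum_geometric_kernel_le {ε : ℝ} (J : ℕ) :
    ∑' j : ℕ, (if j ≤ J then (2 : ℝ≥0∞) ^ (-(ε * ((J : ℝ) - j))) else 0) ≤
      ∑' l : ℕ, (2 : ℝ≥0∞) ^ (-(ε * l)) := by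
  rw [tsum_eq_sum (s := Finset.range (J + 1)) (by
    intro b hb
    rw [if_neg]; simpa [Nat.lt_succ_iff] using hb)]
  rw [← Finset.sum_range_reflect]
  refine le_trans (Finset.sum_le_sum fun j hj => ?_) (ENNReal.sum_le_tsum (Finset.range (J + 1)))
  have hj' : j ≤ J := Nat.lt_succ_iff.1 (Finset.mem_range.1 hj)
  rw [if_pos (by omega)]
  have : J + 1 - 1 - j = J - j := by omega
  rw [this, Nat.cast_sub hj']
  simp

/-- Column sums of the matrix `2^{-ε (J - j)}`, `j ≤ J`. -/
theorem tsum_geometric_kernel_le' {ε : ℝ} (j : ℕ) :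
    ∑' J : ℕ, (if j ≤ J then (2 : ℝ≥0∞) ^ (-(ε * ((J : ℝ) - j))) else 0) ≤
      ∑' l : ℕ, (2 : ℝ≥0∞) ^ (-(ε * l)) := by
  rw [← ENNReal.summable.sum_add_tsum_nat_add' (k := j)]
  rw [Finset.sum_eq_zero, zero_add]
  · refine ENNReal.tsum_le_tsum fun l => ?_
    rw [if_pos (by omega)]; simp
  · intro i hi
    rw [if_neg]; simpa using hi

/-- Young's inequality for the convolution of a sequence on `ℕ` with a geometric sequence. -/
theorem tsum_rpow_geometric_conv_le {ε q : ℝ} (hε : 0 < ε) (hq : 1 ≤ q) :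
    ∃ C : ℝ≥0∞, C ≠ ∞ ∧ ∀ a : ℕ → ℝ≥0∞,
      ∑' J : ℕ, (2 ^ (-(ε * J)) * ∑ j ∈ Finset.range (J + 1), 2 ^ (ε * j) * a j) ^ q ≤
        C * ∑' j, a j ^ q := by
  have hq0 : 0 < q := by linarith
  refine ⟨(∑' l : ℕ, (2 : ℝ≥0∞) ^ (-(ε * l))) ^ q,
    ENNReal.rpow_ne_top_of_nonneg hq0.le (tsum_two_rpow_ne_top hε), fun a => ?_⟩
  have h := eLpNorm_kernel_le (μ := (Measure.count : Measure ℕ)) (ν := (Measure.count : Measure ℕ))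
    (p := ENNReal.ofReal q) (by simpa using hq)
    (N := fun J j => if j ≤ J then (2 : ℝ≥0∞) ^ (-(ε * ((J : ℝ) - j))) else 0) (f := a)
    (measurable_of_countable _) (measurable_of_countable _)
    (A := ∑' l : ℕ, (2 : ℝ≥0∞) ^ (-(ε * l)))
    (by intro J; rw [lintegral_count]; exact tsum_geometric_kernel_le J)
    (by intro J; rw [lintegral_count]; exact tsum_geometric_kernel_le' J)
  rw [eLpNorm_eq_lintegral_rpow hq0, eLpNorm_eq_lintegral_rpow hq0] at h
  simp only [lintegral_count] at h
  have h' := ENNReal.rpow_le_rpow h hq0.le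
  rw [ENNReal.mul_rpow_of_nonneg _ _ hq0.le, ← ENNReal.rpow_mul, ← ENNReal.rpow_mul,
    one_div_mul_cancel hq0.ne', ENNReal.rpow_one, ENNReal.rpow_one] at h'
  refine le_trans (le_of_eq (tsum_congr fun J => ?_)) h'
  congr 1
  rw [tsum_eq_sum (s := Finset.range (J + 1)) (by
    intro b hb
    rw [if_neg, zero_mul]; simpa [Nat.lt_succ_iff] using hb), Finset.mul_sum]
  refine Finset.sum_congr rfl fun j hj => ?_
  rw [if_pos (Nat.lt_succ_iff.1 (Finset.mem_range.1 hj)), ← mul_assoc, ← two_rpow_add]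
  congr 2; ring

section

variable {X : Type*} [MeasurableSpace X] {μ : Measure X}

/-- Interpolation between `L_p` and `L_∞`. -/
theorem lintegral_rpow_interp_le {G : X → ℝ≥0∞} {p v : ℝ} (hp : 0 ≤ p) (hpv : p ≤ v)
    (hG : Measurable G) {B : ℝ≥0∞} (hB : ∀ x, G x ≤ B) :
    ∫⁻ x, G x ^ v ∂μ ≤ B ^ (v - p) * ∫⁻ x, G x ^ p ∂μ := by
  rw [← lintegral_const_mul _ (hG.pow_const p)]
  refine lintegral_mono fun x => ?_
  have : G x ^ v = G x ^ (v - p) * G x ^ p := by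
    rw [← ENNReal.rpow_add_of_nonneg _ _ (by linarith) hp]; simp
  rw [this]
  exact mul_le_mul_left (ENNReal.rpow_le_rpow (hB x) (by linarith)) _

/-- The Hölder step: `∫ G_J S_J^{q-1}`, where `S_J` is a partial sum, is controlled by the
`L_p`-norm of `G_J` and by the `L_v`-norm of `S_J`, `v = (q - 1) p'` (read as `∞` for `p = 1`). -/
theorem lintegral_mul_sum_rpow_le {p q : ℝ} (hp : 1 ≤ p) (hpq : p < q) :
    ∃ ε : ℝ, 0 < ε ∧ ∀ (G : ℕ → X → ℝ≥0∞) (a : ℕ → ℝ≥0∞), (∀ j, Measurable (G j)) →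
      (∀ j : ℕ, (∫⁻ x, G j x ^ p ∂μ) ^ (1 / p) ≤ 2 ^ (-(j * (1 / p - 1 / q))) * a j) →
      (∀ (j : ℕ) x, G j x ≤ 2 ^ (j / q : ℝ) * a j) → ∀ J : ℕ,
      ∫⁻ x, G J x * (∑ j ∈ Finset.range (J + 1), G j x) ^ (q - 1) ∂μ ≤
        a J * (2 ^ (-(ε * J)) * ∑ j ∈ Finset.range (J + 1), 2 ^ (ε * j) * a j) ^ (q - 1) := by
  have hq0 : 0 < q := by linarith
  have hp0 : 0 < p := by linarith
  -- both cases end with the same computation of powers of two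
  have fin : ∀ (ε : ℝ) (a : ℕ → ℝ≥0∞) (J : ℕ), ε * (q - 1) = 1 / p - 1 / q →
      2 ^ (-((J : ℝ) * (1 / p - 1 / q))) * a J *
        (∑ j ∈ Finset.range (J + 1), 2 ^ (ε * j) * a j) ^ (q - 1) =
      a J * (2 ^ (-(ε * J)) * ∑ j ∈ Finset.range (J + 1), 2 ^ (ε * j) * a j) ^ (q - 1) := by
    intro ε a J hε
    rw [ENNReal.mul_rpow_of_nonneg _ _ (by linarith), ← ENNReal.rpow_mul]
    have : -(ε * (J : ℝ)) * (q - 1) = -((J : ℝ) * (1 / p - 1 / q)) := by rw [← hε]; ring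
    rw [this]; ring
  rcases hp.eq_or_lt with rfl | hp1
  · refine ⟨1 / q, by positivity, fun G a hG h1 h2 J => ?_⟩
    rw [← fin (1 / q) a J (by field_simp)]
    have hS : ∀ x, (∑ j ∈ Finset.range (J + 1), G j x) ^ (q - 1) ≤
        (∑ j ∈ Finset.range (J + 1), 2 ^ (1 / q * j) * a j) ^ (q - 1) := fun x => by
      refine ENNReal.rpow_le_rpow (Finset.sum_le_sum fun j _ => (h2 j x).trans_eq ?_) (by linarith)
      congr 2; ring
    calc _ ≤ ∫⁻ x, G J x * (∑ j ∈ Finset.range (J + 1), 2 ^ (1 / q * j) * a j) ^ (q - 1) ∂μ :=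
          lintegral_mono fun x => mul_le_mul_right (hS x) _
      _ = (∫⁻ x, G J x ∂μ) * _ := lintegral_mul_const _ (hG J)
      _ ≤ _ := mul_le_mul_left (by simpa using h1 J) _
  · have hconj := Real.HolderConjugate.conjExponent hp1
    set p' := p.conjExponent
    have hp0' : 0 < p' := hconj.symm.pos
    have hinv : 1 / p' = 1 - 1 / p := by
      have := hconj.inv_add_inv_eq_one
      simp only [one_div]; linarith
    set v := (q - 1) * p' with hv
    have hv0 : 0 < v := mul_pos (by linarith) hp0'
    have hvq : q < v := by
      have h1 : 1 / p' < 1 - 1 / q := by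
        rw [hinv]
        have : 1 / q < 1 / p := one_div_lt_one_div_of_lt hp0 hpq
        linarith
      have h2 : (q - 1) / v = 1 / p' := by
        rw [hv]; field_simp
        rw [div_self (by linarith)]
      have h3 : (1 - 1 / q) = (q - 1) / q := by field_simp
      rw [← h2, h3] at h1
      exact (div_lt_div_iff_of_pos_left (by linarith) hv0 hq0).1 h1
    have hε : (1 / q - 1 / v) * (q - 1) = 1 / p - 1 / q := by
      have h2 : (q - 1) / v = 1 / p' := by
        rw [hv]; field_simp
        rw [div_self (by linarith)]
      calc (1 / q - 1 / v) * (q - 1) = (q - 1) / q - (q - 1) / v := by ring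
        _ = _ := by rw [h2, hinv]; field_simp; ring
    refine ⟨1 / q - 1 / v, by
      have : 1 / v < 1 / q := one_div_lt_one_div_of_lt hq0 hvq
      linarith, fun G a hG h1 h2 J => ?_⟩
    rw [← fin _ a J hε]
    have hGv : ∀ j, (∫⁻ x, G j x ^ v ∂μ) ^ (1 / v) ≤ 2 ^ ((1 / q - 1 / v) * j) * a j := by
      intro j
      have h3 : ∫⁻ x, G j x ^ p ∂μ ≤ (2 ^ (-(j * (1 / p - 1 / q))) * a j) ^ p := by
        have := ENNReal.rpow_le_rpow (h1 j) hp0.le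
        rwa [← ENNReal.rpow_mul, one_div_mul_cancel hp0.ne', ENNReal.rpow_one] at this
      have h4 :=
        (lintegral_rpow_interp_le (μ := μ) hp0.le (by linarith : p ≤ v) (hG j) (h2 j)).trans
        (mul_le_mul_right h3 _)
      calc _ ≤ ((2 ^ (j / q : ℝ) * a j) ^ (v - p) *
            (2 ^ (-(j * (1 / p - 1 / q))) * a j) ^ p) ^ (1 / v) :=
            ENNReal.rpow_le_rpow h4 (by positivity)
        _ = ((2 ^ ((1 / q - 1 / v) * j) * a j) ^ v) ^ (1 / v) := by
            congr 1
            rw [ENNReal.mul_rpow_of_nonneg _ _ (by linarith), ENNReal.mul_rpow_of_nonneg _ _ hp0.le,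
              ENNReal.mul_rpow_of_nonneg _ _ hv0.le, ← ENNReal.rpow_mul, ← ENNReal.rpow_mul,
              ← ENNReal.rpow_mul]
            have e1 : a j ^ v = a j ^ (v - p) * a j ^ p := by
              rw [← ENNReal.rpow_add_of_nonneg _ _ (by linarith) hp0.le]; simp
            have e2 : (1 / q - 1 / v) * (j : ℝ) * v =
                (j : ℝ) / q * (v - p) + -((j : ℝ) * (1 / p - 1 / q)) * p := by
              field_simp; ring
            rw [e1, e2, two_rpow_add]; ring
        _ = _ := by rw [← ENNReal.rpow_mul, mul_one_div_cancel hv0.ne', ENNReal.rpow_one]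
    have hSv : (∫⁻ x, (∑ j ∈ Finset.range (J + 1), G j x) ^ v ∂μ) ^ (1 / v) ≤
        ∑ j ∈ Finset.range (J + 1), 2 ^ ((1 / q - 1 / v) * j) * a j := by
      have h5 := eLpNorm_sum_le (μ := μ) (f := G) (s := Finset.range (J + 1))
        (p := ENNReal.ofReal v) (fun i _ => (hG i).aestronglyMeasurable)
        (by simpa using (by linarith : 1 ≤ v))
      simp only [eLpNorm_eq_lintegral_rpow hv0, Finset.sum_apply] at h5
      exact h5.trans (Finset.sum_le_sum fun j _ => hGv j)
    have hH := ENNReal.lintegral_mul_le_Lp_mul_Lq μ hconj (hG J).aemeasurable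
      (g := fun x => (∑ j ∈ Finset.range (J + 1), G j x) ^ (q - 1))
      ((Finset.measurable_fun_sum _ fun j _ => hG j).pow_const _).aemeasurable
    refine hH.trans (mul_le_mul' (h1 J) ?_)
    simp only [← ENNReal.rpow_mul, ← hv]
    have : 1 / p' = 1 / v * (q - 1) := by
      rw [hv]; field_simp
      rw [div_self (by linarith)]
    rw [this, ENNReal.rpow_mul]
    exact ENNReal.rpow_le_rpow hSv (by linarith)

/-- A sum of functions `G_j` whose `L_p`- and `L_∞`-norms are balanced around the exponent `q` is
controlled in `L_q` by an `ℓ_q`-norm: the univariate core of the embedding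
`B^{1/p-1/q}_{p,q} ⊂ L_q` for `p < q < ∞`.  By `sum_rpow_le` the `q`-th power of the sum splits into
the terms `G_J S_J^{q-1}`, in which the geometric decay away from `J` survives the integration. -/
theorem lintegral_tsum_rpow_le {p q : ℝ} (hp : 1 ≤ p) (hpq : p < q) :
    ∃ C : ℝ≥0∞, C ≠ ∞ ∧ ∀ (G : ℕ → X → ℝ≥0∞) (a : ℕ → ℝ≥0∞), (∀ j, Measurable (G j)) →
      (∀ j : ℕ, (∫⁻ x, G j x ^ p ∂μ) ^ (1 / p) ≤ 2 ^ (-(j * (1 / p - 1 / q))) * a j) →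
      (∀ (j : ℕ) x, G j x ≤ 2 ^ (j / q : ℝ) * a j) →
      ∫⁻ x, (∑' j, G j x) ^ q ∂μ ≤ C * ∑' j, a j ^ q := by
  have hq0 : 0 < q := by linarith
  have hq1 : 1 < q := by linarith
  obtain ⟨ε, hε, hstep⟩ := lintegral_mul_sum_rpow_le (μ := μ) hp hpq
  obtain ⟨C, hC, hconv⟩ := tsum_rpow_geometric_conv_le hε hq1.le
  have hconj := Real.HolderConjugate.conjExponent hq1
  set q' := q.conjExponent
  have hq0' : 0 < q' := hconj.symm.pos
  have hqq : (q - 1) * q' = q := hconj.sub_one_mul_conj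
  have hsum : 1 / q + 1 / q' = 1 := by simpa [one_div] using hconj.inv_add_inv_eq_one
  refine ⟨ENNReal.ofReal q * C ^ (1 / q'), ENNReal.mul_ne_top ENNReal.ofReal_ne_top
    (ENNReal.rpow_ne_top_of_nonneg (by positivity) hC), fun G a hG h1 h2 => ?_⟩
  set A : ℕ → ℝ≥0∞ := fun J => 2 ^ (-(ε * J)) * ∑ j ∈ Finset.range (J + 1), 2 ^ (ε * j) * a j
  have hfinite : ∀ N : ℕ, ∫⁻ x, (∑ j ∈ Finset.range N, G j x) ^ q ∂μ ≤
      ENNReal.ofReal q * ∑' J, a J * A J ^ (q - 1) := by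
    intro N
    calc _ ≤ ∫⁻ x, ENNReal.ofReal q * ∑ J ∈ Finset.range N,
            G J x * (∑ j ∈ Finset.range (J + 1), G j x) ^ (q - 1) ∂μ :=
          lintegral_mono fun x => sum_rpow_le hq1.le (fun j => G j x) N
      _ = ENNReal.ofReal q * ∑ J ∈ Finset.range N,
            ∫⁻ x, G J x * (∑ j ∈ Finset.range (J + 1), G j x) ^ (q - 1) ∂μ := by
          have hm : ∀ J, Measurable fun x =>
              G J x * (∑ j ∈ Finset.range (J + 1), G j x) ^ (q - 1) := fun J =>
            (hG J).mul ((Finset.measurable_fun_sum _ fun j _ => hG j).pow_const _)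
          rw [lintegral_const_mul _ (Finset.measurable_fun_sum _ fun J _ => hm J),
            lintegral_finsetSum _ fun J _ => hm J]
      _ ≤ ENNReal.ofReal q * ∑ J ∈ Finset.range N, a J * A J ^ (q - 1) := by
          gcongr with J _
          exact hstep G a hG h1 h2 J
      _ ≤ _ := by gcongr; exact ENNReal.sum_le_tsum _
  have hlim : ∫⁻ x, (∑' j, G j x) ^ q ∂μ ≤ ENNReal.ofReal q * ∑' J, a J * A J ^ (q - 1) := by
    have hpt : ∀ x, (∑' j, G j x) ^ q = ⨆ N : ℕ, (∑ j ∈ Finset.range N, G j x) ^ q := by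
      intro x
      have hm := (ENNReal.orderIsoRpow q hq0).map_iSup fun N : ℕ => ∑ j ∈ Finset.range N, G j x
      simp only [ENNReal.orderIsoRpow_apply] at hm
      rw [ENNReal.tsum_eq_iSup_nat, hm]
    simp_rw [hpt]
    rw [lintegral_iSup]
    · exact iSup_le hfinite
    · exact fun N => (Finset.measurable_fun_sum _ fun j _ => hG j).pow_const _
    · intro M N hMN x
      exact ENNReal.rpow_le_rpow (Finset.sum_le_sum_of_subset (Finset.range_mono hMN)) hq0.le
  have hH := ENNReal.lintegral_mul_le_Lp_mul_Lq (Measure.count : Measure ℕ) hconj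
    (f := a) (g := fun J => A J ^ (q - 1)) (measurable_of_countable _).aemeasurable
    (measurable_of_countable _).aemeasurable
  simp only [lintegral_count, Pi.mul_apply, ← ENNReal.rpow_mul, hqq] at hH
  calc _ ≤ _ := hlim
    _ ≤ ENNReal.ofReal q * ((∑' j, a j ^ q) ^ (1 / q) * (C * ∑' j, a j ^ q) ^ (1 / q')) := by
        refine mul_le_mul_right (hH.trans (mul_le_mul_right ?_ _)) _
        exact ENNReal.rpow_le_rpow (hconv a) (by positivity)
    _ = _ := by
        rw [ENNReal.mul_rpow_of_nonneg _ _ (by positivity)]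
        have : (∑' j, a j ^ q) = (∑' j, a j ^ q) ^ (1 / q) * (∑' j, a j ^ q) ^ (1 / q') := by
          rw [← ENNReal.rpow_add_of_nonneg _ _ (by positivity) (by positivity), hsum,
            ENNReal.rpow_one]
        nth_rewrite 3 [this]
        ring

end

/-! ### Embeddings for families of positive kernels -/

section

variable {X Y ι κ : Type*} [MeasurableSpace X] [MeasurableSpace Y]

/-- The inequality `‖∑ᵢ Kᵢ hᵢ‖_q^q ≤ C ∑ᵢ (αᵢ ‖hᵢ‖_p)^q` for a family of positive integral
operators `Kᵢ` and all families of nonnegative functions `hᵢ`. -/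
def KernelEmbedding (μ : Measure X) (K : ι → X → X → ℝ≥0∞) (α : ι → ℝ≥0∞) (p q : ℝ)
    (C : ℝ≥0∞) : Prop :=
  ∀ h : ι → X → ℝ≥0∞, (∀ i, Measurable (h i)) →
    ∫⁻ x, (∑' i, ∫⁻ t, K i x t * h i t ∂μ) ^ q ∂μ ≤
      C * ∑' i, (α i * (∫⁻ t, h i t ^ p ∂μ) ^ (1 / p)) ^ q

/-- Embeddings in two groups of variables combine to one for the tensor products: apply the first
one with the second variable frozen, move the inner `L_p`-norm inside by Minkowski's inequality,
and apply the second one to the resulting norms. -/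
theorem KernelEmbedding.prod [Countable ι] [Countable κ] {μ : Measure X} [IsFiniteMeasure μ]
    {ν : Measure Y} [IsFiniteMeasure ν] {K : ι → X → X → ℝ≥0∞} {L : κ → Y → Y → ℝ≥0∞}
    (hK : ∀ i, Measurable (Function.uncurry (K i))) (hL : ∀ k, Measurable (Function.uncurry (L k)))
    {α : ι → ℝ≥0∞} {β : κ → ℝ≥0∞} {p q : ℝ} (hp : 1 ≤ p) (hq : 0 < q) {C D : ℝ≥0∞}
    (h1 : KernelEmbedding μ K α p q C) (h2 : KernelEmbedding ν L β p q D) :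
    KernelEmbedding (μ.prod ν) (fun (i : ι × κ) x t => K i.1 x.1 t.1 * L i.2 x.2 t.2)
      (fun i => α i.1 * β i.2) p q (C * D) := by
  intro h hh
  have hp0 : 0 < p := by linarith
  -- `Φ i y t` is the sum over the second index with the second operator applied
  set Φ : ι → Y → X → ℝ≥0∞ := fun i y t => ∑' k, ∫⁻ u, L k y u * h (i, k) (t, u) ∂ν with hΦ
  have hLx : ∀ k y, Measurable (L k y) := fun k y => (hL k).comp measurable_prodMk_left
  have hKx : ∀ k y, Measurable (K k y) := fun k y => (hK k).comp measurable_prodMk_left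
  have hhm : ∀ i t, Measurable fun u => h i (t, u) := fun i t => (hh i).comp measurable_prodMk_left
  have hh1 : ∀ i u, Measurable fun t => h i (t, u) := fun i u => (hh i).comp measurable_prodMk_right
  have hm1 : ∀ i k, Measurable fun z : X × Y => ∫⁻ u, L k z.2 u * h (i, k) (z.1, u) ∂ν := by
    intro i k
    refine Measurable.lintegral_prod_right' (f := fun w : (X × Y) × Y =>
      L k w.1.2 w.2 * h (i, k) (w.1.1, w.2)) ?_
    exact ((hL k).comp (measurable_fst.snd.prodMk measurable_snd)).mul
      ((hh (i, k)).comp (measurable_fst.fst.prodMk measurable_snd))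
  have hΦm : ∀ i, Measurable fun z : X × Y => Φ i z.2 z.1 := fun i =>
    Measurable.tsum fun k => hm1 i k
  have hΦy : ∀ i y, Measurable (Φ i y) := fun i y => (hΦm i).comp measurable_prodMk_right
  have hpt : ∀ x y, (∑' i : ι × κ, ∫⁻ t, K i.1 x t.1 * L i.2 y t.2 * h i t ∂(μ.prod ν)) =
      ∑' i, ∫⁻ t, K i x t * Φ i y t ∂μ := by
    intro x y
    rw [ENNReal.tsum_prod']
    refine tsum_congr fun i => ?_
    calc ∑' k, ∫⁻ t, K i x t.1 * L k y t.2 * h (i, k) t ∂(μ.prod ν)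
        = ∑' k, ∫⁻ t, K i x t * ∫⁻ u, L k y u * h (i, k) (t, u) ∂ν ∂μ := by
          refine tsum_congr fun k => ?_
          rw [lintegral_prod _ (Measurable.aemeasurable ?_)]
          · refine lintegral_congr fun t => ?_
            have hm : Measurable fun u => L k y u * h (i, k) (t, u) := (hLx k y).mul (hhm _ t)
            rw [← lintegral_const_mul _ hm]
            simp only [mul_assoc]
          · exact (((hKx i x).comp measurable_fst).mul ((hLx k y).comp measurable_snd)).mul (hh _)
      _ = ∫⁻ t, ∑' k, K i x t * ∫⁻ u, L k y u * h (i, k) (t, u) ∂ν ∂μ := by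
          rw [lintegral_tsum]
          intro k
          exact ((hKx i x).mul ((hm1 i k).comp measurable_prodMk_right)).aemeasurable
      _ = _ := by simp_rw [ENNReal.tsum_mul_left, hΦ]
  set H : ι → κ → Y → ℝ≥0∞ := fun i k u => (∫⁻ t, h (i, k) (t, u) ^ p ∂μ) ^ (1 / p) with hH
  have hHm : ∀ i k, Measurable (H i k) := fun i k =>
    (((hh (i, k)).pow_const p).lintegral_prod_left').pow_const _
  have hmink : ∀ i y, (∫⁻ t, Φ i y t ^ p ∂μ) ^ (1 / p) ≤ ∑' k, ∫⁻ u, L k y u * H i k u ∂ν := by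
    intro i y
    have a1 : (∫⁻ t, Φ i y t ^ p ∂μ) ^ (1 / p) ≤
        ∑' k, (∫⁻ t, (∫⁻ u, L k y u * h (i, k) (t, u) ∂ν) ^ p ∂μ) ^ (1 / p) := by
      have := eLpNorm_tsum_le (μ := μ) (p := ENNReal.ofReal p) (by simpa using hp)
        (G := fun k t => ∫⁻ u, L k y u * h (i, k) (t, u) ∂ν)
        (fun k => (hm1 i k).comp measurable_prodMk_right)
      simpa only [eLpNorm_eq_lintegral_rpow hp0] using this
    refine a1.trans (ENNReal.tsum_le_tsum fun k => ?_)
    refine (lintegral_rpow_lintegral_le hp (G := fun t u => L k y u * h (i, k) (t, u))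
      (((hLx k y).comp measurable_snd).mul (hh _))).trans_eq ?_
    refine lintegral_congr fun u => ?_
    simp_rw [ENNReal.mul_rpow_of_nonneg _ _ hp0.le]
    rw [lintegral_const_mul _ ((hh1 _ u).pow_const p),
      ENNReal.mul_rpow_of_nonneg _ _ (by positivity), ← ENNReal.rpow_mul,
      mul_one_div_cancel hp0.ne', ENNReal.rpow_one]
  have hmain : Measurable fun z : X × Y => (∑' i : ι × κ,
      ∫⁻ t, K i.1 z.1 t.1 * L i.2 z.2 t.2 * h i t ∂(μ.prod ν)) ^ q := by
    refine (Measurable.tsum fun i => ?_).pow_const q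
    refine Measurable.lintegral_prod_right' (f := fun w : (X × Y) × (X × Y) =>
      K i.1 w.1.1 w.2.1 * L i.2 w.1.2 w.2.2 * h i w.2) ?_
    exact (((hK i.1).comp (measurable_fst.fst.prodMk measurable_snd.fst)).mul
      ((hL i.2).comp (measurable_fst.snd.prodMk measurable_snd.snd))).mul
      ((hh i).comp measurable_snd)
  calc ∫⁻ z, (∑' i : ι × κ, ∫⁻ t, K i.1 z.1 t.1 * L i.2 z.2 t.2 * h i t ∂(μ.prod ν)) ^ q ∂(μ.prod ν)
      = ∫⁻ y, ∫⁻ x, (∑' i, ∫⁻ t, K i x t * Φ i y t ∂μ) ^ q ∂μ ∂ν := by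
        rw [lintegral_prod_symm' _ hmain]
        simp_rw [hpt]
    _ ≤ ∫⁻ y, C * ∑' i, (α i * ∑' k, ∫⁻ u, L k y u * H i k u ∂ν) ^ q ∂ν := by
        refine lintegral_mono fun y => (h1 (fun i => Φ i y) fun i => hΦy i y).trans ?_
        gcongr with i
        exact hmink i y
    _ = C * ∑' i, α i ^ q * ∫⁻ y, (∑' k, ∫⁻ u, L k y u * H i k u ∂ν) ^ q ∂ν := by
        have hm : ∀ i, Measurable fun y => (∑' k, ∫⁻ u, L k y u * H i k u ∂ν) ^ q := by
          intro i
          refine (Measurable.tsum fun k => ?_).pow_const q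
          exact Measurable.lintegral_prod_right' (f := fun w : Y × Y => L k w.1 w.2 * H i k w.2)
            ((hL k).mul ((hHm i k).comp measurable_snd))
        simp_rw [ENNReal.mul_rpow_of_nonneg _ _ hq.le]
        rw [lintegral_const_mul, lintegral_tsum]
        · simp_rw [lintegral_const_mul _ (hm _)]
        · exact fun i => ((hm i).const_mul _).aemeasurable
        · exact Measurable.tsum fun i => (hm i).const_mul _
    _ ≤ C * ∑' i, α i ^ q * (D * ∑' k, (β k * (∫⁻ u, H i k u ^ p ∂ν) ^ (1 / p)) ^ q) := by
        gcongr with i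
        exact h2 _ (hHm i)
    _ = C * D * ∑' i : ι × κ, (α i.1 * β i.2 * (∫⁻ t, h i t ^ p ∂(μ.prod ν)) ^ (1 / p)) ^ q := by
        rw [mul_assoc]
        congr 1
        rw [ENNReal.tsum_prod', ← ENNReal.tsum_mul_left]
        refine tsum_congr fun i => ?_
        rw [mul_left_comm, ← ENNReal.tsum_mul_left]
        congr 1
        refine tsum_congr fun k => ?_
        have e : ∫⁻ t, h (i, k) t ^ p ∂(μ.prod ν) = ∫⁻ u, H i k u ^ p ∂ν := by
          rw [lintegral_prod_symm' _ ((hh _).pow_const p)]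
          refine lintegral_congr fun u => ?_
          rw [hH, ← ENNReal.rpow_mul, one_div_mul_cancel hp0.ne', ENNReal.rpow_one]
        simp only [e, mul_assoc, ENNReal.mul_rpow_of_nonneg _ _ hq.le]

end

/-! ### Sequence spaces on multi-indices -/

theorem ellNorm_eq_eLpNorm {ι : Type*} [MeasurableSpace ι] [MeasurableSingletonClass ι]
    {θ : ℝ≥0∞} (hθ : θ ≠ 0) (a : ι → ℝ≥0∞) : ellNorm θ a = eLpNorm a θ Measure.count := by
  unfold ellNorm
  split_ifs with h
  · subst h
    simp [eLpNormEssSup_eq_essSup_enorm]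
  · rw [eLpNorm_eq_lintegral_rpow_enorm_toReal hθ h]
    simp [lintegral_count]

theorem le_ellNorm {ι : Type*} {θ : ℝ≥0∞} (hθ : 1 ≤ θ) (a : ι → ℝ≥0∞) (j : ι) :
    a j ≤ ellNorm θ a := by
  unfold ellNorm
  split_ifs with h
  · exact le_iSup a j
  · have h0 : 0 < θ.toReal := ENNReal.toReal_pos (by positivity) h
    calc a j = (a j ^ θ.toReal) ^ (1 / θ.toReal) := by
          rw [← ENNReal.rpow_mul, mul_one_div_cancel h0.ne', ENNReal.rpow_one]
      _ ≤ _ := ENNReal.rpow_le_rpow (ENNReal.le_tsum j) (by positivity)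

theorem tsum_fin_succ {d : ℕ} (g : (Fin (d + 1) → ℕ) → ℝ≥0∞) :
    ∑' j, g j = ∑' (l : ℕ) (j : Fin d → ℕ), g (Fin.cons l j) := by
  rw [← (Fin.consEquiv fun _ : Fin (d + 1) => ℕ).tsum_eq, ENNReal.tsum_prod']
  rfl

theorem tsum_prod_fin {d : ℕ} (g : Fin d → ℕ → ℝ≥0∞) :
    ∑' j : Fin d → ℕ, ∏ i, g i (j i) = ∏ i, ∑' l, g i l := by
  induction d with
  | zero => simp
  | succ d ih =>
    rw [tsum_fin_succ, Fin.prod_univ_succ, ← ih, ← ENNReal.tsum_mul_right]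
    refine tsum_congr fun l => ?_
    rw [← ENNReal.tsum_mul_left]
    refine tsum_congr fun j => ?_
    rw [Fin.prod_univ_succ]
    simp

theorem two_rpow_norm1 {d : ℕ} (ε : ℝ) (j : Fin d → ℕ) :
    (2 : ℝ≥0∞) ^ (-(ε * norm1 j)) = ∏ i, (2 : ℝ≥0∞) ^ (-(ε * j i)) := by
  unfold norm1
  induction d with
  | zero => simp
  | succ d ih =>
    rw [Fin.sum_univ_succ, Fin.prod_univ_succ, ← ih fun i => j i.succ, ← two_rpow_add]
    congr 1; push_cast; ring

theorem tsum_two_rpow_norm1_ne_top (d : ℕ) {ε : ℝ} (hε : 0 < ε) :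
    ∑' j : Fin d → ℕ, (2 : ℝ≥0∞) ^ (-(ε * norm1 j)) ≠ ∞ := by
  simp_rw [two_rpow_norm1, tsum_prod_fin fun (_ : Fin d) (l : ℕ) => (2 : ℝ≥0∞) ^ (-(ε * l))]
  exact ENNReal.prod_ne_top fun i _ => tsum_two_rpow_ne_top hε

/-- A geometric weight makes every `ℓ_θ`-sequence summable. -/
theorem tsum_two_rpow_mul_le {d : ℕ} {ε : ℝ} (hε : 0 < ε) {θ : ℝ≥0∞} (hθ : 1 ≤ θ)
    {a : (Fin d → ℕ) → ℝ≥0∞} (ha : ellNorm θ a ≠ ∞) :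
    ∑' j, (2 : ℝ≥0∞) ^ (-(ε * norm1 j)) * a j ≠ ∞ := by
  refine ne_top_of_le_ne_top ?_
    (ENNReal.tsum_le_tsum fun j => mul_le_mul_right (le_ellNorm hθ a j) _)
  rw [ENNReal.tsum_mul_right]
  exact ENNReal.mul_ne_top (tsum_two_rpow_norm1_ne_top d hε) ha

/-! ### The decay matrix on sequence spaces -/

/-- The matrix `2^{-s (j - k)_+ + r (j - k)}`; truncated subtraction is the positive part.  For
`0 < r < s` it decays geometrically away from the diagonal on both sides. -/
noncomputable def decay (s r : ℝ) (j k : ℕ) : ℝ≥0∞ :=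
  2 ^ (-(s * ((j - k : ℕ) : ℝ)) + r * ((j : ℝ) - k))

theorem decay_le (s r : ℝ) (j k : ℕ) :
    decay s r j k ≤ (if k ≤ j then (2 : ℝ≥0∞) ^ (-((s - r) * ((j : ℝ) - k))) else 0) +
      (if j ≤ k then (2 : ℝ≥0∞) ^ (-(r * ((k : ℝ) - j))) else 0) := by
  unfold decay
  rcases le_total k j with h | h
  · rw [if_pos h, Nat.cast_sub h]
    refine le_add_right (le_of_eq ?_)
    congr 1; ring
  · rw [if_pos h, Nat.sub_eq_zero_of_le h]
    refine le_add_left (le_of_eq ?_)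
    congr 1; push_cast; ring

theorem tsum_decay_le (s r : ℝ) (j : ℕ) : ∑' k, decay s r j k ≤
    (∑' l : ℕ, (2 : ℝ≥0∞) ^ (-((s - r) * l))) + ∑' l : ℕ, (2 : ℝ≥0∞) ^ (-(r * l)) := by
  refine (ENNReal.tsum_le_tsum fun k => decay_le s r j k).trans ?_
  rw [ENNReal.tsum_add]
  exact add_le_add (tsum_geometric_kernel_le j) (tsum_geometric_kernel_le' j)

theorem tsum_decay_le' (s r : ℝ) (k : ℕ) : ∑' j, decay s r j k ≤
    (∑' l : ℕ, (2 : ℝ≥0∞) ^ (-((s - r) * l))) + ∑' l : ℕ, (2 : ℝ≥0∞) ^ (-(r * l)) := by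
  refine (ENNReal.tsum_le_tsum fun j => decay_le s r j k).trans ?_
  rw [ENNReal.tsum_add]
  exact add_le_add (tsum_geometric_kernel_le' k) (tsum_geometric_kernel_le k)

/-- The tensor powers of the decay matrix act boundedly on every `ℓ_θ`, by the Schur test for
counting measure.  This is where `0 < r < s` is used. -/
theorem ellNorm_decay_le (d : ℕ) {s r : ℝ} (hr : 0 < r) (hrs : r < s) {θ : ℝ≥0∞} (hθ : 1 ≤ θ) :
    ∃ C : ℝ≥0∞, C ≠ ∞ ∧ ∀ b : (Fin d → ℕ) → ℝ≥0∞,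
      ellNorm θ (fun j : Fin d → ℕ => ∑' k : Fin d → ℕ, (∏ i, decay s r (j i) (k i)) * b k) ≤
        C * ellNorm θ b := by
  set S : ℝ≥0∞ := (∑' l : ℕ, (2 : ℝ≥0∞) ^ (-((s - r) * l))) + ∑' l : ℕ, (2 : ℝ≥0∞) ^ (-(r * l))
  have hS : S ≠ ∞ := ENNReal.add_ne_top.2
    ⟨tsum_two_rpow_ne_top (by linarith), tsum_two_rpow_ne_top hr⟩
  refine ⟨S ^ d, ENNReal.pow_ne_top hS, fun b => ?_⟩
  have hθ0 : θ ≠ 0 := by positivity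
  rw [ellNorm_eq_eLpNorm hθ0, ellNorm_eq_eLpNorm hθ0]
  have h := eLpNorm_kernel_le (μ := (Measure.count : Measure (Fin d → ℕ)))
    (ν := (Measure.count : Measure (Fin d → ℕ))) hθ
    (N := fun j k => ∏ i, decay s r (j i) (k i)) (f := b)
    (measurable_of_countable _) (measurable_of_countable _) (A := S ^ d) ?_ ?_
  · simpa only [lintegral_count] using h
  · intro j
    rw [lintegral_count, tsum_prod_fin fun i l => decay s r (j i) l]
    exact (Finset.prod_le_prod' fun i _ => tsum_decay_le s r (j i)).trans_eq (by simp [S])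
  · intro k
    rw [lintegral_count, tsum_prod_fin fun i l => decay s r l (k i)]
    exact (Finset.prod_le_prod' fun i _ => tsum_decay_le' s r (k i)).trans_eq (by simp [S])

/-! ### Tails of the weighted sequence spaces -/

/-- The number of multi-indices of length at most `n` is at most `(n + 1)^d`. -/
theorem tsum_card_le (d n : ℕ) :
    ∑' j : Fin d → ℕ, (if norm1 j ≤ n then (1 : ℝ≥0∞) else 0) ≤ (n + 1 : ℝ≥0∞) ^ d := by
  calc _ ≤ ∑' j : Fin d → ℕ, ∏ i, (if j i ≤ n then (1 : ℝ≥0∞) else 0) := by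
        refine ENNReal.tsum_le_tsum fun j => ?_
        split_ifs with h
        · rw [Finset.prod_eq_one]
          intro i _
          rw [if_pos]
          exact (Finset.single_le_sum (f := j) (fun _ _ => Nat.zero_le _)
            (Finset.mem_univ i)).trans h
        · exact zero_le
    _ = _ := by
        rw [tsum_prod_fin fun (_ : Fin d) (l : ℕ) => if l ≤ n then (1 : ℝ≥0∞) else 0]
        have : ∑' l : ℕ, (if l ≤ n then (1 : ℝ≥0∞) else 0) = n + 1 := by
          rw [tsum_eq_sum (s := Finset.range (n + 1)) (by
            intro b hb; rw [if_neg]; simpa [Nat.lt_succ_iff] using hb)]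
          rw [Finset.sum_congr rfl (g := fun _ => (1 : ℝ≥0∞))]
          · simp
          · intro b hb; rw [if_pos]; exact Nat.lt_succ_iff.1 (Finset.mem_range.1 hb)
        simp [this]

/-- The tail of the geometric series in one coordinate, when the others have length `m`. -/
theorem tsum_tail_fiber_le (ε : ℝ) (m n : ℕ) :
    ∑' l : ℕ, (if n < l + m then (2 : ℝ≥0∞) ^ (-(ε * ((l + m : ℕ) : ℝ))) else 0) ≤
      (∑' l : ℕ, (2 : ℝ≥0∞) ^ (-(ε * l))) *
        ((if m ≤ n then 1 else 0) * 2 ^ (-(ε * n)) +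
          if n < m then (2 : ℝ≥0∞) ^ (-(ε * m)) else 0) := by
  rcases le_or_gt m n with h | h
  · rw [if_pos h, if_neg (not_lt.2 h), one_mul, add_zero, ← ENNReal.tsum_mul_right,
      ← ENNReal.summable.sum_add_tsum_nat_add' (k := n - m), Finset.sum_eq_zero, zero_add]
    · refine ENNReal.tsum_le_tsum fun l => ?_
      split_ifs
      · rw [← two_rpow_add]
        refine le_of_eq ?_
        congr 1
        have : l + (n - m) + m = l + n := by omega
        rw [this]; push_cast; ring
      · exact zero_le
    · intro l hl
      rw [if_neg]
      have := Finset.mem_range.1 hl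
      omega
  · rw [if_neg (not_le.2 h), if_pos h, zero_mul, zero_add, ← ENNReal.tsum_mul_right]
    refine ENNReal.tsum_le_tsum fun l => ?_
    split_ifs
    · rw [← two_rpow_add]
      refine le_of_eq ?_
      congr 1; push_cast; ring
    · exact zero_le

/-- The tail of a geometric series over `ℕ^{d+1}`; the power of `n` counts the multi-indices of a
given length. -/
theorem tsum_tail_le (d : ℕ) {ε : ℝ} (hε : 0 < ε) :
    ∃ C : ℝ≥0∞, C ≠ ∞ ∧ ∀ n : ℕ, 1 ≤ n →
      ∑' j : Fin (d + 1) → ℕ, (if n < norm1 j then (2 : ℝ≥0∞) ^ (-(ε * norm1 j)) else 0) ≤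
        C * (2 ^ (-(ε * n)) * (n : ℝ≥0∞) ^ d) := by
  set S : ℝ≥0∞ := ∑' l : ℕ, (2 : ℝ≥0∞) ^ (-(ε * l))
  have hS : S ≠ ∞ := tsum_two_rpow_ne_top hε
  have step : ∀ (d n : ℕ),
      ∑' j : Fin (d + 1) → ℕ, (if n < norm1 j then (2 : ℝ≥0∞) ^ (-(ε * norm1 j)) else 0) ≤
      S * ((n + 1 : ℝ≥0∞) ^ d * 2 ^ (-(ε * n)) +
        ∑' j : Fin d → ℕ, (if n < norm1 j then (2 : ℝ≥0∞) ^ (-(ε * norm1 j)) else 0)) := by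
    intro d n
    rw [tsum_fin_succ, ENNReal.tsum_comm]
    have hn1 : ∀ (l : ℕ) (j : Fin d → ℕ),
        norm1 (Fin.cons l j : Fin (d + 1) → ℕ) = l + norm1 j := by
      intro l j
      unfold norm1
      rw [Fin.sum_univ_succ]; simp
    simp_rw [hn1]
    calc _ ≤ ∑' j : Fin d → ℕ, S * ((if norm1 j ≤ n then 1 else 0) * 2 ^ (-(ε * n)) +
          if n < norm1 j then (2 : ℝ≥0∞) ^ (-(ε * norm1 j)) else 0) :=
          ENNReal.tsum_le_tsum fun j => tsum_tail_fiber_le ε (norm1 j) n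
      _ ≤ _ := by
          rw [ENNReal.tsum_mul_left, ENNReal.tsum_add, ENNReal.tsum_mul_right]
          gcongr
          exact tsum_card_le d n
  have hn2 : ∀ n : ℕ, 1 ≤ n → ((n : ℝ≥0∞) + 1) ≤ 2 * n := by
    intro n hn
    exact_mod_cast (by omega : n + 1 ≤ 2 * n)
  induction d with
  | zero =>
    refine ⟨S, hS, fun n _ => (step 0 n).trans (le_of_eq ?_)⟩
    simp [norm1]
  | succ d ih =>
    obtain ⟨C, hC, hle⟩ := ih
    refine ⟨S * (2 ^ (d + 1) + C), ENNReal.mul_ne_top hS (ENNReal.add_ne_top.2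
      ⟨ENNReal.pow_ne_top (by simp), hC⟩), fun n hn => (step (d + 1) n).trans ?_⟩
    have h1 : ((n : ℝ≥0∞) + 1) ^ (d + 1) ≤ 2 ^ (d + 1) * (n : ℝ≥0∞) ^ (d + 1) := by
      rw [← mul_pow]; exact pow_le_pow_left' (hn2 n hn) _
    have h2 : (n : ℝ≥0∞) ^ d ≤ (n : ℝ≥0∞) ^ (d + 1) :=
      pow_le_pow_right₀ (by exact_mod_cast hn) (Nat.le_succ d)
    calc _ ≤ S * (2 ^ (d + 1) * (n : ℝ≥0∞) ^ (d + 1) * 2 ^ (-(ε * n)) +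
          C * (2 ^ (-(ε * n)) * (n : ℝ≥0∞) ^ (d + 1))) := by
          gcongr
          exact (hle n hn).trans (by gcongr)
      _ = _ := by ring

/-- For `θ ≤ q` the embedding `ℓ_θ ⊂ ℓ_q` costs no power of `n`. -/
theorem eLpNorm_tail_le_of_le {d : ℕ} {ε : ℝ} (hε : 0 < ε) {q θ : ℝ≥0∞} (hθ : 1 ≤ θ)
    (hθq : θ ≤ q) (hq : q ≠ ∞) (n : ℕ) (a : (Fin d → ℕ) → ℝ≥0∞) :
    eLpNorm (fun j => if n < norm1 j then (2 : ℝ≥0∞) ^ (-(ε * norm1 j)) * a j else 0) q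
      Measure.count ≤ 2 ^ (-(ε * n)) * ellNorm θ a := by
  have hθt : θ ≠ ∞ := ne_top_of_le_ne_top hq hθq
  have hq0 : q ≠ 0 := (zero_lt_one.trans_le (hθ.trans hθq)).ne'
  have h0 : 0 < θ.toReal := ENNReal.toReal_pos (by positivity) hθt
  have hq0' : 0 < q.toReal := ENNReal.toReal_pos hq0 hq
  have hle : θ.toReal ≤ q.toReal := (ENNReal.toReal_le_toReal hθt hq).2 hθq
  set M := ellNorm θ a
  have h1 : (∑' j, a j ^ q.toReal) ≤ M ^ q.toReal := by
    have h := lintegral_rpow_interp_le (μ := (Measure.count : Measure (Fin d → ℕ))) h0.le hle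
      (measurable_of_countable a) (le_ellNorm hθ a)
    simp only [lintegral_count] at h
    have hM : M ^ θ.toReal = ∑' j, a j ^ θ.toReal := by
      simp only [M, ellNorm, if_neg hθt]
      rw [← ENNReal.rpow_mul, one_div_mul_cancel h0.ne', ENNReal.rpow_one]
    calc _ ≤ M ^ (q.toReal - θ.toReal) * M ^ θ.toReal := by rw [hM]; exact h
      _ = _ := by
          rw [← ENNReal.rpow_add_of_nonneg _ _ (by linarith) h0.le]; simp
  rw [← ellNorm_eq_eLpNorm hq0, ellNorm, if_neg hq]
  calc _ ≤ (∑' j, (2 ^ (-(ε * n)) * a j) ^ q.toReal) ^ (1 / q.toReal) := by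
        gcongr with j
        split_ifs with hj
        · gcongr
          · norm_num
        · exact zero_le
    _ ≤ (((2 : ℝ≥0∞) ^ (-(ε * n))) ^ q.toReal * M ^ q.toReal) ^ (1 / q.toReal) := by
        simp_rw [ENNReal.mul_rpow_of_nonneg _ _ hq0'.le]
        rw [ENNReal.tsum_mul_left]
        gcongr
    _ = _ := by
        rw [← ENNReal.mul_rpow_of_nonneg _ _ hq0'.le, ← ENNReal.rpow_mul,
          mul_one_div_cancel hq0'.ne', ENNReal.rpow_one]

/-- The `ℓ_q`-norm of the tail of a weighted `ℓ_θ`-sequence on `ℕ^{d+1}`.  For `q < θ`, Hölder's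
inequality against the tail of the weight gives the power of `n`. -/
theorem eLpNorm_tail_le (d : ℕ) {ε : ℝ} (hε : 0 < ε) {q θ : ℝ≥0∞} (hq1 : 1 ≤ q) (hq : q ≠ ∞)
    (hθ : 1 ≤ θ) :
    ∃ C : ℝ≥0∞, C ≠ ∞ ∧ ∀ n : ℕ, 1 ≤ n → ∀ a : (Fin (d + 1) → ℕ) → ℝ≥0∞,
      eLpNorm (fun j => if n < norm1 j then (2 : ℝ≥0∞) ^ (-(ε * norm1 j)) * a j else 0) q
        Measure.count ≤
      C * (2 ^ (-(ε * n)) * (n : ℝ≥0∞) ^ ((d : ℝ) * max ((1 / q).toReal - (1 / θ).toReal) 0)) *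
        ellNorm θ a := by
  have hq0 : q ≠ 0 := (zero_lt_one.trans_le hq1).ne'
  have hq0' : 0 < q.toReal := ENNReal.toReal_pos hq0 hq
  rcases le_or_gt θ q with hle | hlt
  · refine ⟨1, by simp, fun n hn a => (eLpNorm_tail_le_of_le hε hθ hle hq n a).trans ?_⟩
    rw [one_mul]
    gcongr
    have h1 : (1 : ℝ≥0∞) ≤ (n : ℝ≥0∞) ^ ((d : ℝ) * max ((1 / q).toReal - (1 / θ).toReal) 0) :=
      (ENNReal.one_rpow _).symm.le.trans
        (ENNReal.rpow_le_rpow (by exact_mod_cast hn) (by positivity))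
    calc (2 : ℝ≥0∞) ^ (-(ε * n)) = 2 ^ (-(ε * n)) * 1 := (mul_one _).symm
      _ ≤ _ := by gcongr
  have hinv : (1 / θ).toReal < (1 / q).toReal := by
    refine (ENNReal.toReal_lt_toReal ?_ ?_).2 ?_
    · simp only [one_div, ne_eq, ENNReal.inv_eq_top]; positivity
    · simpa using hq0
    · simpa using hlt
  set u : ℝ := ((1 / q).toReal - (1 / θ).toReal)⁻¹ with hu
  have hu0 : 0 < u := inv_pos.2 (by linarith)
  have hu1 : (1 / q).toReal - (1 / θ).toReal = 1 / u := by rw [hu]; simp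
  rw [hu1, max_eq_left (by positivity)]
  obtain ⟨C, hC, htail⟩ := tsum_tail_le d (mul_pos hε hu0)
  refine ⟨C ^ (1 / u), ENNReal.rpow_ne_top_of_nonneg (by positivity) hC, fun n hn a => ?_⟩
  set g : (Fin (d + 1) → ℕ) → ℝ≥0∞ := fun j =>
    if n < norm1 j then (2 : ℝ≥0∞) ^ (-(ε * norm1 j)) else 0
  have hfun : (fun j => if n < norm1 j then (2 : ℝ≥0∞) ^ (-(ε * norm1 j)) * a j else 0) =
      g * a := by
    funext j
    simp only [g, Pi.mul_apply]
    split_ifs <;> simp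
  have hg : (∑' j, g j ^ u) ^ (1 / u) ≤
      C ^ (1 / u) * (2 ^ (-(ε * n)) * (n : ℝ≥0∞) ^ ((d : ℝ) * (1 / u))) := by
    have h1 : ∀ j, g j ^ u = if n < norm1 j then (2 : ℝ≥0∞) ^ (-(ε * u * norm1 j)) else 0 := by
      intro j
      simp only [g]
      split_ifs
      · rw [← ENNReal.rpow_mul]; congr 1; ring
      · simp [hu0]
    simp_rw [h1]
    refine (ENNReal.rpow_le_rpow (htail n hn) (by positivity)).trans_eq ?_
    rw [ENNReal.mul_rpow_of_nonneg _ _ (by positivity),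
      ENNReal.mul_rpow_of_nonneg _ _ (by positivity), ← ENNReal.rpow_mul, ← ENNReal.rpow_natCast,
      ← ENNReal.rpow_mul]
    congr 3
    field_simp
  rw [hfun]
  rcases eq_or_ne θ ∞ with rfl | hθt
  · have hqu : 1 / u = 1 / q.toReal := by rw [← hu1]; simp
    have huq : u = q.toReal := by
      have := hqu; field_simp at this; exact this.symm
    rw [← ellNorm_eq_eLpNorm hq0, ellNorm, if_neg hq, ← huq]
    calc _ ≤ (∑' j, (g j ^ u * ellNorm ∞ a ^ u)) ^ (1 / u) := by
          gcongr with j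
          rw [← ENNReal.mul_rpow_of_nonneg _ _ hu0.le]
          exact ENNReal.rpow_le_rpow (mul_le_mul_right (le_ellNorm hθ a j) _) hu0.le
      _ = (∑' j, g j ^ u) ^ (1 / u) * ellNorm ∞ a := by
          rw [ENNReal.tsum_mul_right, ENNReal.mul_rpow_of_nonneg _ _ (by positivity),
            ← ENNReal.rpow_mul, mul_one_div_cancel hu0.ne', ENNReal.rpow_one]
      _ ≤ _ := by gcongr
  · have hθ0 : 0 < θ.toReal := ENNReal.toReal_pos (by positivity) hθt
    have e1 : (1 / q).toReal = 1 / q.toReal := by simp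
    have e2 : (1 / θ).toReal = 1 / θ.toReal := by simp
    have hlt' : q.toReal < θ.toReal := (ENNReal.toReal_lt_toReal hq hθt).2 hlt
    have hH := ENNReal.lintegral_Lp_mul_le_Lq_mul_Lr hq0' hlt'
      (r := u) (by rw [← e1, ← e2, ← hu1]; ring)
      (Measure.count : Measure (Fin (d + 1) → ℕ)) (f := a) (g := g)
      (measurable_of_countable _).aemeasurable (measurable_of_countable _).aemeasurable
    simp only [lintegral_count] at hH
    rw [← ellNorm_eq_eLpNorm hq0, ellNorm, if_neg hq, mul_comm g a]
    refine hH.trans ?_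
    rw [mul_comm]
    refine mul_le_mul' hg ?_
    rw [ellNorm, if_neg hθt]

/-! ### Uniqueness of Fourier coefficients of integrable functions -/

section Uniqueness

variable {X : Type*} [TopologicalSpace X] [CompactSpace X] [MeasurableSpace X] [BorelSpace X]
  {μ : Measure X}

theorem Integrable.mul_continuousMap {g : X → ℂ} (hg : Integrable g μ) (F : C(X, ℂ)) :
    Integrable (fun x => g x * F x) μ :=
  hg.mul_bdd (c := ‖F‖) F.continuous.aestronglyMeasurable
    (Filter.Eventually.of_forall fun x => F.norm_coe_le_norm x)

/-- An integrable function that is orthogonal to a set of continuous functions with dense span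
vanishes almost everywhere. -/
theorem ae_eq_zero_of_dense_span [HasOuterApproxClosed X] {g : X → ℂ} (hg : Integrable g μ)
    {s : Set C(X, ℂ)} (hs : (Submodule.span ℂ s).topologicalClosure = ⊤)
    (h : ∀ e ∈ s, ∫ x, g x * e x ∂μ = 0) : g =ᵐ[μ] 0 := by
  let I : C(X, ℂ) →ₗ[ℂ] ℂ :=
    { toFun := fun F => ∫ x, g x * F x ∂μ
      map_add' := fun F G => by
        simp only [ContinuousMap.add_apply, mul_add]
        exact integral_add (Integrable.mul_continuousMap hg F) (Integrable.mul_continuousMap hg G)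
      map_smul' := fun c F => by
        simp only [ContinuousMap.smul_apply, smul_eq_mul, RingHom.id_apply]
        rw [← integral_const_mul]
        congr 1; funext x; ring }
  have hI : Continuous I := by
    refine (I.mkContinuous (∫ x, ‖g x‖ ∂μ) fun F => ?_).continuous
    refine (norm_integral_le_integral_norm _).trans ?_
    rw [← integral_mul_const]
    refine integral_mono (Integrable.mul_continuousMap hg F).norm (hg.norm.mul_const _) fun x => ?_
    simp only [norm_mul]
    exact mul_le_mul_of_nonneg_left (F.norm_coe_le_norm x) (norm_nonneg _)
  have hall : ∀ F, I F = 0 := by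
    have hker : Submodule.span ℂ s ≤ LinearMap.ker I :=
      Submodule.span_le.2 fun e he => h e he
    have hclosed : IsClosed (LinearMap.ker I : Set C(X, ℂ)) := isClosed_singleton.preimage hI
    have htop : ⊤ ≤ LinearMap.ker I := by
      rw [← hs]; exact Submodule.topologicalClosure_minimal _ hker hclosed
    exact fun F => htop trivial
  refine ae_eq_zero_of_forall_setIntegral_isClosed_eq_zero hg fun F hF => ?_
  have hlim : Filter.Tendsto (fun n => ∫ x, g x * ((hF.apprSeq n x : ℝ) : ℂ) ∂μ) Filter.atTop
      (nhds (∫ x, g x * F.indicator (fun _ => (1 : ℂ)) x ∂μ)) := by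
    refine tendsto_integral_of_dominated_convergence (fun x => ‖g x‖) (fun n => ?_) hg.norm
      (fun n => ?_) ?_
    · refine hg.aestronglyMeasurable.mul (Continuous.aestronglyMeasurable ?_)
      exact Complex.continuous_ofReal.comp (NNReal.continuous_coe.comp (hF.apprSeq n).continuous)
    · refine Filter.Eventually.of_forall fun x => ?_
      have h1 : ‖((hF.apprSeq n x : ℝ) : ℂ)‖ ≤ 1 := by
        simpa using HasOuterApproxClosed.apprSeq_apply_le_one hF n x
      rw [norm_mul]
      exact mul_le_of_le_one_right (norm_nonneg _) h1
    · refine Filter.Eventually.of_forall fun x => Filter.Tendsto.const_mul _ ?_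
      have h2 := tendsto_pi_nhds.1 (HasOuterApproxClosed.tendsto_apprSeq hF) x
      have h3 := ((Complex.continuous_ofReal.comp NNReal.continuous_coe).tendsto _).comp h2
      have e : F.indicator (fun _ => (1 : ℂ)) x =
          (Complex.ofReal ∘ NNReal.toReal) (F.indicator (fun _ => 1) x) := by
        by_cases hx : x ∈ F <;> simp [hx]
      rw [e]
      exact h3
  have hzero : ∀ n, ∫ x, g x * ((hF.apprSeq n x : ℝ) : ℂ) ∂μ = 0 := fun n =>
    hall ⟨fun x => ((hF.apprSeq n x : ℝ) : ℂ),
      Complex.continuous_ofReal.comp (NNReal.continuous_coe.comp (hF.apprSeq n).continuous)⟩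
  simp_rw [hzero] at hlim
  have := tendsto_nhds_unique hlim tendsto_const_nhds
  rw [← integral_indicator hF.measurableSet]
  rw [← this]
  refine integral_congr_ae (Filter.Eventually.of_forall fun x => ?_)
  by_cases hx : x ∈ F
  · simp [hx]
  · simp [hx]

end Uniqueness

theorem continuous_character {d : ℕ} (k : Fin d → ℤ) : Continuous (character k) :=
  continuous_finsetProd _ fun i _ => (fourier (k i)).continuous.comp (continuous_apply i)

/-- The character as a continuous map. -/
noncomputable def characterMap {d : ℕ} (k : Fin d → ℤ) : C(Torus d, ℂ) :=
  ⟨character k, continuous_character k⟩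

/-- Stone–Weierstrass: trigonometric polynomials are dense in the continuous functions on `𝕋ᵈ`. -/
theorem span_characterMap_closure_eq_top (d : ℕ) :
    (Submodule.span ℂ (Set.range (characterMap (d := d)))).topologicalClosure = ⊤ := by
  let A : StarSubalgebra ℂ C(Torus d, ℂ) :=
    { toSubalgebra := Algebra.adjoin ℂ (Set.range characterMap)
      star_mem' := by
        change Algebra.adjoin ℂ (Set.range characterMap) ≤
          star (Algebra.adjoin ℂ (Set.range characterMap))
        refine Algebra.adjoin_le ?_
        rintro _ ⟨n, rfl⟩
        refine Algebra.subset_adjoin ⟨-n, ?_⟩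
        ext x
        simp [characterMap, character] }
  have hA : A.toSubalgebra.toSubmodule = Submodule.span ℂ (Set.range characterMap) := by
    apply Algebra.adjoin_eq_span_of_subset
    refine .trans (fun x => Submonoid.closure_induction (fun _ => id) ⟨0, ?_⟩ ?_)
      Submodule.subset_span
    · ext z
      simp [characterMap, character]
    · rintro _ _ _ _ ⟨m, rfl⟩ ⟨n, rfl⟩
      refine ⟨m + n, ?_⟩
      ext z
      simp [characterMap, character, Finset.prod_mul_distrib]
  have hsep : A.SeparatesPoints := by
    intro x y hxy
    rw [Ne, funext_iff, not_forall] at hxy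
    obtain ⟨i, hi⟩ := hxy
    have hs : ∀ z : Torus d, character (Pi.single i 1) z = fourier 1 (z i) := by
      intro z
      unfold character
      rw [Finset.prod_eq_single i]
      · simp
      · intro b _ hb
        simp [hb]
      · simp
    refine ⟨_, ⟨characterMap (Pi.single i 1), Algebra.subset_adjoin ⟨_, rfl⟩, rfl⟩, ?_⟩
    change character _ x ≠ character _ y
    rw [hs, hs, fourier_one, fourier_one]
    exact fun hc => hi (AddCircle.injective_toCircle Real.two_pi_pos.ne' (Circle.coe_injective hc))
  rw [← hA]
  exact congr_arg (Subalgebra.toSubmodule <| StarSubalgebra.toSubalgebra ·)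
    (ContinuousMap.starSubalgebra_topologicalClosure_eq_top_of_separatesPoints A hsep)

/-- An integrable function on `𝕋ᵈ` is determined by its Fourier coefficients. -/
theorem ae_eq_of_coeff_eq {d : ℕ} {f g : Torus d → ℂ} (hf : Integrable f volume)
    (hg : Integrable g volume) (h : ∀ k, coeff f k = coeff g k) : f =ᵐ[volume] g := by
  have h1 : (fun x => f x - g x) =ᵐ[volume] 0 := by
    refine ae_eq_zero_of_dense_span (hf.sub hg) (span_characterMap_closure_eq_top d) ?_
    rintro _ ⟨k, rfl⟩
    have h2 := h (-k)
    have hpi : ((2 * Real.pi : ℝ) : ℂ)⁻¹ ^ d ≠ 0 := by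
      refine pow_ne_zero _ (inv_ne_zero ?_)
      exact_mod_cast Real.two_pi_pos.ne'
    simp only [coeff, neg_neg] at h2
    have h3 := mul_left_cancel₀ hpi h2
    simp only [sub_mul]
    rw [integral_sub (Integrable.mul_continuousMap hf (characterMap k))
      (Integrable.mul_continuousMap hg (characterMap k))]
    exact sub_eq_zero.2 h3
  filter_upwards [h1] with x hx
  exact sub_eq_zero.1 hx

theorem fourierCoeff_eq_integral (g : Circ → ℂ) (k : ℤ) :
    fourierCoeff g k = ((2 * Real.pi : ℝ) : ℂ)⁻¹ * ∫ t, fourier (-k) t * g t := by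
  unfold fourierCoeff
  rw [AddCircle.integral_haarAddCircle]
  simp only [smul_eq_mul, Complex.real_smul]
  push_cast; rfl

theorem ae_eq_of_fourierCoeff_eq {f g : Circ → ℂ} (hf : Integrable f volume)
    (hg : Integrable g volume) (h : ∀ k, fourierCoeff f k = fourierCoeff g k) :
    f =ᵐ[volume] g := by
  have h1 : (fun x => f x - g x) =ᵐ[volume] 0 := by
    refine ae_eq_zero_of_dense_span (hf.sub hg) span_fourier_closure_eq_top ?_
    rintro _ ⟨k, rfl⟩
    have h2 := h (-k)
    have hpi : ((2 * Real.pi : ℝ) : ℂ)⁻¹ ≠ 0 := by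
      refine inv_ne_zero ?_
      exact_mod_cast Real.two_pi_pos.ne'
    simp only [fourierCoeff_eq_integral, neg_neg] at h2
    have h3 := mul_left_cancel₀ hpi h2
    simp only [sub_mul]
    rw [integral_sub (Integrable.mul_continuousMap hf (fourier k))
      (Integrable.mul_continuousMap hg (fourier k))]
    simp only [mul_comm _ (fourier k _)]
    exact sub_eq_zero.2 h3
  filter_upwards [h1] with x hx
  exact sub_eq_zero.1 hx

/-! ### Trigonometric polynomials on the circle -/

theorem integral_fourier (m : ℤ) :
    ∫ t : Circ, fourier m t = if m = 0 then ((2 * Real.pi : ℝ) : ℂ) else 0 := by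
  have h := congrFun (fourierCoeff_fourier (T := 2 * Real.pi) m) 0
  rw [fourierCoeff_eq_integral] at h
  have hpi : ((2 * Real.pi : ℝ) : ℂ) ≠ 0 := by exact_mod_cast Real.two_pi_pos.ne'
  simp only [neg_zero, fourier_zero, one_mul] at h
  rw [inv_mul_eq_iff_eq_mul₀ hpi] at h
  rw [h]
  by_cases hm : m = 0
  · simp [hm]
  · simp [hm, eq_comm]

/-- The trigonometric polynomial with frequencies in `S` and coefficients `c`. -/
noncomputable def trig (S : Finset ℤ) (c : ℤ → ℂ) (x : Circ) : ℂ := ∑ m ∈ S, c m * fourier m x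

theorem continuous_trig (S : Finset ℤ) (c : ℤ → ℂ) : Continuous (trig S c) :=
  continuous_finsetSum _ fun m _ => continuous_const.mul (fourier m).continuous

theorem integrable_of_continuous {f : Circ → ℂ} (hf : Continuous f) : Integrable f volume :=
  hf.integrable_of_hasCompactSupport (HasCompactSupport.of_compactSpace f)

theorem memLp_of_continuous {f : Circ → ℂ} (hf : Continuous f) (p : ℝ≥0∞) : MemLp f p volume := by
  obtain ⟨C, hC⟩ := (isCompact_range hf.norm).bddAbove
  exact MemLp.of_bound hf.aestronglyMeasurable C
    (Filter.Eventually.of_forall fun x => hC ⟨x, rfl⟩)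

theorem fourier_mul (m n : ℤ) (x : Circ) : fourier (m + n) x = fourier m x * fourier n x :=
  fourier_add

theorem integral_trig_mul (S : Finset ℤ) (c : ℤ → ℂ) (n : ℤ) :
    ∫ t, trig S c t * fourier (-n) t =
      if n ∈ S then ((2 * Real.pi : ℝ) : ℂ) * c n else 0 := by
  simp only [trig, Finset.sum_mul, mul_assoc, ← fourier_mul]
  rw [integral_finsetSum]
  · simp only [integral_const_mul, integral_fourier, add_neg_eq_zero, mul_ite, mul_zero]
    rw [Finset.sum_ite_eq']
    simp [mul_comm]
  · exact fun m _ => integrable_of_continuous (continuous_const.mul (fourier _).continuous)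

theorem fourierCoeff_trig (S : Finset ℤ) (c : ℤ → ℂ) (n : ℤ) :
    fourierCoeff (trig S c) n = if n ∈ S then c n else 0 := by
  rw [fourierCoeff_eq_integral]
  simp only [mul_comm (fourier (-n) _)]
  rw [integral_trig_mul]
  have hpi : ((2 * Real.pi : ℝ) : ℂ) ≠ 0 := by exact_mod_cast Real.two_pi_pos.ne'
  split_ifs
  · field_simp
  · simp

theorem norm_fourier_apply (m : ℤ) (x : Circ) : ‖fourier m x‖ = 1 := by
  rw [fourier_apply]; exact Circle.norm_coe _

theorem fourier_sub_apply (m : ℤ) (x t : Circ) :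
    fourier m (x - t) = fourier m x * fourier (-m) t := by
  rw [fourier_apply, fourier_apply, fourier_apply, smul_sub, sub_eq_add_neg,
    AddCircle.toCircle_add, ← neg_smul]
  simp

/-- Convolution with a trigonometric polynomial is a Fourier multiplier. -/
theorem integral_trig_sub_mul_fourier (S : Finset ℤ) (c : ℤ → ℂ) (n : ℤ) (x : Circ) :
    ∫ t, trig S c (x - t) * fourier n t =
      if n ∈ S then ((2 * Real.pi : ℝ) : ℂ) * c n * fourier n x else 0 := by
  have h := integral_sub_left_eq_self (fun t => trig S c t * fourier n (x - t)) volume x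
  simp only [sub_sub_cancel] at h
  rw [h]
  simp only [fourier_sub_apply, mul_left_comm (trig S c _)]
  rw [integral_const_mul, integral_trig_mul]
  split_ifs <;> ring

theorem integral_trig_sub_mul_trig {S T : Finset ℤ} (hST : S ⊆ T) (a c : ℤ → ℂ) (x : Circ) :
    ∫ t, ((2 * Real.pi : ℝ) : ℂ)⁻¹ * trig T a (x - t) * trig S c t =
      trig S (fun m => a m * c m) x := by
  have hpi : ((2 * Real.pi : ℝ) : ℂ) ≠ 0 := by exact_mod_cast Real.two_pi_pos.ne'
  have h : ∀ t, ((2 * Real.pi : ℝ) : ℂ)⁻¹ * trig T a (x - t) * trig S c t =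
      ∑ m ∈ S, ((2 * Real.pi : ℝ) : ℂ)⁻¹ * c m * (trig T a (x - t) * fourier m t) := by
    intro t
    conv_lhs => rw [trig.eq_def S]
    rw [Finset.mul_sum]
    exact Finset.sum_congr rfl fun m _ => by ring
  simp_rw [h]
  rw [integral_finsetSum]
  · refine Finset.sum_congr rfl fun m hm => ?_
    rw [integral_const_mul, integral_trig_sub_mul_fourier, if_pos (hST hm)]
    field_simp
  · intro m _
    refine (integrable_of_continuous ?_).const_mul _
    exact ((continuous_trig T a).comp (continuous_const.sub continuous_id)).mul
      (fourier m).continuous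

/-- Parseval's identity. -/
theorem integral_normSq_trig (S : Finset ℤ) (c : ℤ → ℂ) :
    ∫ t, ‖trig S c t‖ ^ 2 = 2 * Real.pi * ∑ m ∈ S, ‖c m‖ ^ 2 := by
  have h : ∀ t : Circ, ((‖trig S c t‖ ^ 2 : ℝ) : ℂ) =
      ∑ n ∈ S, (starRingEnd ℂ) (c n) * (trig S c t * fourier (-n) t) := by
    intro t
    have h1 : ((‖trig S c t‖ ^ 2 : ℝ) : ℂ) = trig S c t * (starRingEnd ℂ) (trig S c t) := by
      rw [Complex.mul_conj, Complex.normSq_eq_norm_sq]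
    rw [h1]
    nth_rewrite 2 [trig]
    rw [map_sum, Finset.mul_sum]
    refine Finset.sum_congr rfl fun n _ => ?_
    rw [map_mul, ← fourier_neg]; ring
  have h2 : ((∫ t, ‖trig S c t‖ ^ 2 : ℝ) : ℂ) =
      ((2 * Real.pi * ∑ m ∈ S, ‖c m‖ ^ 2 : ℝ) : ℂ) := by
    rw [← integral_complex_ofReal]
    simp_rw [h]
    rw [integral_finsetSum]
    · push_cast
      rw [Finset.mul_sum]
      refine Finset.sum_congr rfl fun n hn => ?_
      rw [integral_const_mul, integral_trig_mul, if_pos hn]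
      have : (starRingEnd ℂ) (c n) * c n = ((‖c n‖ : ℝ) : ℂ) ^ 2 := by
        rw [mul_comm, Complex.mul_conj, Complex.normSq_eq_norm_sq]; push_cast; rfl
      rw [mul_left_comm, this]; push_cast; ring
    · intro n _
      exact (integrable_of_continuous
        ((continuous_trig S c).mul (fourier _).continuous)).const_mul _
  exact_mod_cast h2

/-! ### A reproducing kernel for trigonometric polynomials with a Fejér majorant -/

/-- The one-sided Dirichlet kernel `∑_{0 ≤ b < N} e^{ibx}`. -/
noncomputable def dirichlet (N : ℕ) (x : Circ) : ℂ := ∑ b ∈ Finset.range N, fourier (b : ℤ) x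

/-- A kernel of de la Vallée-Poussin type: convolution with it fixes trigonometric polynomials of
degree at most `N`.  It is a product of two Dirichlet-type kernels, so that it is dominated by a
multiple of the Fejér kernel. -/
noncomputable def reproKernel (N : ℕ) (x : Circ) : ℂ :=
  ((2 * Real.pi : ℝ) : ℂ)⁻¹ * ((N : ℂ)⁻¹ * dirichlet N x *
    ∑ a ∈ Finset.range (4 * N), fourier ((a : ℤ) - 2 * N) x)

/-- Four times the Fejér kernel, with respect to Lebesgue measure. -/
noncomputable def fejer (N : ℕ) (x : Circ) : ℝ :=
  (2 * Real.pi)⁻¹ * (4 * (N : ℝ)⁻¹ * ‖dirichlet N x‖ ^ 2)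

theorem dirichlet_eq_trig (N : ℕ) : dirichlet N = trig (Finset.Ico 0 (N : ℤ)) 1 := by
  funext x
  simp only [dirichlet, trig, Pi.one_apply, one_mul]
  refine Finset.sum_bij (fun b _ => (b : ℤ)) (by simp) (by simp) ?_ (by simp)
  intro b hb
  rw [Finset.mem_Ico] at hb
  exact ⟨b.toNat, by simp; omega, by omega⟩

theorem continuous_dirichlet (N : ℕ) : Continuous (dirichlet N) :=
  continuous_finsetSum _ fun _ _ => (fourier _).continuous

theorem continuous_fejer (N : ℕ) : Continuous (fejer N) :=
  continuous_const.mul (continuous_const.mul ((continuous_dirichlet N).norm.pow 2))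

theorem continuous_reproKernel (N : ℕ) : Continuous (reproKernel N) :=
  continuous_const.mul ((continuous_const.mul (continuous_dirichlet N)).mul
    (continuous_finsetSum _ fun _ _ => (fourier _).continuous))

theorem fejer_nonneg (N : ℕ) (x : Circ) : 0 ≤ fejer N x := by
  unfold fejer; positivity

/-- The factor with `4N` frequencies consists of four modulated copies of the Dirichlet kernel,
so that it is at most four times as large as that kernel. -/
theorem norm_reproKernel_le (N : ℕ) (x : Circ) : ‖reproKernel N x‖ ≤ fejer N x := by
  have hblock : ∀ i : ℕ, ‖∑ a ∈ Finset.range N, fourier ((i * N + a : ℕ) - 2 * N : ℤ) x‖ =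
      ‖dirichlet N x‖ := by
    intro i
    have : ∀ a : ℕ, fourier ((i * N + a : ℕ) - 2 * N : ℤ) x =
        fourier ((i : ℤ) * N - 2 * N) x * fourier (a : ℤ) x := by
      intro a
      rw [← fourier_mul]; congr 2; push_cast; ring
    simp_rw [this, ← Finset.mul_sum]
    rw [norm_mul, norm_fourier_apply, one_mul, dirichlet]
  have hP : ‖∑ a ∈ Finset.range (4 * N), fourier ((a : ℤ) - 2 * N) x‖ ≤ 4 * ‖dirichlet N x‖ := by
    have h4 : 4 * N = N + N + N + N := by ring
    rw [h4, Finset.sum_range_add, Finset.sum_range_add, Finset.sum_range_add]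
    have h0 := hblock 0
    have h1 := hblock 1
    have h2 := hblock 2
    have h3 := hblock 3
    simp only [zero_mul, zero_add, one_mul] at h0 h1
    have e2 : 2 * N = N + N := by ring
    have e3 : 3 * N = N + N + N := by ring
    rw [e2] at h2
    rw [e3] at h3
    refine (norm_add_le _ _).trans ?_
    refine (add_le_add (norm_add_le _ _) le_rfl).trans ?_
    refine (add_le_add (add_le_add (norm_add_le _ _) le_rfl) le_rfl).trans ?_
    rw [h0, h1, h2, h3]; linarith
  have hpi : (0 : ℝ) ≤ (2 * Real.pi)⁻¹ := by positivity
  unfold reproKernel fejer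
  rw [norm_mul, norm_mul, norm_mul, norm_inv, norm_inv, Complex.norm_real, Real.norm_eq_abs,
    abs_of_pos Real.two_pi_pos, Complex.norm_natCast]
  refine mul_le_mul_of_nonneg_left ?_ hpi
  calc (N : ℝ)⁻¹ * ‖dirichlet N x‖ * _ ≤ (N : ℝ)⁻¹ * ‖dirichlet N x‖ * (4 * ‖dirichlet N x‖) :=
        mul_le_mul_of_nonneg_left hP (by positivity)
    _ = _ := by ring

theorem integral_fejer {N : ℕ} (hN : 1 ≤ N) : ∫ x, fejer N x = 4 := by
  unfold fejer
  rw [integral_const_mul, integral_const_mul]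
  simp_rw [dirichlet_eq_trig]
  rw [integral_normSq_trig]
  have hpi : (2 * Real.pi) ≠ 0 := Real.two_pi_pos.ne'
  have hN' : (N : ℝ) ≠ 0 := by positivity
  simp
  field_simp

theorem fejer_le (N : ℕ) (x : Circ) : fejer N x ≤ N := by
  rcases Nat.eq_zero_or_pos N with rfl | hN
  · simp [fejer]
  have hD : ‖dirichlet N x‖ ≤ N := by
    refine (norm_sum_le _ _).trans ?_
    simp only [norm_fourier_apply]
    simp
  have hN' : (0 : ℝ) < N := by positivity
  have hpi : 4 ≤ 2 * Real.pi := by linarith [Real.pi_gt_three]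
  unfold fejer
  calc (2 * Real.pi)⁻¹ * (4 * (N : ℝ)⁻¹ * ‖dirichlet N x‖ ^ 2)
      ≤ (2 * Real.pi)⁻¹ * (4 * (N : ℝ)⁻¹ * (N : ℝ) ^ 2) := by gcongr
    _ = 4 / (2 * Real.pi) * N := by field_simp
    _ ≤ 1 * N := by
        gcongr
        rw [div_le_one Real.two_pi_pos]; exact hpi
    _ = N := one_mul _

/-- The Fejér majorant as a positive kernel. -/
noncomputable def fejerKernel (N : ℕ) (x t : Circ) : ℝ≥0∞ := ENNReal.ofReal (fejer N (x - t))

theorem measurable_fejerKernel (N : ℕ) : Measurable (Function.uncurry (fejerKernel N)) :=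
  (ENNReal.continuous_ofReal.comp ((continuous_fejer N).comp
    (continuous_fst.sub continuous_snd))).measurable

theorem lintegral_ofReal_fejer {N : ℕ} (hN : 1 ≤ N) :
    ∫⁻ x, ENNReal.ofReal (fejer N x) = 4 := by
  rw [← ofReal_integral_eq_lintegral_ofReal
    ((continuous_fejer N).integrable_of_hasCompactSupport (HasCompactSupport.of_compactSpace _))
    (Filter.Eventually.of_forall (fejer_nonneg N)), integral_fejer hN]
  simp

theorem lintegral_fejerKernel_right {N : ℕ} (hN : 1 ≤ N) (x : Circ) :
    ∫⁻ t, fejerKernel N x t = 4 := by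
  unfold fejerKernel
  rw [lintegral_sub_left_eq_self (fun t => ENNReal.ofReal (fejer N t)) x, lintegral_ofReal_fejer hN]

theorem lintegral_fejerKernel_left {N : ℕ} (hN : 1 ≤ N) (t : Circ) :
    ∫⁻ x, fejerKernel N x t = 4 := by
  unfold fejerKernel
  rw [lintegral_sub_right_eq_self (fun t => ENNReal.ofReal (fejer N t)) t,
    lintegral_ofReal_fejer hN]

theorem fejerKernel_le (N : ℕ) (x t : Circ) : fejerKernel N x t ≤ N := by
  refine (ENNReal.ofReal_le_ofReal (fejer_le N _)).trans ?_
  simp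

theorem enorm_reproKernel_le (N : ℕ) (x t : Circ) :
    ‖reproKernel N (x - t)‖ₑ ≤ fejerKernel N x t := by
  rw [← ofReal_norm]
  exact ENNReal.ofReal_le_ofReal (norm_reproKernel_le N _)

/-- The kernel is `N⁻¹ ∑_b ∑_a e^{i(a + b - 2N)x}` up to normalization; a frequency `|m| ≤ N`
arises exactly once for every `b`, hence with coefficient `N⁻¹ N = 1`. -/
theorem integral_reproKernel_mul_fourier {N : ℕ} (hN : 1 ≤ N) {m : ℤ} (hm : |m| ≤ N) (x : Circ) :
    ∫ t, reproKernel N (x - t) * fourier m t = fourier m x := by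
  have h := integral_sub_left_eq_self (fun t => reproKernel N t * fourier m (x - t)) volume x
  simp only [sub_sub_cancel] at h
  rw [h]
  have hpi : ((2 * Real.pi : ℝ) : ℂ) ≠ 0 := by exact_mod_cast Real.two_pi_pos.ne'
  have hNc : (N : ℂ) ≠ 0 := by exact_mod_cast (by omega : N ≠ 0)
  have hexp : ∀ t, reproKernel N t * fourier m (x - t) = fourier m x *
      (((2 * Real.pi : ℝ) : ℂ)⁻¹ * (N : ℂ)⁻¹ * ∑ b ∈ Finset.range N, ∑ a ∈ Finset.range (4 * N),
        fourier ((b : ℤ) + ((a : ℤ) - 2 * N) + -m) t) := by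
    intro t
    simp only [fourier_mul, fourier_sub_apply, reproKernel, dirichlet, ← Finset.sum_mul,
      ← Finset.mul_sum]
    ring
  simp_rw [hexp]
  rw [integral_const_mul, integral_const_mul, integral_finsetSum]
  · have hin : ∀ b ∈ Finset.range N, ∫ t : Circ, ∑ a ∈ Finset.range (4 * N),
        fourier ((b : ℤ) + ((a : ℤ) - 2 * N) + -m) t = ((2 * Real.pi : ℝ) : ℂ) := by
      intro b hb
      rw [integral_finsetSum _ fun a _ => integrable_of_continuous (fourier _).continuous]
      simp only [integral_fourier]
      have hb' := Finset.mem_range.1 hb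
      have hm' := abs_le.1 hm
      -- the only contributing frequency is `m - b`, which lies in `[-2N, 2N)`
      rw [Finset.sum_eq_single ((m - b + 2 * N).toNat)]
      · rw [if_pos]; omega
      · intro a _ ha
        rw [if_neg]; omega
      · intro ha
        rw [Finset.mem_range] at ha
        omega
    rw [Finset.sum_congr rfl hin]
    simp
    field_simp
  · exact fun b _ => integrable_finsetSum _ fun a _ =>
      integrable_of_continuous (fourier _).continuous

/-- The continuous function `ψ` is reproduced by convolution with the kernel of order `N`: the form
in which `ψ` is a trigonometric polynomial of degree at most `N` is used. -/
def Reproduced (N : ℕ) (ψ : Circ → ℂ) : Prop :=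
  Continuous ψ ∧ ∀ x, ∫ t, reproKernel N (x - t) * ψ t = ψ x

theorem Reproduced.fourier {N : ℕ} (hN : 1 ≤ N) {m : ℤ} (hm : |m| ≤ N) :
    Reproduced N (fourier m) :=
  ⟨(_root_.fourier m).continuous, integral_reproKernel_mul_fourier hN hm⟩

theorem integrable_reproKernel_mul {N : ℕ} {ψ : Circ → ℂ} (hψ : Continuous ψ) (x : Circ) :
    Integrable (fun t => reproKernel N (x - t) * ψ t) volume :=
  integrable_of_continuous (((continuous_reproKernel N).comp
    (continuous_const.sub continuous_id)).mul hψ)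

theorem Reproduced.add {N : ℕ} {ψ χ : Circ → ℂ} (hψ : Reproduced N ψ) (hχ : Reproduced N χ) :
    Reproduced N (ψ + χ) := by
  refine ⟨hψ.1.add hχ.1, fun x => ?_⟩
  simp only [Pi.add_apply, mul_add]
  rw [integral_add (integrable_reproKernel_mul hψ.1 x) (integrable_reproKernel_mul hχ.1 x),
    hψ.2, hχ.2]

theorem Reproduced.const_mul {N : ℕ} {ψ : Circ → ℂ} (hψ : Reproduced N ψ) (c : ℂ) :
    Reproduced N (fun x => c * ψ x) := by
  refine ⟨continuous_const.mul hψ.1, fun x => ?_⟩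
  simp only [mul_left_comm _ c]
  rw [integral_const_mul, hψ.2]

theorem Reproduced.sum {ι : Type*} {N : ℕ} {ψ : ι → Circ → ℂ} {s : Finset ι}
    (hψ : ∀ i ∈ s, Reproduced N (ψ i)) : Reproduced N (fun x => ∑ i ∈ s, ψ i x) := by
  refine ⟨continuous_finsetSum _ fun i hi => (hψ i hi).1, fun x => ?_⟩
  simp only [Finset.mul_sum]
  rw [integral_finsetSum _ fun i hi => integrable_reproKernel_mul (hψ i hi).1 x]
  exact Finset.sum_congr rfl fun i hi => (hψ i hi).2 x

/-! ### The univariate embedding -/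

/-- Hölder's inequality for a kernel with known mass and supremum; for kernels of degree `N` this
is the Nikolskii inequality between `L_p` and `L_∞`. -/
theorem lintegral_mul_le_of_bdd {Y : Type*} [MeasurableSpace Y] {ν : Measure Y} [SFinite ν]
    {p : ℝ} (hp : 1 ≤ p) {N f : Y → ℝ≥0∞} (hN : Measurable N) (hf : Measurable f) {A B : ℝ≥0∞}
    (hA : ∫⁻ t, N t ∂ν ≤ A) (hB : ∀ t, N t ≤ B) :
    ∫⁻ t, N t * f t ∂ν ≤ A ^ (1 - 1 / p) * B ^ (1 / p) * (∫⁻ t, f t ^ p ∂ν) ^ (1 / p) := by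
  have hp0 : 0 < p := by linarith
  rcases hp.eq_or_lt with rfl | hp1
  · simp only [div_one, sub_self, ENNReal.rpow_zero, ENNReal.rpow_one, one_mul]
    rw [← lintegral_const_mul _ hf]
    exact lintegral_mono fun t => mul_le_mul_left (hB t) _
  have hconj := Real.HolderConjugate.conjExponent hp1
  have h := lintegral_rpow_kernel_le (μ := (Measure.dirac () : Measure Unit)) (ν := ν) hconj
    (N := fun _ t => N t) (hN.comp measurable_snd) hf (ω := fun _ => 1) measurable_const
    (by simp) (by simp) (A := A) (B := B) (by simpa using hA) (by simpa using hB)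
  simp only [lintegral_dirac] at h
  have h' := ENNReal.rpow_le_rpow h (by positivity : 0 ≤ 1 / p)
  rw [← ENNReal.rpow_mul, mul_one_div_cancel hp0.ne', ENNReal.rpow_one,
    ENNReal.mul_rpow_of_nonneg _ _ (by positivity), ENNReal.mul_rpow_of_nonneg _ _ (by positivity),
    ← ENNReal.rpow_mul] at h'
  have e : (p - 1) * (1 / p) = 1 - 1 / p := by field_simp
  rwa [e] at h'

/-- The embedding `B^{1/p-1/q}_{p,q}(𝕋) ⊂ L_q(𝕋)`, in the form of a bound for positive operators
with Fejér kernels of degree `2^j`. -/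
theorem kernelEmbedding_fejer {p q : ℝ} (hp : 1 ≤ p) (hpq : p < q) :
    ∃ C : ℝ≥0∞, C ≠ ∞ ∧ KernelEmbedding (volume : Measure Circ) (fun j => fejerKernel (2 ^ j))
      (fun j : ℕ => 2 ^ (j * (1 / p - 1 / q))) p q C := by
  have hp0 : 0 < p := by linarith
  have hq0 : 0 < q := by linarith
  obtain ⟨C, hC, hle⟩ := lintegral_tsum_rpow_le (μ := (volume : Measure Circ)) hp hpq
  refine ⟨C * 4 ^ q, ENNReal.mul_ne_top hC (ENNReal.rpow_ne_top_of_nonneg hq0.le (by simp)),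
    fun h hh => ?_⟩
  have hN : ∀ j : ℕ, 1 ≤ 2 ^ j := fun j => Nat.one_le_two_pow
  have hmain := hle (fun j x => ∫⁻ t, fejerKernel (2 ^ j) x t * h j t)
    (fun j => 4 * (2 ^ (j * (1 / p - 1 / q)) * (∫⁻ t, h j t ^ p) ^ (1 / p)))
    (fun j => ((measurable_fejerKernel _).mul ((hh j).comp measurable_snd)).lintegral_prod_right')
    (fun j => ?_) (fun j x => ?_)
  · refine hmain.trans_eq ?_
    simp_rw [ENNReal.mul_rpow_of_nonneg 4 _ hq0.le]
    rw [ENNReal.tsum_mul_left, mul_assoc]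
  · have h1 := eLpNorm_kernel_le (μ := (volume : Measure Circ)) (ν := (volume : Measure Circ))
      (p := ENNReal.ofReal p) (by simpa using hp) (measurable_fejerKernel (2 ^ j)) (hh j) (A := 4)
      (fun x => (lintegral_fejerKernel_right (hN j) x).le)
      (fun x => (lintegral_fejerKernel_left (hN j) x).le)
    rw [eLpNorm_eq_lintegral_rpow hp0, eLpNorm_eq_lintegral_rpow hp0] at h1
    refine h1.trans_eq ?_
    rw [mul_left_comm, ← mul_assoc ((2 : ℝ≥0∞) ^ _), ← two_rpow_add]
    simp
  · have h1 := lintegral_mul_le_of_bdd hp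
      ((measurable_fejerKernel (2 ^ j)).comp (measurable_prodMk_left (x := x)))
      (hh j) (lintegral_fejerKernel_right (hN j) x).le (fun t => fejerKernel_le _ x t)
    refine h1.trans ?_
    have e1 : ((2 ^ j : ℕ) : ℝ≥0∞) ^ (1 / p) = 2 ^ (j / q : ℝ) * 2 ^ (j * (1 / p - 1 / q)) := by
      rw [← two_rpow_add]; push_cast
      rw [← ENNReal.rpow_natCast, ← ENNReal.rpow_mul]; congr 1; ring
    have e2 : (4 : ℝ≥0∞) ^ (1 - 1 / p) ≤ 4 := by
      nth_rewrite 2 [← ENNReal.rpow_one 4]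
      exact ENNReal.rpow_le_rpow_of_exponent_le (by norm_num) (by
        have : 0 < 1 / p := by positivity
        linarith)
    rw [e1]
    calc _ ≤ 4 * (2 ^ (j / q : ℝ) * 2 ^ (j * (1 / p - 1 / q))) * (∫⁻ t, h j t ^ p) ^ (1 / p) := by
          gcongr
      _ = _ := by ring

/-! ### Multipliers of bounded variation -/

theorem hasSum_poisson {r : ℝ} (hr0 : 0 ≤ r) (hr1 : r < 1) (x : Circ) :
    HasSum (fun n : ℕ => (r : ℂ) ^ n * fourier (n : ℤ) x) (1 - r * fourier 1 x)⁻¹ := by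
  have h : ∀ n : ℕ, (r : ℂ) ^ n * fourier (n : ℤ) x = (r * fourier 1 x) ^ n := by
    intro n
    rw [mul_pow, fourier_one, fourier_apply]
    congr 1
    simp [AddCircle.toCircle_nsmul]
  simp_rw [h]
  refine hasSum_geometric_of_norm_lt_one ?_
  rw [norm_mul, norm_fourier_apply, mul_one, Complex.norm_real, Real.norm_eq_abs, abs_of_nonneg hr0]
  exact hr1

theorem one_sub_ne_zero {r : ℝ} (hr0 : 0 ≤ r) (hr1 : r < 1) (x : Circ) :
    (1 - r * fourier 1 x : ℂ) ≠ 0 := by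
  intro h
  have h1 : ‖(r * fourier 1 x : ℂ)‖ = 1 := by
    rw [← sub_eq_zero.1 h]; simp
  rw [norm_mul, norm_fourier_apply, mul_one, Complex.norm_real, Real.norm_eq_abs,
    abs_of_nonneg hr0] at h1
  linarith

theorem continuous_one_sub (r : ℝ) : Continuous fun x : Circ => (1 - r * fourier 1 x : ℂ) :=
  continuous_const.sub (continuous_const.mul (fourier 1).continuous)

theorem integral_inv_one_sub {r : ℝ} (hr0 : 0 ≤ r) (hr1 : r < 1) :
    ∫ x : Circ, (1 - r * fourier 1 x : ℂ)⁻¹ = ((2 * Real.pi : ℝ) : ℂ) := by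
  have hint : ∀ n : ℕ, Integrable (fun x : Circ => (r : ℂ) ^ n * fourier (n : ℤ) x) volume :=
    fun n => (integrable_of_continuous (fourier _).continuous).const_mul _
  have hs : Summable fun n : ℕ => ∫ x : Circ, ‖(r : ℂ) ^ n * fourier (n : ℤ) x‖ := by
    have h : ∀ n : ℕ, ∫ x : Circ, ‖(r : ℂ) ^ n * fourier (n : ℤ) x‖ =
        (volume : Measure Circ).real Set.univ * r ^ n := by
      intro n
      simp only [norm_mul, norm_fourier_apply, mul_one, norm_pow, Complex.norm_real,
        Real.norm_eq_abs, abs_of_nonneg hr0]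
      rw [integral_const, smul_eq_mul]
    simp_rw [h]
    exact (summable_geometric_of_lt_one hr0 hr1).mul_left _
  have h := hasSum_integral_of_summable_integral_norm hint hs
  simp only [(hasSum_poisson hr0 hr1 _).tsum_eq, integral_const_mul, integral_fourier] at h
  refine h.unique ?_
  have e : (fun n : ℕ => (r : ℂ) ^ n * if (n : ℤ) = 0 then ((2 * Real.pi : ℝ) : ℂ) else 0) =
      fun n => if n = 0 then ((2 * Real.pi : ℝ) : ℂ) else 0 := by
    funext n
    by_cases hn : n = 0
    · simp [hn]
    · simp [hn]
  rw [e]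
  exact hasSum_ite_eq (0 : ℕ) _

/-- The integral of the Poisson kernel, `|1 - r e^{ix}|⁻²` being its multiple by `(1 - r²)⁻¹`. -/
theorem integral_inv_normSq {r : ℝ} (hr0 : 0 ≤ r) (hr1 : r < 1) :
    ∫ x : Circ, (‖(1 - r * fourier 1 x : ℂ)‖ ^ 2)⁻¹ = 2 * Real.pi / (1 - r ^ 2) := by
  have hr2 : (0 : ℝ) < 1 - r ^ 2 := by nlinarith
  have hpt : ∀ x : Circ, (‖(1 - r * fourier 1 x : ℂ)‖ ^ 2)⁻¹ =
      (1 - r ^ 2)⁻¹ * (2 * ((1 - r * fourier 1 x : ℂ)⁻¹).re - 1) := by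
    intro x
    have hz := one_sub_ne_zero hr0 hr1 x
    have hn : ‖(1 - r * fourier 1 x : ℂ)‖ ^ 2 = Complex.normSq (1 - r * fourier 1 x) :=
      (Complex.normSq_eq_norm_sq _).symm
    have h1 : Complex.normSq (fourier 1 x) = 1 := by
      rw [Complex.normSq_eq_norm_sq, norm_fourier_apply]; norm_num
    have hpos : 0 < Complex.normSq (1 - r * fourier 1 x) := Complex.normSq_pos.2 hz
    rw [hn, Complex.inv_re]
    field_simp
    rw [Complex.normSq_apply] at h1 ⊢
    simp only [Complex.sub_re, Complex.one_re, Complex.mul_re, Complex.ofReal_re,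
      Complex.ofReal_im, zero_mul, sub_zero, Complex.sub_im, Complex.one_im, Complex.mul_im,
      add_zero, zero_sub]
    linear_combination r ^ 2 * h1
  have hcont : Continuous fun x : Circ => (1 - r * fourier 1 x : ℂ)⁻¹ :=
    (continuous_one_sub r).inv₀ (one_sub_ne_zero hr0 hr1)
  have hint := integrable_of_continuous hcont
  have hintre : Integrable (fun x : Circ => 2 * ((1 - r * fourier 1 x : ℂ)⁻¹).re) volume :=
    hint.re.const_mul 2
  simp_rw [hpt]
  rw [integral_const_mul, integral_sub hintre (integrable_const _),
    integral_const_mul]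
  have hre : ∫ x : Circ, ((1 - r * fourier 1 x : ℂ)⁻¹).re = 2 * Real.pi := by
    have := integral_re hint
    simp only [RCLike.re_to_complex] at this
    rw [this, integral_inv_one_sub hr0 hr1, Complex.ofReal_re]
  rw [hre, integral_const, Measure.real, AddCircle.measure_univ,
    ENNReal.toReal_ofReal Real.two_pi_pos.le]
  simp only [smul_eq_mul, mul_one]
  field_simp; ring

/-- Multiplication by `1 - r e^{ix}` turns coefficients into differences (summation by parts). -/
theorem one_sub_mul_trig {a : ℤ → ℂ} {M : ℤ} (ha : ∀ m, M < |m| → a m = 0)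
    (r : ℝ) (x : Circ) :
    (1 - r * fourier 1 x : ℂ) * trig (Finset.Icc (-M) M) a x =
      trig (Finset.Icc (-M) (M + 1)) (fun m => a m - r * a (m - 1)) x := by
  simp only [trig, sub_mul, Finset.sum_sub_distrib, one_mul]
  congr 1
  · refine Finset.sum_subset (Finset.Icc_subset_Icc_right (by omega)) fun m hm hm' => ?_
    rw [ha m, zero_mul]
    rw [Finset.mem_Icc] at hm hm'
    rw [lt_abs]; omega
  · rw [Finset.mul_sum]
    have h : ∀ m ∈ Finset.Icc (-M) M, (r : ℂ) * fourier 1 x * (a m * fourier m x) =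
        r * a ((m + 1) - 1) * fourier (m + 1) x := by
      intro m _
      rw [fourier_mul, add_sub_cancel_right]; ring
    rw [Finset.sum_congr rfl h]
    rw [← Finset.sum_subset (s₁ := Finset.Icc (-M + 1) (M + 1))
      (Finset.Icc_subset_Icc_left (by omega))]
    · refine Finset.sum_bij (fun m _ => m + 1) ?_ (by simp) ?_ (by simp)
      · intro m hm; rw [Finset.mem_Icc] at hm ⊢; omega
      · intro m hm
        rw [Finset.mem_Icc] at hm
        exact ⟨m - 1, by rw [Finset.mem_Icc]; omega, by ring⟩
    · intro m hm hm'
      rw [ha (m - 1)]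
      · simp
      · rw [Finset.mem_Icc] at hm hm'
        rw [lt_abs]; omega

theorem le_weighted_add {N A w l : ℝ} (hN : 0 < N) (hA : 0 < A) (hw : 0 < w) :
    l ≤ (A / (2 * N)) * (w ^ 2)⁻¹ + (N / (2 * A)) * (w * l) ^ 2 := by
  have h2 : (A / (2 * N)) * (w ^ 2)⁻¹ + (N / (2 * A)) * (w * l) ^ 2 - l =
      (A - N * w ^ 2 * l) ^ 2 / (2 * N * A * w ^ 2) := by
    field_simp; ring
  have h3 : 0 ≤ (A - N * w ^ 2 * l) ^ 2 / (2 * N * A * w ^ 2) := by positivity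
  linarith

/-- A Bernstein-type bound for the `L_1`-norm of a kernel whose coefficients are of size `A`, live
on frequencies `≲ N` and vary by at most `A / N` from one frequency to the next.  The weight in the
Cauchy–Schwarz inequality is a Poisson kernel with `1 - r` of order `1 / N`. -/
theorem integral_norm_trig_le {N : ℕ} (hN : 1 ≤ N) {A : ℝ} (hA : 0 < A) {a : ℤ → ℂ}
    (ha : ∀ m, ‖a m‖ ≤ A) (hd : ∀ m, ‖a m - a (m - 1)‖ ≤ A / N)
    (hs : ∀ m, 4 * (N : ℤ) < |m| → a m = 0) :
    ∫ x, ‖trig (Finset.Icc (-(4 * (N : ℤ))) (4 * N)) a x‖ ≤ 2 * Real.pi * (13 * A) := by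
  have hN0 : (0 : ℝ) < N := by positivity
  have hN1 : (1 : ℝ) ≤ N := by exact_mod_cast hN
  set r : ℝ := 1 - 1 / (2 * N) with hr
  have hrN : 1 / (2 * (N : ℝ)) ≤ 1 / 2 := by
    rw [div_le_div_iff₀ (by positivity) (by norm_num)]; linarith
  have hrpos : 0 < 1 / (2 * (N : ℝ)) := by positivity
  have hr0 : 0 ≤ r := by rw [hr]; linarith
  have hr1 : r < 1 := by rw [hr]; linarith
  set L := trig (Finset.Icc (-(4 * (N : ℤ))) (4 * N)) a
  set b : ℤ → ℂ := fun m => a m - r * a (m - 1) with hb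
  set T := Finset.Icc (-(4 * (N : ℤ))) (4 * N + 1)
  set w : Circ → ℝ := fun x => ‖(1 - r * fourier 1 x : ℂ)‖
  have hw0 : ∀ x, 0 < w x := fun x => norm_pos_iff.2 (one_sub_ne_zero hr0 hr1 x)
  have hwc : Continuous w := (continuous_one_sub r).norm
  have hpt : ∀ x, ‖L x‖ ≤ (A / (2 * N)) * (w x ^ 2)⁻¹ + (N / (2 * A)) * ‖trig T b x‖ ^ 2 := by
    intro x
    have h1 : ‖trig T b x‖ = w x * ‖L x‖ := by
      rw [← one_sub_mul_trig hs r x, norm_mul]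
    rw [h1]
    exact le_weighted_add hN0 hA (hw0 x)
  have hbm : ∀ m, ‖b m‖ ≤ 3 * A / (2 * N) := by
    intro m
    have : b m = (a m - a (m - 1)) + ((1 - r : ℝ) : ℂ) * a (m - 1) := by
      simp only [hb]; push_cast; ring
    rw [this]
    refine (norm_add_le _ _).trans ?_
    rw [norm_mul, Complex.norm_real, Real.norm_eq_abs, abs_of_pos (by linarith)]
    calc _ ≤ A / N + 1 / (2 * N) * A := by
          refine add_le_add (hd m) ?_
          have : 1 - r = 1 / (2 * N) := by rw [hr]; ring
          rw [this]
          exact mul_le_mul_of_nonneg_left (ha _) hrpos.le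
      _ = _ := by field_simp; ring
  have hcard : (T.card : ℝ) ≤ 10 * N := by
    have : T.card ≤ 10 * N := by
      simp only [T, Int.card_Icc]; omega
    exact_mod_cast this
  have hsum : ∑ m ∈ T, ‖b m‖ ^ 2 ≤ 10 * N * (3 * A / (2 * N)) ^ 2 := by
    have h1 : ∑ m ∈ T, ‖b m‖ ^ 2 ≤ T.card • (3 * A / (2 * N)) ^ 2 :=
      Finset.sum_le_card_nsmul T _ _ fun m _ => pow_le_pow_left₀ (norm_nonneg _) (hbm m) 2
    rw [nsmul_eq_mul] at h1
    exact h1.trans (mul_le_mul_of_nonneg_right hcard (sq_nonneg _))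
  have hpoisson : ∫ x, (w x ^ 2)⁻¹ ≤ 2 * Real.pi * (2 * N) := by
    rw [integral_inv_normSq hr0 hr1, div_eq_mul_inv]
    refine mul_le_mul_of_nonneg_left ?_ Real.two_pi_pos.le
    rw [inv_le_comm₀ (by nlinarith) (by positivity)]
    have : 1 - r = 1 / (2 * N) := by rw [hr]; ring
    have h2 : 1 - r ^ 2 = (1 - r) * (1 + r) := by ring
    rw [h2, this, one_div]
    exact le_mul_of_one_le_right (by positivity) (by linarith)
  have hi1 : Integrable (fun x => (A / (2 * N)) * (w x ^ 2)⁻¹) volume := by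
    refine Integrable.const_mul ?_ _
    exact ((hwc.pow 2).inv₀ fun x => (pow_pos (hw0 x) 2).ne').integrable_of_hasCompactSupport
      (HasCompactSupport.of_compactSpace _)
  have hi2 : Integrable (fun x => (N / (2 * A)) * ‖trig T b x‖ ^ 2) volume := by
    refine Integrable.const_mul ?_ _
    exact ((continuous_trig T b).norm.pow 2).integrable_of_hasCompactSupport
      (HasCompactSupport.of_compactSpace _)
  have h1 : ∫ x, ‖L x‖ ≤ ∫ x, ((A / (2 * N)) * (w x ^ 2)⁻¹ + (N / (2 * A)) * ‖trig T b x‖ ^ 2) :=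
    integral_mono (integrable_of_continuous (continuous_trig _ _)).norm (hi1.add hi2) hpt
  rw [integral_add hi1 hi2, integral_const_mul, integral_const_mul, integral_normSq_trig] at h1
  have h2 : (A / (2 * N)) * ∫ x, (w x ^ 2)⁻¹ ≤ (A / (2 * N)) * (2 * Real.pi * (2 * N)) :=
    mul_le_mul_of_nonneg_left hpoisson (by positivity)
  have h3 : (N / (2 * A)) * (2 * Real.pi * ∑ m ∈ T, ‖b m‖ ^ 2) ≤
      (N / (2 * A)) * (2 * Real.pi * (10 * N * (3 * A / (2 * N)) ^ 2)) :=
    mul_le_mul_of_nonneg_left (mul_le_mul_of_nonneg_left hsum Real.two_pi_pos.le) (by positivity)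
  have h4 : (A / (2 * N)) * (2 * Real.pi * (2 * N)) +
      (N / (2 * A)) * (2 * Real.pi * (10 * N * (3 * A / (2 * N)) ^ 2)) =
      2 * Real.pi * (49 / 4 * A) := by
    field_simp; ring
  have h5 : 2 * Real.pi * (49 / 4 * A) ≤ 2 * Real.pi * (13 * A) :=
    mul_le_mul_of_nonneg_left (by linarith) Real.two_pi_pos.le
  linarith

theorem enorm_integral_mul_le {μ : Measure Circ} (K f : Circ → ℂ) :
    ‖∫ t, K t * f t ∂μ‖ₑ ≤ ∫⁻ t, ‖K t‖ₑ * ‖f t‖ₑ ∂μ := by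
  refine (enorm_integral_le_lintegral_enorm _).trans_eq ?_
  simp only [enorm_mul]

theorem eLpNorm_enorm' {X : Type*} [MeasurableSpace X] {μ : Measure X} (f : X → ℂ) (p : ℝ≥0∞) :
    eLpNorm (fun x => ‖f x‖ₑ) p μ = eLpNorm f p μ := by
  refine eLpNorm_congr_enorm_ae ?_
  simp

/-- Coefficients as in `integral_norm_trig_le` form a Fourier multiplier on trigonometric
polynomials, for every `L_p`. -/
theorem eLpNorm_trig_mul_le {N : ℕ} (hN : 1 ≤ N) {A : ℝ} (hA : 0 < A) {a : ℤ → ℂ}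
    (ha : ∀ m, ‖a m‖ ≤ A) (hd : ∀ m, ‖a m - a (m - 1)‖ ≤ A / N)
    (hs : ∀ m, 4 * (N : ℤ) < |m| → a m = 0) {S : Finset ℤ} (hS : ∀ m ∈ S, |m| ≤ 4 * (N : ℤ))
    {p : ℝ≥0∞} (hp : 1 ≤ p) (c : ℤ → ℂ) :
    eLpNorm (trig S fun m => a m * c m) p volume ≤
      ENNReal.ofReal (13 * A) * eLpNorm (trig S c) p volume := by
  set T := Finset.Icc (-(4 * (N : ℤ))) (4 * N)
  have hST : S ⊆ T := fun m hm => Finset.mem_Icc.2 (abs_le.1 (hS m hm))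
  set K : Circ → ℂ := fun x => ((2 * Real.pi : ℝ) : ℂ)⁻¹ * trig T a x
  have hKc : Continuous K := continuous_const.mul (continuous_trig T a)
  have hK : ∫⁻ x, ‖K x‖ₑ ≤ ENNReal.ofReal (13 * A) := by
    rw [← ofReal_integral_norm_eq_lintegral_enorm (integrable_of_continuous hKc)]
    refine ENNReal.ofReal_le_ofReal ?_
    have hn : ∀ x, ‖K x‖ = (2 * Real.pi)⁻¹ * ‖trig T a x‖ := by
      intro x
      simp only [K]
      rw [norm_mul, norm_inv, Complex.norm_real, Real.norm_eq_abs, abs_of_pos Real.two_pi_pos]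
    simp_rw [hn]
    rw [integral_const_mul, inv_mul_le_iff₀ Real.two_pi_pos]
    exact integral_norm_trig_le hN hA ha hd hs
  have h := eLpNorm_kernel_le (μ := (volume : Measure Circ)) (ν := (volume : Measure Circ)) hp
    (N := fun x t => ‖K (x - t)‖ₑ) (f := fun t => ‖trig S c t‖ₑ)
    (hKc.comp (continuous_fst.sub continuous_snd)).enorm.measurable
    (continuous_trig S c).enorm.measurable (A := ENNReal.ofReal (13 * A))
    (fun x => by rw [lintegral_sub_left_eq_self (fun t => ‖K t‖ₑ) x]; exact hK)
    (fun x => by rw [lintegral_sub_right_eq_self (fun t => ‖K t‖ₑ) x]; exact hK)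
  rw [eLpNorm_enorm'] at h
  refine le_trans (eLpNorm_mono_enorm fun x => ?_) h
  rw [← integral_trig_sub_mul_trig hST a c x, enorm_eq_self]
  exact enorm_integral_mul_le (fun t => K (x - t)) (trig S c)

/-- The dyadic set of frequencies that carries the `k`-th block. -/
noncomputable def freqSet (k : ℕ) : Finset ℤ :=
  (Finset.Icc (-(2 : ℤ) ^ (k + 1)) (2 ^ (k + 1))).filter fun m => k = 0 ∨ 2 ^ k ≤ 2 * |m|

theorem abs_le_of_mem_freqSet {k : ℕ} {m : ℤ} (hm : m ∈ freqSet k) : |m| ≤ 2 ^ (k + 1) :=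
  abs_le.2 (Finset.mem_Icc.1 (Finset.mem_filter.1 hm).1)

/-- A bounded Lipschitz function, supported in `[0, 4]`, that equals `ξ^s` on `[1/2, 2]`. -/
theorem exists_cutoff_rpow (s : ℝ) : ∃ (ψ : ℝ → ℝ) (K : NNReal), LipschitzWith K ψ ∧
    (∀ ξ, ξ ∈ Set.Icc (1 / 2 : ℝ) 2 → ψ ξ = ξ ^ s) ∧ (∀ ξ, 4 < |ξ| ∨ ξ ≤ 0 → ψ ξ = 0) ∧
    ∃ B : ℝ, ∀ ξ, |ψ ξ| ≤ B := by
  let β : ContDiffBump (5 / 4 : ℝ) := ⟨3 / 4, 1, by norm_num, by norm_num⟩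
  have hout : ∀ ξ : ℝ, 1 ≤ |ξ - 5 / 4| → β ξ = 0 := fun ξ h =>
    β.zero_of_le_dist (by rw [Real.dist_eq]; exact h)
  have hsmooth : ContDiff ℝ 1 fun ξ => β ξ * ξ ^ s := by
    rw [contDiff_iff_contDiffAt]
    intro ξ
    rcases le_or_gt ξ (1 / 8) with h | h
    · have : (fun ξ => β ξ * ξ ^ s) =ᶠ[nhds ξ] fun _ => 0 := by
        filter_upwards [Iio_mem_nhds (by linarith : ξ < 1 / 4)] with y hy
        rw [hout y, zero_mul]
        have hy' : y < 1 / 4 := hy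
        rw [abs_of_neg (by linarith)]; linarith
      exact contDiffAt_const.congr_of_eventuallyEq this
    · exact β.contDiff.contDiffAt.mul (Real.contDiffAt_rpow_const_of_ne (by linarith))
  have hcomp : HasCompactSupport fun ξ => β ξ * ξ ^ s := β.hasCompactSupport.mul_right
  obtain ⟨K, hK⟩ := hsmooth.lipschitzWith_of_hasCompactSupport hcomp (by simp)
  refine ⟨fun ξ => β ξ * ξ ^ s, K, hK, fun ξ hξ => ?_, fun ξ hξ => ?_, ?_⟩
  · simp only
    rw [β.one_of_mem_closedBall, one_mul]
    rw [Metric.mem_closedBall, Real.dist_eq, abs_le]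
    constructor <;> simp only [β] <;> linarith [hξ.1, hξ.2]
  · simp only
    rw [hout, zero_mul]
    rcases hξ with h | h
    · rcases lt_abs.1 h with h | h
      · rw [abs_of_pos (by linarith)]; linarith
      · rw [abs_of_neg (by linarith)]; linarith
    · rw [abs_of_neg (by linarith)]; linarith
  · obtain ⟨B, hB⟩ := hsmooth.continuous.norm.bddAbove_range_of_hasCompactSupport hcomp.norm
    exact ⟨B, fun ξ => hB ⟨ξ, rfl⟩⟩

/-- Bernstein's inequality of order `s` for trigonometric polynomials with frequencies in one dyadic
block: on the block, `(2^{-k} m)^s` is the restriction of a multiplier with smoothly varying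
coefficients, to which `eLpNorm_trig_mul_le` applies. -/
theorem exists_eLpNorm_cpow_le (s : ℝ) {p : ℝ≥0∞} (hp : 1 ≤ p) :
    ∃ C : ℝ≥0∞, C ≠ ∞ ∧ ∀ (k : ℕ) (c : ℤ → ℂ),
      eLpNorm (trig (freqSet k) fun m => (((m : ℝ) / 2 ^ k : ℝ) : ℂ) ^ (s : ℂ) * c m) p volume ≤
        C * eLpNorm (trig (freqSet k) c) p volume := by
  obtain ⟨ψ, K, hK, hψ1, hψ0, B, hB⟩ := exists_cutoff_rpow s
  set ζ : ℂ := Complex.exp (Real.pi * Complex.I * s)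
  have hζ : ‖ζ‖ = 1 := by
    simp only [ζ]
    rw [show (Real.pi * Complex.I * s : ℂ) = ((Real.pi * s : ℝ) : ℂ) * Complex.I by push_cast; ring]
    exact Complex.norm_exp_ofReal_mul_I _
  -- for a negative base the principal power contributes the phase `ζ`
  have hpow : ∀ ξ : ℝ, 1 / 2 ≤ |ξ| → |ξ| ≤ 2 → (ξ : ℂ) ^ (s : ℂ) = ψ ξ + ζ * ψ (-ξ) := by
    intro ξ h1 h2
    rcases le_or_gt ξ 0 with h | h
    · rw [abs_of_nonpos h] at h1 h2
      rw [Complex.ofReal_cpow_of_nonpos h, hψ0 ξ (Or.inr h), hψ1 (-ξ) ⟨h1, h2⟩,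
        Complex.ofReal_cpow (by linarith)]
      push_cast
      simp only [ζ]; ring
    · rw [abs_of_pos h] at h1 h2
      rw [hψ0 (-ξ) (Or.inr (by linarith)), hψ1 ξ ⟨h1, h2⟩, Complex.ofReal_cpow h.le]
      simp
  set B0 : ℝ := ∑ m ∈ freqSet 0, ‖((m : ℝ) : ℂ) ^ (s : ℂ)‖
  have hB0 : 0 ≤ B0 := Finset.sum_nonneg fun _ _ => norm_nonneg _
  have hBn : 0 ≤ B := (abs_nonneg _).trans (hB 0)
  set A : ℝ := 2 * B + 2 * K + 2 * B0 + 1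
  have hA : 0 < A := by positivity
  refine ⟨ENNReal.ofReal (13 * A), ENNReal.ofReal_ne_top, fun k c => ?_⟩
  -- the lowest block contains the frequency `0`, but it is a finite set
  rcases Nat.eq_zero_or_pos k with rfl | hk
  · set a : ℤ → ℂ := fun m => if m ∈ freqSet 0 then ((m : ℝ) : ℂ) ^ (s : ℂ) else 0
    have ha : ∀ m, ‖a m‖ ≤ B0 := by
      intro m
      by_cases hm : m ∈ freqSet 0
      · simp only [a, if_pos hm]
        exact Finset.single_le_sum (f := fun m : ℤ => ‖((m : ℝ) : ℂ) ^ (s : ℂ)‖)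
          (fun _ _ => norm_nonneg _) hm
      · simp only [a, if_neg hm, norm_zero]; exact hB0
    have h := eLpNorm_trig_mul_le (N := 1) le_rfl hA (a := a) (S := freqSet 0)
      (fun m => (ha m).trans (by simp only [A]; linarith [K.coe_nonneg]))
      (fun m => (norm_sub_le _ _).trans (by
        simp only [A, Nat.cast_one, div_one]; linarith [ha m, ha (m - 1), K.coe_nonneg]))
      (fun m hm => if_neg fun hm' => by
        have := abs_le_of_mem_freqSet hm'; norm_num at this hm; omega)
      (fun m hm => by have := abs_le_of_mem_freqSet hm; norm_num at this ⊢; omega) hp c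
    refine le_trans (le_of_eq ?_) h
    congr 1
    funext x
    refine Finset.sum_congr rfl fun m hm => ?_
    simp only [a, if_pos hm]; norm_num
  · have h2k : (0 : ℝ) < 2 ^ k := by positivity
    set a : ℤ → ℂ := fun m => ψ ((m : ℝ) / 2 ^ k) + ζ * ψ (-((m : ℝ) / 2 ^ k))
    have ha : ∀ m, ‖a m‖ ≤ A := by
      intro m
      refine (norm_add_le _ _).trans ?_
      rw [norm_mul, hζ, one_mul, Complex.norm_real, Complex.norm_real, Real.norm_eq_abs,
        Real.norm_eq_abs]
      have := hB ((m : ℝ) / 2 ^ k)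
      have := hB (-((m : ℝ) / 2 ^ k))
      simp only [A]; linarith [K.coe_nonneg]
    have hlip : ∀ x y, |ψ x - ψ y| ≤ K * |x - y| := by
      intro x y
      have := hK.dist_le_mul x y
      rwa [Real.dist_eq, Real.dist_eq] at this
    have hd : ∀ m, ‖a m - a (m - 1)‖ ≤ A / (2 ^ k : ℕ) := by
      intro m
      have e : a m - a (m - 1) = ((ψ ((m : ℝ) / 2 ^ k) - ψ (((m - 1 : ℤ) : ℝ) / 2 ^ k) : ℝ) : ℂ) +
          ζ * ((ψ (-((m : ℝ) / 2 ^ k)) - ψ (-(((m - 1 : ℤ) : ℝ) / 2 ^ k)) : ℝ) : ℂ) := by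
        simp only [a]; push_cast; ring
      rw [e]
      refine (norm_add_le _ _).trans ?_
      rw [norm_mul, hζ, one_mul, Complex.norm_real, Complex.norm_real, Real.norm_eq_abs,
        Real.norm_eq_abs]
      have e1 : |(m : ℝ) / 2 ^ k - ((m - 1 : ℤ) : ℝ) / 2 ^ k| = 1 / 2 ^ k := by
        rw [← sub_div]; push_cast
        rw [sub_sub_cancel, abs_of_pos (by positivity)]
      have e2 : |-((m : ℝ) / 2 ^ k) - -(((m - 1 : ℤ) : ℝ) / 2 ^ k)| = 1 / 2 ^ k := by
        rw [neg_sub_neg, abs_sub_comm, e1]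
      have h1 := hlip ((m : ℝ) / 2 ^ k) (((m - 1 : ℤ) : ℝ) / 2 ^ k)
      have h2 := hlip (-((m : ℝ) / 2 ^ k)) (-(((m - 1 : ℤ) : ℝ) / 2 ^ k))
      rw [e1] at h1
      rw [e2] at h2
      calc _ ≤ (K : ℝ) * (1 / 2 ^ k) + (K : ℝ) * (1 / 2 ^ k) := add_le_add h1 h2
        _ = (2 * (K : ℝ)) / 2 ^ k := by ring
        _ ≤ A / (2 ^ k : ℕ) := by
            push_cast
            gcongr
            simp only [A]; linarith
    have hs0 : ∀ m : ℤ, 4 * ((2 ^ k : ℕ) : ℤ) < |m| → a m = 0 := by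
      intro m hm
      have h4 : 4 < |(m : ℝ) / 2 ^ k| := by
        rw [abs_div, abs_of_pos h2k, lt_div_iff₀ h2k]
        have : ((4 * ((2 ^ k : ℕ) : ℤ) : ℤ) : ℝ) < ((|m| : ℤ) : ℝ) := by exact_mod_cast hm
        push_cast at this; exact this
      simp only [a]
      rw [hψ0 _ (Or.inl h4), hψ0 _ (Or.inl (by rwa [abs_neg]))]
      simp
    have h := eLpNorm_trig_mul_le (N := 2 ^ k) Nat.one_le_two_pow hA (a := a) (S := freqSet k)
      ha hd hs0 (fun m hm => by
        have := abs_le_of_mem_freqSet hm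
        rw [pow_succ] at this; push_cast
        have h0 : (0 : ℤ) < 2 ^ k := by positivity
        linarith) hp c
    refine le_trans (le_of_eq ?_) h
    congr 1
    funext x
    refine Finset.sum_congr rfl fun m hm => ?_
    have hm1 := abs_le_of_mem_freqSet hm
    have hm2 : (2 : ℤ) ^ k ≤ 2 * |m| := ((Finset.mem_filter.1 hm).2).resolve_left (by omega)
    have hm1' : |(m : ℝ)| ≤ 2 ^ (k + 1) := by exact_mod_cast hm1
    have hm2' : (2 : ℝ) ^ k ≤ 2 * |(m : ℝ)| := by exact_mod_cast hm2
    simp only [a]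
    rw [hpow]
    · rw [abs_div, abs_of_pos h2k, le_div_iff₀ h2k]; linarith
    · rw [abs_div, abs_of_pos h2k, div_le_iff₀ h2k]; rw [pow_succ] at hm1'; linarith

/-! ### The nodes -/

/-- The node `x_k^j` as a point of the circle. -/
noncomputable def nodePt (j : ℕ) (k : ℤ) : Circ := ((node j k : ℝ) : Circ)

theorem nodePt_add (j : ℕ) (k l : ℤ) : nodePt j (k + l) = nodePt j k + nodePt j l := by
  unfold nodePt node
  rw [← AddCircle.coe_add]; congr 1; push_cast; ring

theorem nodePt_two_pow (j : ℕ) : nodePt j (2 ^ j) = 0 := by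
  unfold nodePt node
  have h : 2 * Real.pi * ((2 ^ j : ℤ) : ℝ) / 2 ^ j = 2 * Real.pi := by
    push_cast; field_simp
  rw [h, AddCircle.coe_period]

theorem nodePt_add_two_pow (j : ℕ) (k : ℤ) : nodePt j (k + 2 ^ j) = nodePt j k := by
  rw [nodePt_add, nodePt_two_pow, add_zero]

theorem nodePt_neg (j : ℕ) (k : ℤ) : nodePt j (-k) = -nodePt j k := by
  unfold nodePt node
  rw [← AddCircle.coe_neg]; congr 1; push_cast; ring

theorem nodePt_eq_zsmul (j : ℕ) (k : ℤ) : nodePt j k = k • nodePt j 1 := by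
  unfold nodePt node
  rw [← AddCircle.coe_zsmul]; congr 1; rw [zsmul_eq_mul]; push_cast; ring

theorem indexSet_eq (j : ℕ) :
    indexSet j = Finset.Ico (-((2 : ℤ) ^ j / 2)) (-((2 : ℤ) ^ j / 2) + 2 ^ j) := by
  ext k
  have h1 : (-((2 : ℝ) ^ j / 2) ≤ (k : ℝ)) ↔ -(2 : ℤ) ^ j ≤ 2 * k := by
    rw [← Int.cast_le (R := ℝ)]; push_cast
    constructor <;> intro h <;> linarith
  have h2 : ((k : ℝ) < (2 : ℝ) ^ j / 2) ↔ 2 * k < (2 : ℤ) ^ j := by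
    rw [← Int.cast_lt (R := ℝ)]; push_cast
    constructor <;> intro h <;> linarith
  simp only [indexSet, Finset.mem_filter, Finset.mem_Ico, h1, h2]
  rcases j with _ | j
  · simp only [pow_zero]; omega
  · have h0 : (0 : ℤ) < 2 ^ j := by positivity
    rw [pow_succ]; omega

theorem card_indexSet (j : ℕ) : (indexSet j).card = 2 ^ j := by
  rw [indexSet_eq, Int.card_Ico]
  have : ((2 : ℤ) ^ j) = ((2 ^ j : ℕ) : ℤ) := by push_cast; rfl
  rw [add_sub_cancel_left, this, Int.toNat_natCast]

theorem sum_Ico_periodic {M : Type*} [AddCommMonoid M] {n : ℤ} (hn : 0 < n) {g : ℤ → M}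
    (hg : ∀ k, g (k + n) = g k) (a b : ℤ) :
    ∑ k ∈ Finset.Ico a (a + n), g k = ∑ k ∈ Finset.Ico b (b + n), g k := by
  have step : ∀ a : ℤ, ∑ k ∈ Finset.Ico a (a + n), g k =
      ∑ k ∈ Finset.Ico (a + 1) (a + 1 + n), g k := by
    intro a
    have e1 : Finset.Ico a (a + n) = insert a (Finset.Ico (a + 1) (a + n)) := by
      ext k; simp only [Finset.mem_Ico, Finset.mem_insert]; omega
    have e2 : Finset.Ico (a + 1) (a + 1 + n) = insert (a + n) (Finset.Ico (a + 1) (a + n)) := by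
      ext k; simp only [Finset.mem_Ico, Finset.mem_insert]; omega
    rw [e1, e2, Finset.sum_insert (by simp), Finset.sum_insert (by simp), hg]
  have hnat : ∀ (l : ℕ) (a : ℤ), ∑ k ∈ Finset.Ico a (a + n), g k =
      ∑ k ∈ Finset.Ico (a + l) (a + l + n), g k := by
    intro l
    induction l with
    | zero => intro a; simp
    | succ l ih =>
      intro a
      rw [ih a, step]; push_cast; simp only [add_assoc]
  rcases le_total a b with h | h
  · have := hnat (b - a).toNat a
    rwa [Int.toNat_of_nonneg (by omega), add_sub_cancel] at this
  · have := hnat (a - b).toNat b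
    rw [Int.toNat_of_nonneg (by omega), add_sub_cancel] at this
    exact this.symm

theorem sum_indexSet_add {M : Type*} [AddCommMonoid M] (j : ℕ) {g : ℤ → M}
    (hg : ∀ k, g (k + 2 ^ j) = g k) (l : ℤ) :
    ∑ k ∈ indexSet j, g (k + l) = ∑ k ∈ indexSet j, g k := by
  rw [indexSet_eq]
  set a := -((2 : ℤ) ^ j / 2)
  rw [sum_Ico_periodic (by positivity) hg a (a + l)]
  refine Finset.sum_bij (fun k _ => k + l) ?_ (by simp) ?_ (by simp)
  · intro k hk; rw [Finset.mem_Ico] at hk ⊢; omega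
  · intro k hk
    rw [Finset.mem_Ico] at hk
    exact ⟨k - l, by rw [Finset.mem_Ico]; omega, by ring⟩

theorem sum_indexSet_neg {M : Type*} [AddCommMonoid M] (j : ℕ) {g : ℤ → M}
    (hg : ∀ k, g (k + 2 ^ j) = g k) :
    ∑ k ∈ indexSet j, g (-k) = ∑ k ∈ indexSet j, g k := by
  rw [indexSet_eq]
  set a := -((2 : ℤ) ^ j / 2)
  rw [sum_Ico_periodic (by positivity) hg a (-a - 2 ^ j + 1)]
  refine Finset.sum_bij (fun k _ => -k) ?_ (by simp) ?_ (by simp)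
  · intro k hk; rw [Finset.mem_Ico] at hk ⊢; omega
  · intro k hk
    rw [Finset.mem_Ico] at hk
    exact ⟨-k, by rw [Finset.mem_Ico]; omega, by ring⟩

theorem fourier_add_apply (m : ℤ) (x t : Circ) :
    fourier m (x + t) = fourier m x * fourier m t := by
  rw [fourier_apply, fourier_apply, fourier_apply, smul_add, AddCircle.toCircle_add]
  simp

theorem fourier_nodePt_one (j : ℕ) (m : ℤ) :
    fourier m (nodePt j 1) = Complex.exp (2 * Real.pi * Complex.I * (m / 2 ^ j)) := by
  unfold nodePt node
  rw [fourier_coe_apply]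
  congr 1
  have : (Real.pi : ℂ) ≠ 0 := by exact_mod_cast Real.pi_ne_zero
  push_cast; field_simp

theorem fourier_nodePt_one_eq_one_iff (j : ℕ) (m : ℤ) :
    fourier m (nodePt j 1) = 1 ↔ (2 : ℤ) ^ j ∣ m := by
  rw [fourier_nodePt_one, Complex.exp_eq_one_iff]
  have hpi : (2 * Real.pi * Complex.I : ℂ) ≠ 0 := Complex.two_pi_I_ne_zero
  constructor
  · rintro ⟨n, hn⟩
    refine ⟨n, ?_⟩
    rw [mul_comm] at hn
    have h1 := mul_right_cancel₀ hpi hn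
    rw [div_eq_iff (pow_ne_zero _ two_ne_zero)] at h1
    have : (m : ℂ) = (((2 : ℤ) ^ j * n : ℤ) : ℂ) := by rw [h1]; push_cast; ring
    exact_mod_cast this
  · rintro ⟨n, rfl⟩
    refine ⟨n, ?_⟩
    push_cast; field_simp

/-- Orthogonality of the characters on the equidistant nodes. -/
theorem sum_fourier_nodePt (j : ℕ) (m : ℤ) :
    ∑ k ∈ indexSet j, fourier m (nodePt j k) = if (2 : ℤ) ^ j ∣ m then (2 : ℂ) ^ j else 0 := by
  have hshift := sum_indexSet_add j (g := fun k => fourier m (nodePt j k))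
    (fun k => by rw [nodePt_add_two_pow]) 1
  simp only [nodePt_add, fourier_add_apply, ← Finset.sum_mul] at hshift
  split_ifs with h
  · have h1 := (fourier_nodePt_one_eq_one_iff j m).2 h
    have : ∀ k ∈ indexSet j, fourier m (nodePt j k) = (1 : ℂ) := by
      intro k _
      rw [nodePt_eq_zsmul, fourier_apply, smul_comm, AddCircle.toCircle_zsmul,
        Circle.coe_zpow, ← fourier_apply, h1, one_zpow]
    rw [Finset.sum_congr rfl this]
    simp [card_indexSet]
  · have h1 := mt (fourier_nodePt_one_eq_one_iff j m).1 h
    by_contra h0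
    exact h1 (mul_left_cancel₀ h0 (hshift.trans (mul_one _).symm))

/-- The mean of the Fejér majorant over the nodes. -/
theorem sum_fejerKernel_nodePt_le (j : ℕ) (x : Circ) :
    ∑ k ∈ indexSet j, fejerKernel (2 ^ j) x (nodePt j k) ≤ 2 ^ j := by
  have hD : ∑ k ∈ indexSet j, ‖dirichlet (2 ^ j) (x - nodePt j k)‖ ^ 2 = ((2 : ℝ) ^ j) ^ 2 := by
    have hexp : ∀ k, ((‖dirichlet (2 ^ j) (x - nodePt j k)‖ ^ 2 : ℝ) : ℂ) =
        ∑ a ∈ Finset.range (2 ^ j), ∑ b ∈ Finset.range (2 ^ j),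
          fourier ((a : ℤ) - b) x * fourier ((b : ℤ) - a) (nodePt j k) := by
      intro k
      have h1 : ((‖dirichlet (2 ^ j) (x - nodePt j k)‖ ^ 2 : ℝ) : ℂ) =
          dirichlet (2 ^ j) (x - nodePt j k) *
            (starRingEnd ℂ) (dirichlet (2 ^ j) (x - nodePt j k)) := by
        rw [Complex.mul_conj, Complex.normSq_eq_norm_sq]
      rw [h1, dirichlet, map_sum, Finset.sum_mul_sum]
      refine Finset.sum_congr rfl fun a _ => Finset.sum_congr rfl fun b _ => ?_
      rw [← fourier_neg, ← fourier_mul, fourier_sub_apply]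
      congr 2; ring_nf
    have hc : ((∑ k ∈ indexSet j, ‖dirichlet (2 ^ j) (x - nodePt j k)‖ ^ 2 : ℝ) : ℂ) =
        ((((2 : ℝ) ^ j) ^ 2 : ℝ) : ℂ) := by
      rw [Complex.ofReal_sum]
      simp_rw [hexp]
      rw [Finset.sum_comm]
      have : ∀ a ∈ Finset.range (2 ^ j), ∑ k ∈ indexSet j, ∑ b ∈ Finset.range (2 ^ j),
          fourier ((a : ℤ) - b) x * fourier ((b : ℤ) - a) (nodePt j k) = (2 : ℂ) ^ j := by
        intro a ha
        rw [Finset.sum_comm]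
        simp_rw [← Finset.mul_sum, sum_fourier_nodePt]
        rw [Finset.sum_eq_single a]
        · simp
        · intro b hb hba
          rw [if_neg, mul_zero]
          intro hdvd
          have ha' := Finset.mem_range.1 ha
          have hb' := Finset.mem_range.1 hb
          have h3 : ((b : ℤ) - a) = 0 := by
            refine Int.eq_zero_of_abs_lt_dvd hdvd ?_
            have : ((2 : ℤ) ^ j) = ((2 ^ j : ℕ) : ℤ) := by push_cast; rfl
            rw [this, abs_lt]; omega
          omega
        · intro h; exact absurd ha h
      rw [Finset.sum_congr rfl this]
      simp; ring
    exact_mod_cast hc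
  have hreal : ∑ k ∈ indexSet j, fejer (2 ^ j) (x - nodePt j k) ≤ 2 ^ j := by
    unfold fejer
    rw [← Finset.mul_sum, ← Finset.mul_sum, hD]
    push_cast
    have hpi : 4 ≤ 2 * Real.pi := by linarith [Real.pi_gt_three]
    calc (2 * Real.pi)⁻¹ * (4 * ((2 : ℝ) ^ j)⁻¹ * ((2 : ℝ) ^ j) ^ 2)
        = 4 / (2 * Real.pi) * 2 ^ j := by field_simp
      _ ≤ 1 * 2 ^ j := by
          gcongr
          rw [div_le_one Real.two_pi_pos]; exact hpi
      _ = 2 ^ j := one_mul _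
  unfold fejerKernel
  rw [← ENNReal.ofReal_sum_of_nonneg fun k _ => fejer_nonneg _ _]
  refine (ENNReal.ofReal_le_ofReal hreal).trans_eq ?_
  rw [ENNReal.ofReal_pow (by norm_num)]; simp

/-! ### The operators on trigonometric polynomials -/

theorem conv_eq (f g : Circ → ℂ) (x : Circ) :
    conv f g x = ((2 * Real.pi : ℝ) : ℂ)⁻¹ * ∫ t, f t * g (x - t) := by
  unfold conv
  have h := integral_sub_left_eq_self (fun t => f t * g (x - t)) volume x
  simp only [sub_sub_cancel] at h
  rw [h]

theorem conv_fourier (w : Circ → ℂ) (m : ℤ) (x : Circ) :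
    conv (fourier m) w x = fourierCoeff w m * fourier m x := by
  unfold conv
  rw [fourierCoeff_eq_integral]
  simp only [fourier_sub_apply, mul_assoc]
  rw [integral_const_mul]; ring

theorem conv_trig {w : Circ → ℂ} (hw : Integrable w volume) (S : Finset ℤ) (c : ℤ → ℂ) (x : Circ) :
    conv (trig S c) w x = ∑ m ∈ S, c m * conv (fourier m) w x := by
  unfold conv
  simp only [trig, Finset.sum_mul]
  rw [integral_finsetSum, Finset.mul_sum]
  · refine Finset.sum_congr rfl fun m _ => ?_
    simp only [mul_assoc]
    rw [integral_const_mul]; ring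
  · intro m _
    simp only [mul_assoc]
    refine Integrable.const_mul ?_ _
    refine hw.bdd_mul (c := 1) ((fourier m).continuous.comp
      (continuous_const.sub continuous_id)).aestronglyMeasurable
      (Filter.Eventually.of_forall fun t => ?_)
    exact (norm_fourier_apply m _).le

/-- The frequencies of `trigPoly j`. -/
noncomputable def polyFreq (j : ℕ) : Finset ℤ := Finset.Ico (-(2 : ℤ) ^ j) (2 ^ j)

/-- Elements of `trigPoly j`, a span, in coordinates. -/
theorem exists_eq_trig {j : ℕ} {f : Circ → ℂ} (hf : f ∈ trigPoly j) :
    ∃ c : ℤ → ℂ, f = trig (polyFreq j) c := by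
  unfold trigPoly at hf
  induction hf using Submodule.span_induction with
  | mem x h =>
    obtain ⟨k, hk, rfl⟩ := h
    refine ⟨Pi.single k 1, ?_⟩
    funext x
    unfold trig
    rw [Finset.sum_eq_single k]
    · simp
    · intro b _ hb; simp [hb]
    · intro h; exact absurd (Finset.mem_Ico.2 hk) h
  | zero => exact ⟨0, by funext x; simp [trig]⟩
  | add x y _ _ hx hy =>
    obtain ⟨c, rfl⟩ := hx
    obtain ⟨d, rfl⟩ := hy
    exact ⟨c + d, by funext x; simp [trig, add_mul, Finset.sum_add_distrib]⟩
  | smul a x _ hx =>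
    obtain ⟨c, rfl⟩ := hx
    exact ⟨a • c, by funext x; simp [trig, Finset.mul_sum, mul_assoc]⟩

theorem eq_trig_fourierCoeff {j : ℕ} {f : Circ → ℂ} (hf : f ∈ trigPoly j) :
    f = trig (polyFreq j) (fourierCoeff f) := by
  obtain ⟨c, hc⟩ := exists_eq_trig hf
  nth_rewrite 1 [hc]
  funext x
  refine Finset.sum_congr rfl fun m hm => ?_
  rw [hc, fourierCoeff_trig, if_pos hm]

theorem fourierCoeff_eq_zero_of_trigPoly {j : ℕ} {f : Circ → ℂ} (hf : f ∈ trigPoly j) {m : ℤ}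
    (hm : m ∉ polyFreq j) : fourierCoeff f m = 0 := by
  rw [eq_trig_fourierCoeff hf, fourierCoeff_trig, if_neg hm]

theorem continuous_of_trigPoly {j : ℕ} {f : Circ → ℂ} (hf : f ∈ trigPoly j) : Continuous f := by
  rw [eq_trig_fourierCoeff hf]; exact continuous_trig _ _

theorem abs_le_of_mem_polyFreq {j : ℕ} {m : ℤ} (hm : m ∈ polyFreq j) : |m| ≤ 2 ^ j := by
  have := Finset.mem_Ico.1 hm
  exact abs_le.2 ⟨this.1, this.2.le⟩

section Operators

variable {v w : ℕ → Circ → ℂ}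

/-- Sampling at the nodes aliases the frequencies modulo `2^j`. -/
theorem quasiInterp_fourier (hv : ∀ j, v j ∈ trigPoly j) (j : ℕ) (m : ℤ) (x : Circ) :
    quasiInterp v w j (fourier m) x =
      fourierCoeff (w j) m * ∑ l ∈ polyFreq j, (if (2 : ℤ) ^ j ∣ m - l then 1 else 0) *
        (fourierCoeff (v j) l * fourier l x) := by
  have hvx : ∀ k, v j (x - nodePt j k) =
      ∑ l ∈ polyFreq j, fourierCoeff (v j) l * (fourier l x * fourier (-l) (nodePt j k)) := by
    intro k
    conv_lhs => rw [eq_trig_fourierCoeff (hv j)]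
    exact Finset.sum_congr rfl fun l _ => by rw [fourier_sub_apply]
  have hnode : ∀ k, ((node j k : ℝ) : Circ) = nodePt j k := fun _ => rfl
  unfold quasiInterp
  simp only [conv_fourier, hnode, hvx]
  have h2 : (2 : ℂ) ^ j ≠ 0 := pow_ne_zero _ two_ne_zero
  calc _ = ((2 : ℂ) ^ j)⁻¹ * ∑ k ∈ indexSet j, ∑ l ∈ polyFreq j,
        fourierCoeff (w j) m * (fourierCoeff (v j) l * fourier l x) *
          fourier (m - l) (nodePt j k) := by
        congr 1
        refine Finset.sum_congr rfl fun k _ => ?_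
        rw [Finset.mul_sum]
        refine Finset.sum_congr rfl fun l _ => ?_
        rw [sub_eq_add_neg, fourier_mul]; ring
    _ = _ := by
        rw [Finset.sum_comm, Finset.mul_sum, Finset.mul_sum]
        refine Finset.sum_congr rfl fun l _ => ?_
        rw [← Finset.mul_sum, sum_fourier_nodePt]
        split_ifs
        · field_simp
        · ring

/-- Characters of small frequency are eigenfunctions: the band limitation of `v_j` excludes all
aliases. -/
theorem quasiInterp_fourier_of_small (hv : ∀ j, v j ∈ trigPoly j) {ρ : ℝ}
    (hρ : ∀ (j : ℕ) (k : ℤ), ρ * 2 ^ j < |(k : ℝ)| → fourierCoeff (v j) k = 0) {j : ℕ} {m : ℤ}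
    (hm : |(m : ℝ)| < (1 - ρ) * 2 ^ j) (x : Circ) :
    quasiInterp v w j (fourier m) x =
      fourierCoeff (v j) m * fourierCoeff (w j) m * fourier m x := by
  rw [quasiInterp_fourier hv, Finset.sum_eq_single m]
  · simp; ring
  · intro l _ hl
    split_ifs with hdvd
    · rw [hρ j l]
      · simp
      · have h1 : (2 : ℤ) ^ j ≤ |m - l| :=
          Int.le_of_dvd (abs_pos.2 (sub_ne_zero.2 (Ne.symm hl))) ((dvd_abs _ _).2 hdvd)
        have h2 : (2 : ℝ) ^ j ≤ |(m : ℝ) - l| := by exact_mod_cast h1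
        have h3 := abs_sub (m : ℝ) l
        linarith
    · simp
  · intro h
    rw [fourierCoeff_eq_zero_of_trigPoly (hv j) h]; simp

/-- Linearity of `Q_j` on trigonometric polynomials. -/
theorem quasiInterp_trig (hw : ∀ j, Integrable (w j) volume) (j : ℕ) (S : Finset ℤ) (c : ℤ → ℂ)
    (x : Circ) :
    quasiInterp v w j (trig S c) x = ∑ m ∈ S, c m * quasiInterp v w j (fourier m) x := by
  unfold quasiInterp
  simp only [conv_trig (hw j), Finset.sum_mul, Finset.mul_sum]
  rw [Finset.sum_comm]
  exact Finset.sum_congr rfl fun m _ => Finset.sum_congr rfl fun k _ => by ring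

/-- `Q_j` has its range in the trigonometric polynomials of degree at most `2^j`. -/
theorem reproduced_quasiInterp (hv : ∀ j, v j ∈ trigPoly j) {j N : ℕ} (hN : 2 ^ j ≤ N) (m : ℤ) :
    Reproduced N (quasiInterp v w j (fourier m)) := by
  have h : quasiInterp v w j (fourier m) = fun x =>
      fourierCoeff (w j) m * ∑ l ∈ polyFreq j, (if (2 : ℤ) ^ j ∣ m - l then 1 else 0) *
        (fourierCoeff (v j) l * fourier l x) := funext (quasiInterp_fourier hv j m)
  rw [h]
  refine Reproduced.const_mul (Reproduced.sum fun l hl => ?_) _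
  refine Reproduced.const_mul (Reproduced.const_mul (Reproduced.fourier
    (Nat.one_le_two_pow.trans hN) ?_) _) _
  exact (abs_le_of_mem_polyFreq hl).trans (by exact_mod_cast hN)

theorem reproduced_increment (hv : ∀ j, v j ∈ trigPoly j) (j : ℕ) (m : ℤ) :
    Reproduced (2 ^ j) (increment (quasiInterp v w) j (fourier m)) := by
  cases j with
  | zero => exact reproduced_quasiInterp hv le_rfl m
  | succ j =>
    have h := (reproduced_quasiInterp (w := w) hv (le_refl (2 ^ (j + 1))) m).add
      ((reproduced_quasiInterp (w := w) hv (Nat.pow_le_pow_right (by norm_num) (Nat.le_succ j))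
        m).const_mul (-1))
    refine (congrArg (Reproduced (2 ^ (j + 1))) ?_).mp h
    funext x
    simp [increment, sub_eq_add_neg]

end Operators

/-! ### Multipliers and the scaled norms -/

/-- The definition of the multiplier norm provides some `L_p`-function with the right Fourier
coefficients; by uniqueness it is `g`. -/
theorem eLpNorm_le_of_multiplierNorm_lt {p : ℝ≥0∞} (hp : 1 ≤ p) {l : ℤ → ℂ} {M : ℝ≥0∞}
    (hM : multiplierNorm p l < M) {f g : Circ → ℂ} (hf : Continuous f) (hg : Continuous g)
    (h : ∀ k, fourierCoeff g k = l k * fourierCoeff f k) :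
    eLpNorm g p volume ≤ M * eLpNorm f p volume := by
  obtain ⟨C, hC, hCM⟩ := sInf_lt_iff.1 hM
  obtain ⟨G, hG, hcoef, hle⟩ := hC f (memLp_of_continuous hf p)
  have hae : g =ᵐ[volume] G := ae_eq_of_fourierCoeff_eq (integrable_of_continuous hg)
    (hG.integrable hp) fun k => (h k).trans (hcoef k).symm
  rw [eLpNorm_congr_ae hae]
  exact hle.trans (mul_le_mul_left hCM.le _)

/-- The mean of `|w|` over the translates by the nodes: the inner expression of `scaledNorm`, as a
function on the circle.  It has period `2π / 2^j`. -/
noncomputable def nodeMean (j : ℕ) (w : Circ → ℂ) (y : Circ) : ℝ≥0∞ :=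
  ((2 : ℝ≥0∞) ^ j)⁻¹ * ∑ k ∈ indexSet j, ‖w (y - nodePt j k)‖ₑ

theorem nodeMean_add_nodePt (j : ℕ) (w : Circ → ℂ) (y : Circ) :
    nodeMean j w (y + nodePt j 1) = nodeMean j w y := by
  unfold nodeMean
  congr 1
  have h := sum_indexSet_add j (g := fun k => ‖w (y + nodePt j 1 - nodePt j k)‖ₑ)
    (fun k => by rw [nodePt_add_two_pow]) 1
  rw [← h]
  refine Finset.sum_congr rfl fun k _ => ?_
  rw [nodePt_add, add_sub_add_right_eq_sub]

theorem nodeMean_neg (j : ℕ) (w : Circ → ℂ) (t : Circ) :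
    nodeMean j w (-t) = ((2 : ℝ≥0∞) ^ j)⁻¹ * ∑ k ∈ indexSet j, ‖w (nodePt j k - t)‖ₑ := by
  unfold nodeMean
  congr 1
  have h := sum_indexSet_neg j (g := fun k => ‖w (nodePt j k - t)‖ₑ)
    (fun k => by rw [nodePt_add_two_pow])
  rw [← h]
  refine Finset.sum_congr rfl fun k _ => ?_
  rw [nodePt_neg]; congr 2; abel

theorem measurable_nodeMean (j : ℕ) {w : Circ → ℂ} (hw : Measurable w) :
    Measurable (nodeMean j w) :=
  (Finset.measurable_fun_sum _ fun _ _ => (hw.comp (measurable_id.sub_const _)).enorm).const_mul _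

theorem ae_eq_sub_right {α : Type*} {w w' : Circ → α} (h : w =ᵐ[volume] w') (a : Circ) :
    (fun y => w (y - a)) =ᵐ[volume] fun y => w' (y - a) :=
  (measurePreserving_sub_right volume a).quasiMeasurePreserving.ae_eq_comp h

theorem ae_eq_sub_left {α : Type*} {w w' : Circ → α} (h : w =ᵐ[volume] w') (a : Circ) :
    (fun y => w (a - y)) =ᵐ[volume] fun y => w' (a - y) :=
  (Measure.measurePreserving_sub_left volume a).quasiMeasurePreserving.ae_eq_comp h

theorem nodeMean_congr_ae (j : ℕ) {w w' : Circ → ℂ} (h : w =ᵐ[volume] w') :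
    nodeMean j w =ᵐ[volume] nodeMean j w' := by
  have : ∀ᵐ y ∂(volume : Measure Circ), ∀ k : ℤ, w (y - nodePt j k) = w' (y - nodePt j k) :=
    ae_all_iff.2 fun k => ae_eq_sub_right h _
  filter_upwards [this] with y hy
  simp only [nodeMean, hy]

theorem lintegral_Ico_nsmul {F : ℝ → ℝ≥0∞} {τ : ℝ} (hτ : 0 ≤ τ) (hF : ∀ x, F (x + τ) = F x)
    (t : ℝ) (n : ℕ) :
    ∫⁻ x in Set.Ico t (t + n * τ), F x = n * ∫⁻ x in Set.Ico t (t + τ), F x := by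
  have hn : ∀ (n : ℕ) x, F (x + n * τ) = F x := by
    intro n
    induction n with
    | zero => simp
    | succ n ih => intro x; push_cast; rw [add_mul, one_mul, ← add_assoc, hF, ih]
  induction n with
  | zero => simp
  | succ n ih =>
    have hsplit : Set.Ico t (t + (n + 1 : ℕ) * τ) =
        Set.Ico t (t + n * τ) ∪ Set.Ico (t + n * τ) (t + n * τ + τ) := by
      rw [Set.Ico_union_Ico_eq_Ico (by
        have : 0 ≤ (n : ℝ) * τ := by positivity
        linarith) (by linarith)]
      congr 1; push_cast; ring
    rw [hsplit, lintegral_union measurableSet_Ico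
      (Set.disjoint_left.2 fun x hx hx' => (not_lt.2 hx'.1) hx.2), ih]
    have hshift : ∫⁻ x in Set.Ico (t + n * τ) (t + n * τ + τ), F x =
        ∫⁻ x in Set.Ico t (t + τ), F x := by
      rw [← lintegral_indicator measurableSet_Ico, ← lintegral_indicator measurableSet_Ico,
        ← lintegral_add_right_eq_self _ (n * τ)]
      refine lintegral_congr fun x => ?_
      by_cases hx : x ∈ Set.Ico t (t + τ)
      · rw [Set.indicator_of_mem hx, Set.indicator_of_mem, hn]
        exact ⟨by linarith [hx.1], by linarith [hx.2]⟩
      · rw [Set.indicator_of_notMem hx, Set.indicator_of_notMem]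
        exact fun hx' => hx ⟨by linarith [hx'.1], by linarith [hx'.2]⟩
    rw [hshift]; push_cast; ring

/-- The integral of a function with period `2π / 2^j` is `2^j` times its integral over one cell. -/
theorem lintegral_eq_cell (j : ℕ) {Ω : Circ → ℝ≥0∞} (hΩ : ∀ y, Ω (y + nodePt j 1) = Ω y) :
    ∫⁻ y, Ω y = 2 ^ j * ∫⁻ x in Set.Ico (-(Real.pi / 2 ^ j)) (Real.pi / 2 ^ j), Ω (x : Circ) := by
  have h2 : (0 : ℝ) < 2 ^ j := by positivity
  have h := lintegral_Ico_nsmul (F := fun x : ℝ => Ω (x : Circ)) (τ := 2 * Real.pi / 2 ^ j)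
    (by positivity) (fun x => by
      have := hΩ (x : Circ)
      rw [← this, AddCircle.coe_add, nodePt, node]; congr 3; push_cast; ring)
    (-(Real.pi / 2 ^ j)) (2 ^ j)
  have e1 : -(Real.pi / 2 ^ j) + ((2 ^ j : ℕ) : ℝ) * (2 * Real.pi / 2 ^ j) =
      -(Real.pi / 2 ^ j) + 2 * Real.pi := by push_cast; field_simp
  have e2 : -(Real.pi / 2 ^ j) + 2 * Real.pi / 2 ^ j = Real.pi / 2 ^ j := by ring
  rw [e1, e2, restrict_Ico_eq_restrict_Ioc, AddCircle.lintegral_preimage] at h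
  rw [h]; push_cast; rfl

/-- By periodicity, the norm over the circle is `2^j` times (in the sense of measures) the norm
over one cell, which is the scaled norm. -/
theorem eLpNorm_nodeMean_le (j : ℕ) {w : Circ → ℂ} (hw : AEStronglyMeasurable w volume)
    {q : ℝ≥0∞} (hq : 1 ≤ q) : eLpNorm (nodeMean j w) q volume ≤ scaledNorm q j w := by
  set cell := Set.Ico (-(Real.pi / 2 ^ j)) (Real.pi / 2 ^ j)
  have hpt : ∀ x : ℝ, ‖((2 : ℝ) ^ j)⁻¹ * ∑ k ∈ indexSet j, ‖w ((x - node j k : ℝ) : Circ)‖‖ₑ =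
      nodeMean j w (x : Circ) := by
    intro x
    rw [enorm_mul, nodeMean]
    congr 1
    · rw [Real.enorm_eq_ofReal (by positivity), ENNReal.ofReal_inv_of_pos (by positivity),
        ENNReal.ofReal_pow (by norm_num)]; simp
    · rw [Real.enorm_eq_ofReal (Finset.sum_nonneg fun _ _ => norm_nonneg _),
        ENNReal.ofReal_sum_of_nonneg fun _ _ => norm_nonneg _]
      refine Finset.sum_congr rfl fun k _ => ?_
      rw [ofReal_norm, AddCircle.coe_sub]; rfl
  rcases eq_or_ne q ∞ with rfl | hqt
  · set B := scaledNorm ∞ j w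
    have hcell : ∀ᵐ x : ℝ ∂((volume : Measure ℝ).restrict cell), nodeMean j w (x : Circ) ≤ B := by
      have h1 := enorm_ae_le_eLpNormEssSup
        (fun x : ℝ => ((2 : ℝ) ^ j)⁻¹ * ∑ k ∈ indexSet j, ‖w ((x - node j k : ℝ) : Circ)‖)
        ((2 : ℝ≥0∞) ^ j • (volume : Measure ℝ).restrict cell)
      rw [Measure.ae_ennreal_smul_measure_iff (by simp)] at h1
      filter_upwards [h1] with x hx
      rw [← hpt]; exact hx
    -- the exceptional set is invariant under the nodes and null in one cell
    have hzero := lintegral_eq_cell j (Ω := fun y => if B < nodeMean j w y then 1 else 0)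
      (fun y => by simp only [nodeMean_add_nodePt])
    have hr : ∫⁻ x in cell, (if B < nodeMean j w (x : Circ) then (1 : ℝ≥0∞) else 0) = 0 := by
      rw [lintegral_congr_ae (g := fun _ => 0)]
      · simp
      · filter_upwards [hcell] with x hx
        rw [if_neg (not_lt.2 hx)]
    rw [hr, mul_zero] at hzero
    obtain ⟨w', hw', hae⟩ := hw
    have hWae := nodeMean_congr_ae j hae
    have hzero' : ∫⁻ y, (if B < nodeMean j w' y then (1 : ℝ≥0∞) else 0) = 0 := by
      refine Eq.trans (lintegral_congr_ae ?_) hzero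
      filter_upwards [hWae] with y hy
      rw [hy]
    have hm : Measurable fun y => if B < nodeMean j w' y then (1 : ℝ≥0∞) else 0 :=
      Measurable.ite (measurableSet_lt measurable_const (measurable_nodeMean j hw'.measurable))
        measurable_const measurable_const
    rw [lintegral_eq_zero_iff hm] at hzero'
    rw [eLpNorm_exponent_top]
    refine eLpNormEssSup_le_of_ae_enorm_bound ?_
    filter_upwards [hzero', hWae] with y hy hy'
    rw [enorm_eq_self, hy']
    by_contra hlt
    simp [not_le.1 hlt] at hy
  · have hq0 : q ≠ 0 := (zero_lt_one.trans_le hq).ne'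
    unfold scaledNorm
    rw [eLpNorm_eq_lintegral_rpow_enorm_toReal hq0 hqt,
      eLpNorm_eq_lintegral_rpow_enorm_toReal hq0 hqt]
    simp only [hpt, enorm_eq_self]
    rw [lintegral_smul_measure, lintegral_eq_cell j (fun y => by rw [nodeMean_add_nodePt])]
    rfl

/-! ### The sampling operators -/

/-- The positive kernel that dominates sampling of a convolution followed by synthesis. -/
noncomputable def samplingKernel (j : ℕ) (w : Circ → ℂ) (x t : Circ) : ℝ≥0∞ :=
  ∑ k ∈ indexSet j, ((2 : ℝ≥0∞) ^ j)⁻¹ * fejerKernel (2 ^ j) x (nodePt j k) * ‖w (nodePt j k - t)‖ₑ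

theorem measurable_fejerKernel_left (N : ℕ) (a : Circ) : Measurable fun x => fejerKernel N x a :=
  Measurable.of_uncurry_right (measurable_fejerKernel N)

theorem measurable_samplingKernel (j : ℕ) {w : Circ → ℂ} (hw : Measurable w) :
    Measurable (Function.uncurry (samplingKernel j w)) := by
  have h : Function.uncurry (samplingKernel j w) = fun z : Circ × Circ => ∑ k ∈ indexSet j,
      ((2 : ℝ≥0∞) ^ j)⁻¹ * fejerKernel (2 ^ j) z.1 (nodePt j k) * ‖w (nodePt j k - z.2)‖ₑ := rfl
  rw [h]
  refine Finset.measurable_fun_sum _ fun k _ => Measurable.mul (Measurable.const_mul ?_ _) ?_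
  · exact (measurable_fejerKernel_left (2 ^ j) (nodePt j k)).comp measurable_fst
  · exact (hw.comp ((measurable_const (a := nodePt j k)).sub measurable_snd)).enorm

/-- Integrated in `x`, the sampling kernel is a multiple of `nodeMean`, which is bounded only for
`p = 1`; this is why the Schur test needs a weight. -/
theorem lintegral_samplingKernel_left (j : ℕ) (w : Circ → ℂ) (t : Circ) :
    ∫⁻ x, samplingKernel j w x t = 4 * nodeMean j w (-t) := by
  have hm : ∀ k, Measurable fun x => fejerKernel (2 ^ j) x (nodePt j k) := fun k =>
    measurable_fejerKernel_left (2 ^ j) (nodePt j k)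
  have hm' : ∀ k ∈ indexSet j, Measurable fun x =>
      ((2 : ℝ≥0∞) ^ j)⁻¹ * fejerKernel (2 ^ j) x (nodePt j k) * ‖w (nodePt j k - t)‖ₑ :=
    fun k _ => ((hm k).const_mul _).mul_const _
  unfold samplingKernel
  rw [lintegral_finsetSum _ hm', nodeMean_neg, Finset.mul_sum, Finset.mul_sum]
  refine Finset.sum_congr rfl fun k _ => ?_
  rw [lintegral_mul_const _ ((hm k).const_mul _), lintegral_const_mul _ (hm k),
    lintegral_fejerKernel_left Nat.one_le_two_pow]
  ring

theorem apply_sub_nodePt {α : Type*} {Ω : Circ → α} (j : ℕ)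
    (hΩ : ∀ y, Ω (y + nodePt j 1) = Ω y) (y : Circ) (k : ℤ) : Ω (y - nodePt j k) = Ω y := by
  rw [nodePt_eq_zsmul]
  exact Function.Periodic.sub_zsmul_eq (c := nodePt j 1) hΩ k

/-- Integration against a function with period `2π / 2^j` does not see the positions of the
nodes, so that the mean of the Fejér majorant over the nodes can be taken first. -/
theorem lintegral_samplingKernel_mul_le (j : ℕ) {w : Circ → ℂ} (hw : Measurable w)
    {Ω : Circ → ℝ≥0∞} (hm : Measurable Ω) (hΩ : ∀ y, Ω (y + nodePt j 1) = Ω y) (x : Circ) :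
    ∫⁻ t, samplingKernel j w x t * Ω (-t) ≤ ∫⁻ y, nodeMean j w y * Ω y := by
  have hwm : ∀ a, Measurable fun t => ‖w (a - t)‖ₑ := fun a =>
    (hw.comp (measurable_id.const_sub a)).enorm
  have h1 : ∀ k, ∫⁻ t, ‖w (nodePt j k - t)‖ₑ * Ω (-t) = ∫⁻ y, ‖w y‖ₑ * Ω y := by
    intro k
    rw [← lintegral_sub_left_eq_self (fun y => ‖w y‖ₑ * Ω y) (nodePt j k)]
    refine lintegral_congr fun t => ?_
    congr 1
    rw [← apply_sub_nodePt j hΩ (nodePt j k - t) k]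
    congr 1; abel
  have h2 : ∫⁻ y, nodeMean j w y * Ω y = ∫⁻ y, ‖w y‖ₑ * Ω y := by
    have h3 : ∀ k, ∫⁻ y, ‖w (y - nodePt j k)‖ₑ * Ω y = ∫⁻ y, ‖w y‖ₑ * Ω y := by
      intro k
      rw [← lintegral_sub_right_eq_self (fun y => ‖w y‖ₑ * Ω y) (nodePt j k)]
      exact lintegral_congr fun y => by rw [apply_sub_nodePt j hΩ]
    have hm3 : ∀ k, Measurable fun y => ‖w (y - nodePt j k)‖ₑ * Ω y := fun k =>
      (hw.comp (measurable_id.sub_const _)).enorm.mul hm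
    simp only [nodeMean, mul_assoc, Finset.sum_mul]
    rw [lintegral_const_mul _ (Finset.measurable_fun_sum _ fun k _ => hm3 k),
      lintegral_finsetSum _ fun k _ => hm3 k]
    simp only [h3]
    rw [Finset.sum_const, card_indexSet, nsmul_eq_mul, ← mul_assoc]
    push_cast
    rw [ENNReal.inv_mul_cancel (by simp) (by simp), one_mul]
  rw [h2]
  have hm1 : ∀ k, Measurable fun t => ‖w (nodePt j k - t)‖ₑ * Ω (-t) := fun k =>
    (hwm _).mul (hm.comp measurable_neg)
  simp only [samplingKernel, Finset.sum_mul, mul_assoc]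
  rw [lintegral_finsetSum _ fun k _ => ((hm1 k).const_mul _).const_mul _]
  calc _ = (((2 : ℝ≥0∞) ^ j)⁻¹ * ∑ k ∈ indexSet j, fejerKernel (2 ^ j) x (nodePt j k)) *
        ∫⁻ y, ‖w y‖ₑ * Ω y := by
        rw [Finset.mul_sum, Finset.sum_mul]
        refine Finset.sum_congr rfl fun k _ => ?_
        rw [lintegral_const_mul _ ((hm1 k).const_mul _), lintegral_const_mul _ (hm1 k), h1]
        ring
    _ ≤ (((2 : ℝ≥0∞) ^ j)⁻¹ * 2 ^ j) * ∫⁻ y, ‖w y‖ₑ * Ω y := by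
        gcongr
        exact sum_fejerKernel_nodePt_le j x
    _ = _ := by rw [ENNReal.inv_mul_cancel (by simp) (by simp), one_mul]

theorem holderConjugate_toReal {p p' : ℝ≥0∞} (hp : 1 < p) (hpt : p ≠ ∞)
    (hpp' : 1 / p + 1 / p' = 1) : p' ≠ ∞ ∧ p.toReal.HolderConjugate p'.toReal := by
  have h1 : 1 < p.toReal := by
    rw [← ENNReal.toReal_one]; exact (ENNReal.toReal_lt_toReal ENNReal.one_ne_top hpt).2 hp
  have hp't : p' ≠ ∞ := by
    rintro rfl
    simp only [one_div, ENNReal.inv_top, add_zero, ENNReal.inv_eq_one] at hpp'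
    exact hp.ne' hpp'
  have hp'0 : p' ≠ 0 := by
    rintro rfl; simp at hpp'
  refine ⟨hp't, Real.holderConjugate_iff.2 ⟨h1, ?_⟩⟩
  have := congrArg ENNReal.toReal hpp'
  rw [ENNReal.toReal_add (by simp; positivity) (by simpa using hp'0)] at this
  simpa using this

/-- Sampling a convolution is bounded on `L_p`, with a constant that depends only on the scaled
`L_{p'}`-norm of the averaging function: the Schur test with the weight `nodeMean + 1`. -/
theorem exists_eLpNorm_sampling_le {p p' : ℝ≥0∞} (hp : 1 ≤ p) (hpp' : 1 / p + 1 / p' = 1)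
    {B : ℝ≥0∞} (hB : B ≠ ∞) :
    ∃ C : ℝ≥0∞, C ≠ ∞ ∧ ∀ (j : ℕ) (w : Circ → ℂ), Measurable w →
      eLpNorm (nodeMean j w) p' volume ≤ B → ∀ f : Circ → ℝ≥0∞, Measurable f →
      eLpNorm (fun x => ∫⁻ t, samplingKernel j w x t * f t) p volume ≤
        C * eLpNorm f p volume := by
  rcases eq_or_ne p ∞ with rfl | hpt
  · refine ⟨B, hB, fun j w hw hwB f hf => ?_⟩
    have hp1 : p' = 1 := by simpa using hpp'
    subst hp1
    refine essSup_kernel_le (fun x => (measurable_samplingKernel j hw).comp measurable_prodMk_left)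
      fun x => ?_
    have h := lintegral_samplingKernel_mul_le j hw (Ω := fun _ => 1) measurable_const
      (fun _ => rfl) x
    simp only [mul_one] at h
    refine h.trans ?_
    simpa [eLpNorm_one_eq_lintegral_enorm] using hwB
  rcases hp.eq_or_lt with rfl | hp1
  · refine ⟨4 * B, ENNReal.mul_ne_top (by simp) hB, fun j w hw hwB f hf => ?_⟩
    have hp'1 : p' = ∞ := by
      have h0 : p'⁻¹ = 0 := by
        have h1 : (1 : ℝ≥0∞) + p'⁻¹ = 1 + 0 := by simpa using hpp'
        exact (ENNReal.add_right_inj ENNReal.one_ne_top).1 h1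
      simpa using h0
    subst hp'1
    simp only [eLpNorm_one_eq_lintegral_enorm, enorm_eq_self]
    refine lintegral_kernel_le (measurable_samplingKernel j hw) hf ?_
    have h1 : ∀ᵐ y ∂(volume : Measure Circ), nodeMean j w y ≤ B := by
      filter_upwards [enorm_ae_le_eLpNormEssSup (nodeMean j w) volume] with y hy
      exact (by simpa using hy : nodeMean j w y ≤ _).trans (by simpa using hwB)
    have h2 : ∀ᵐ t ∂(volume : Measure Circ), nodeMean j w (-t) ≤ B :=
      (Measure.measurePreserving_neg volume).quasiMeasurePreserving.ae h1
    filter_upwards [h2] with t ht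
    rw [lintegral_samplingKernel_left]
    exact mul_le_mul_right ht _
  · obtain ⟨hp't, hconj⟩ := holderConjugate_toReal hp1 hpt hpp'
    have hp0 := hconj.pos
    have hp0' := hconj.symm.pos
    set A : ℝ≥0∞ := (B + volume (Set.univ : Set Circ) ^ (1 / p'.toReal)) ^ p'.toReal
    have hV : volume (Set.univ : Set Circ) ^ (1 / p'.toReal) ≠ ∞ :=
      ENNReal.rpow_ne_top_of_nonneg (by positivity) (measure_ne_top _ _)
    have hA : A ≠ ∞ := ENNReal.rpow_ne_top_of_nonneg hp0'.le (ENNReal.add_ne_top.2 ⟨hB, hV⟩)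
    refine ⟨(A ^ (p.toReal - 1) * 4) ^ (1 / p.toReal),
      ENNReal.rpow_ne_top_of_nonneg (by positivity) (ENNReal.mul_ne_top
        (ENNReal.rpow_ne_top_of_nonneg (by linarith [hconj.lt]) hA) (by simp)),
      fun j w hw hwB f hf => ?_⟩
    have hWm := measurable_nodeMean j hw
    have hWfin : ∀ y, nodeMean j w y ≠ ∞ := fun y =>
      ENNReal.mul_ne_top (by simp) (ENNReal.sum_ne_top.2 fun _ _ => by simp)
    have hint : ∫⁻ y, (nodeMean j w y + 1) ^ p'.toReal ≤ A := by
      have h1 := ENNReal.lintegral_Lp_add_le (μ := (volume : Measure Circ)) hWm.aemeasurable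
        (g := fun _ => 1) aemeasurable_const hconj.symm.lt.le
      have hW : (∫⁻ y, nodeMean j w y ^ p'.toReal) ^ (1 / p'.toReal) ≤ B := by
        rwa [← eLpNorm_eq_lintegral_rpow hp0', ENNReal.ofReal_toReal hp't]
      simp only [ENNReal.one_rpow, lintegral_const, one_mul, Pi.add_apply] at h1
      have h2 := ENNReal.rpow_le_rpow (h1.trans (add_le_add hW le_rfl)) hp0'.le
      rwa [← ENNReal.rpow_mul, one_div_mul_cancel hp0'.ne', ENNReal.rpow_one] at h2
    have h := lintegral_rpow_kernel_le (μ := (volume : Measure Circ))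
      (ν := (volume : Measure Circ)) hconj (measurable_samplingKernel j hw) hf
      (ω := fun t => nodeMean j w (-t) + 1) ((hWm.comp measurable_neg).add_const _)
      (fun t => by simp) (fun t => by simpa using hWfin (-t)) (A := A) (B := 4)
      (fun x => ?_) (fun t => ?_)
    · rw [← ENNReal.ofReal_toReal hpt, eLpNorm_eq_lintegral_rpow hp0, eLpNorm_eq_lintegral_rpow hp0]
      refine (ENNReal.rpow_le_rpow h (by positivity : 0 ≤ 1 / p.toReal)).trans_eq ?_
      rw [ENNReal.mul_rpow_of_nonneg _ _ (by positivity)]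
      rw [ENNReal.toReal_ofReal hp0.le]
    · refine (lintegral_samplingKernel_mul_le j hw
        (Ω := fun y => (nodeMean j w y + 1) ^ (p'.toReal - 1)) ((hWm.add_const _).pow_const _)
        (fun y => by rw [nodeMean_add_nodePt]) x).trans (le_trans ?_ hint)
      refine lintegral_mono fun y => ?_
      calc _ ≤ (nodeMean j w y + 1) * (nodeMean j w y + 1) ^ (p'.toReal - 1) := by
            gcongr; exact le_self_add
        _ = _ := by
            nth_rewrite 1 [← ENNReal.rpow_one (nodeMean j w y + 1)]
            rw [← ENNReal.rpow_add_of_nonneg _ _ zero_le_one (by linarith [hconj.symm.lt])]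
            congr 1; ring
    · rw [lintegral_samplingKernel_left]
      gcongr; exact le_self_add

/-! ### Estimates for the univariate operators -/

theorem fourierCoeff_comp_sub (g : Circ → ℂ) (y : Circ) (m : ℤ) :
    fourierCoeff (fun x => g (x - y)) m = fourier (-m) y * fourierCoeff g m := by
  rw [fourierCoeff_eq_integral, fourierCoeff_eq_integral,
    ← integral_add_right_eq_self (fun t => fourier (-m) t * g (t - y)) y]
  have : ∀ t : Circ, fourier (-m) (t + y) * g (t + y - y) =
      fourier (-m) y * (fourier (-m) t * g t) := fun t => by
    rw [fourier_add_apply, add_sub_cancel_right]; ring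
  simp only [this]
  rw [integral_const_mul]
  ring

theorem fourierCoeff_sum_translates {ι : Type*} (S : Finset ι) (b : ℂ) (a : ι → ℂ) (y : ι → Circ)
    {g : Circ → ℂ} (hg : Continuous g) (m : ℤ) :
    fourierCoeff (fun x => b * ∑ k ∈ S, a k * g (x - y k)) m =
      (b * ∑ k ∈ S, a k * fourier (-m) (y k)) * fourierCoeff g m := by
  have h : ∀ k, a k * (fourier (-m) (y k) * fourierCoeff g m) =
      ((2 * Real.pi : ℝ) : ℂ)⁻¹ * ∫ t, a k * (fourier (-m) t * g (t - y k)) := fun k => by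
    rw [← fourierCoeff_comp_sub, fourierCoeff_eq_integral, integral_const_mul]; ring
  have h2 : ∀ t : Circ, fourier (-m) t * (b * ∑ k ∈ S, a k * g (t - y k)) =
      b * ∑ k ∈ S, a k * (fourier (-m) t * g (t - y k)) := fun t => by
    simp only [Finset.mul_sum]
    exact Finset.sum_congr rfl fun k _ => by ring
  have hi : ∀ k, Integrable (fun t : Circ => a k * (fourier (-m) t * g (t - y k))) volume :=
    fun k => integrable_of_continuous (continuous_const.mul ((fourier (-m)).continuous.mul
      (hg.comp (continuous_sub_right _))))
  rw [fourierCoeff_eq_integral]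
  simp only [h2]
  rw [integral_const_mul, integral_finsetSum _ fun k _ => hi k, mul_assoc, Finset.sum_mul,
    mul_left_comm, Finset.mul_sum]
  congr 1
  refine Finset.sum_congr rfl fun k _ => ?_
  rw [← h, mul_assoc]

/-- The multiplier of convolution with the reproducing kernel is `1` on the frequencies `|m| ≤
N`. -/
theorem fourierCoeff_reproKernel {N : ℕ} (hN : 1 ≤ N) {m : ℤ} (hm : |m| ≤ N) :
    fourierCoeff (fun x => ((2 * Real.pi : ℝ) : ℂ) * reproKernel N x) m = 1 := by
  have hpi : ((2 * Real.pi : ℝ) : ℂ) ≠ 0 := by exact_mod_cast Real.two_pi_pos.ne'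
  have h := integral_reproKernel_mul_fourier hN hm 0
  rw [← integral_neg_eq_self] at h
  rw [fourierCoeff_eq_integral]
  have h2 : ∀ t : Circ, fourier (-m) t * (((2 * Real.pi : ℝ) : ℂ) * reproKernel N t) =
      ((2 * Real.pi : ℝ) : ℂ) * (reproKernel N (0 - -t) * fourier m (-t)) := fun t => by
    have h3 : fourier m (-t) = fourier (-m) t := by
      simp [fourier_apply]
    rw [h3, zero_sub, neg_neg]; ring
  simp only [h2]
  rw [integral_const_mul, h, ← mul_assoc, inv_mul_cancel₀ hpi]
  simp

theorem conv_congr_ae {w w' : Circ → ℂ} (h : w =ᵐ[volume] w') (f : Circ → ℂ) :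
    conv f w = conv f w' := by
  funext x
  rw [conv_eq, conv_eq]
  congr 1
  refine integral_congr_ae ?_
  filter_upwards [ae_eq_sub_left h x] with t ht
  rw [ht]

section Bounds

variable {v w : ℕ → Circ → ℂ} {p p' : ℝ≥0∞}

/-- The operators `Q_j` are uniformly bounded on the continuous functions with the `L_p`-norm.
Replacing `v_j` by a kernel that reproduces trigonometric polynomials turns `Q_j` into an operator
dominated by a positive kernel; the multiplier `(v̂_j(k))_k` brings `v_j` back. -/
theorem exists_eLpNorm_quasiInterp_le (hp : 1 ≤ p) (hpp' : 1 / p + 1 / p' = 1)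
    (hv : ∀ j, v j ∈ trigPoly j)
    (hM : (⨆ j, multiplierNorm p (fun k => fourierCoeff (v j) k)) < ∞)
    (hw : ∀ j, Measurable (w j)) {B : ℝ≥0∞} (hB : B ≠ ∞)
    (hwB : ∀ j, eLpNorm (nodeMean j (w j)) p' volume ≤ B) :
    ∃ C : ℝ≥0∞, C ≠ ∞ ∧ ∀ (j : ℕ) (f : Circ → ℂ), Continuous f →
      eLpNorm (quasiInterp v w j f) p volume ≤ C * eLpNorm f p volume := by
  obtain ⟨M, hM1, hM2⟩ := ENNReal.lt_iff_exists_nnreal_btwn.1 hM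
  obtain ⟨C, hC, hS⟩ := exists_eLpNorm_sampling_le hp hpp' hB
  refine ⟨M * C, ENNReal.mul_ne_top hM2.ne hC, fun j f hf => ?_⟩
  set κ : Circ → ℂ := fun x => ((2 * Real.pi : ℝ) : ℂ) * reproKernel (2 ^ j) x
  have hκ : Continuous κ := continuous_const.mul (continuous_reproKernel _)
  set u : Circ → ℂ := fun x => ((2 : ℂ) ^ j)⁻¹ *
    ∑ k ∈ indexSet j, conv f (w j) (nodePt j k) * κ (x - nodePt j k)
  have huc : Continuous u := continuous_const.mul (continuous_finsetSum _ fun k _ =>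
    continuous_const.mul (hκ.comp (continuous_sub_right _)))
  have hvc := continuous_of_trigPoly (hv j)
  have hQc : Continuous (quasiInterp v w j f) := continuous_const.mul
    (continuous_finsetSum _ fun k _ => continuous_const.mul (hvc.comp (continuous_sub_right _)))
  have hcoef : ∀ m, fourierCoeff (quasiInterp v w j f) m =
      fourierCoeff (v j) m * fourierCoeff u m := by
    intro m
    have h1 : fourierCoeff (quasiInterp v w j f) m = (((2 : ℂ) ^ j)⁻¹ *
        ∑ k ∈ indexSet j, conv f (w j) (nodePt j k) * fourier (-m) (nodePt j k)) *
          fourierCoeff (v j) m :=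
      fourierCoeff_sum_translates (indexSet j) _ (fun k => conv f (w j) (nodePt j k))
        (nodePt j) hvc m
    have h2 := fourierCoeff_sum_translates (indexSet j) ((2 : ℂ) ^ j)⁻¹
      (fun k => conv f (w j) (nodePt j k)) (nodePt j) hκ m
    rw [h1, h2]
    by_cases hm : |m| ≤ 2 ^ j
    · rw [fourierCoeff_reproKernel Nat.one_le_two_pow (by exact_mod_cast hm)]; ring
    · rw [fourierCoeff_eq_zero_of_trigPoly (hv j) fun hm' => hm (abs_le_of_mem_polyFreq hm')]
      ring
  have hu : ∀ x, ‖u x‖ₑ ≤ ∫⁻ t, samplingKernel j (w j) x t * ‖f t‖ₑ := by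
    intro x
    have hmeas : ∀ k, Measurable fun t => ‖f t‖ₑ * ‖w j (nodePt j k - t)‖ₑ := fun k =>
      hf.measurable.enorm.mul ((hw j).comp (measurable_const.sub measurable_id)).enorm
    have hpi : ‖((2 * Real.pi : ℝ) : ℂ)‖ₑ ≠ 0 := by
      rw [enorm_ne_zero]; exact_mod_cast Real.two_pi_pos.ne'
    have hconv : ∀ y, ‖conv f (w j) y‖ₑ ≤
        ‖((2 * Real.pi : ℝ) : ℂ)‖ₑ⁻¹ * ∫⁻ t, ‖f t‖ₑ * ‖w j (y - t)‖ₑ := by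
      intro y
      rw [conv_eq, enorm_mul, enorm_inv (by exact_mod_cast Real.two_pi_pos.ne')]
      refine mul_le_mul_right ((enorm_integral_le_lintegral_enorm _).trans_eq ?_) _
      simp only [enorm_mul]
    calc ‖u x‖ₑ ≤ ((2 : ℝ≥0∞) ^ j)⁻¹ *
          ∑ k ∈ indexSet j, ‖conv f (w j) (nodePt j k) * κ (x - nodePt j k)‖ₑ := by
          simp only [u]
          rw [enorm_mul, enorm_inv (by simp), enorm_pow]
          have : ‖(2 : ℂ)‖ₑ = 2 := by
            rw [← ofReal_norm]; simp
          rw [this]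
          exact mul_le_mul_right (enorm_sum_le _ _) _
      _ ≤ ((2 : ℝ≥0∞) ^ j)⁻¹ * ∑ k ∈ indexSet j, fejerKernel (2 ^ j) x (nodePt j k) *
            ∫⁻ t, ‖f t‖ₑ * ‖w j (nodePt j k - t)‖ₑ := by
          gcongr with k _
          rw [enorm_mul]
          calc _ ≤ (‖((2 * Real.pi : ℝ) : ℂ)‖ₑ⁻¹ * ∫⁻ t, ‖f t‖ₑ * ‖w j (nodePt j k - t)‖ₑ) *
                (‖((2 * Real.pi : ℝ) : ℂ)‖ₑ * fejerKernel (2 ^ j) x (nodePt j k)) := by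
                simp only [κ]
                rw [enorm_mul]
                exact mul_le_mul' (hconv _) (mul_le_mul_right (enorm_reproKernel_le _ _ _) _)
            _ = (‖((2 * Real.pi : ℝ) : ℂ)‖ₑ⁻¹ * ‖((2 * Real.pi : ℝ) : ℂ)‖ₑ) *
                (fejerKernel (2 ^ j) x (nodePt j k) *
                  ∫⁻ t, ‖f t‖ₑ * ‖w j (nodePt j k - t)‖ₑ) := by ring
            _ = _ := by rw [ENNReal.inv_mul_cancel hpi enorm_ne_top, one_mul]
      _ = _ := by
          simp only [samplingKernel, Finset.sum_mul]
          have hm2 : ∀ k ∈ indexSet j, Measurable fun t => ((2 : ℝ≥0∞) ^ j)⁻¹ *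
              fejerKernel (2 ^ j) x (nodePt j k) * ‖w j (nodePt j k - t)‖ₑ * ‖f t‖ₑ := by
            intro k _
            have : (fun t => ((2 : ℝ≥0∞) ^ j)⁻¹ * fejerKernel (2 ^ j) x (nodePt j k) *
                ‖w j (nodePt j k - t)‖ₑ * ‖f t‖ₑ) = fun t => ((2 : ℝ≥0∞) ^ j)⁻¹ *
                fejerKernel (2 ^ j) x (nodePt j k) * (‖f t‖ₑ * ‖w j (nodePt j k - t)‖ₑ) := by
              funext t; ring
            rw [this]
            exact (hmeas k).const_mul _
          rw [lintegral_finsetSum _ hm2, Finset.mul_sum]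
          refine Finset.sum_congr rfl fun k _ => ?_
          rw [← mul_assoc, ← lintegral_const_mul _ (hmeas k)]
          exact lintegral_congr fun t => by ring
  calc eLpNorm (quasiInterp v w j f) p volume ≤ M * eLpNorm u p volume :=
        eLpNorm_le_of_multiplierNorm_lt hp ((le_iSup _ j).trans_lt hM1) huc hQc hcoef
    _ ≤ M * (C * eLpNorm f p volume) := by
        refine mul_le_mul_right ?_ _
        have h1 := hS j (w j) (hw j) (hwB j) (fun t => ‖f t‖ₑ) hf.measurable.enorm
        rw [eLpNorm_enorm'] at h1
        refine le_trans ?_ h1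
        exact eLpNorm_mono_enorm fun x => (hu x).trans_eq (enorm_eq_self _).symm
    _ = _ := by rw [mul_assoc]

end Bounds

/-- On `|ξ| < 1` all the other functions of the resolution vanish. -/
theorem IsResolution.zero_eq_one {φ : ℕ → ℝ → ℂ} (hφ : IsResolution φ) {ξ : ℝ} (hξ : |ξ| < 1) :
    φ 0 ξ = 1 := by
  have h := hφ.sum_eq_one ξ
  have h0 : ∀ j, j ≠ 0 → φ j ξ = 0 := by
    intro j hj
    by_contra hne
    have hm := hφ.supp_pos j (Nat.one_le_iff_ne_zero.2 hj)
      (subset_tsupport _ (Function.mem_support.2 hne))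
    have : (1 : ℝ) ≤ 2 ^ (j - 1) := one_le_pow₀ (by norm_num)
    linarith [hm.1]
  exact (hasSum_single 0 h0).unique h

/-- Homogeneity of the principal power under positive real factors. -/
theorem ofReal_mul_cpow {a : ℝ} (ha : 0 < a) {z : ℂ} (hz : z ≠ 0) (s : ℝ) :
    ((a : ℂ) * z) ^ (s : ℂ) = ((a ^ s : ℝ) : ℂ) * z ^ (s : ℂ) := by
  have ha' : (a : ℂ) ≠ 0 := by exact_mod_cast ha.ne'
  rw [Complex.cpow_def_of_ne_zero (mul_ne_zero ha' hz), Complex.cpow_def_of_ne_zero hz,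
    Complex.log_ofReal_mul ha hz, add_mul, Complex.exp_add, Complex.ofReal_cpow ha.le,
    Complex.cpow_def_of_ne_zero ha', Complex.ofReal_log ha.le]

theorem eLpNorm_const_mul (c : ℂ) (f : Circ → ℂ) (p : ℝ≥0∞) :
    eLpNorm (fun x => c * f x) p volume = ‖c‖ₑ * eLpNorm f p volume :=
  eLpNorm_const_smul c f p volume

section Bounds

variable {v w : ℕ → Circ → ℂ} {p p' : ℝ≥0∞}

/-- On frequencies of size `2^k` that are small against `2^j`, the operator `Q_j` acts as a
multiplier that differs from the identity by `O(2^{-s(j-k)})`. -/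
theorem exists_eLpNorm_trig_sub_le (hp : 1 ≤ p) {s : ℝ} {φ : ℕ → ℝ → ℂ}
    (hφ : IsResolution φ) (hv : ∀ j, v j ∈ trigPoly j) {ρ : ℝ} (hρ : ρ < 1)
    (hρv : ∀ (j : ℕ) (k : ℤ), ρ * 2 ^ j < |(k : ℝ)| → fourierCoeff (v j) k = 0)
    (hw : ∀ j, Integrable (w j) volume) (hvw : Compatible p s (φ 0) v w) :
    ∃ C : ℝ≥0∞, C ≠ ∞ ∧ ∃ N : ℕ, ∀ (j k : ℕ) (c : ℤ → ℂ), k + N ≤ j →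
      (∀ m ∈ freqSet k, ∀ x, quasiInterp v w j (fourier m) x =
        fourierCoeff (v j) m * fourierCoeff (w j) m * fourier m x) ∧
      eLpNorm (fun x => trig (freqSet k) c x - quasiInterp v w j (trig (freqSet k) c) x) p volume ≤
        C * 2 ^ (-(s * ((j - k : ℕ) : ℝ))) * eLpNorm (trig (freqSet k) c) p volume := by
  obtain ⟨h1, δ, hδ, hlt⟩ := hvw
  obtain ⟨M, hM1, hM2⟩ := ENNReal.lt_iff_exists_nnreal_btwn.1 hlt
  obtain ⟨C, hC, hcpow⟩ := exists_eLpNorm_cpow_le s hp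
  -- for `j ≥ k + N` the frequencies of the block are free of aliases and lie where the cut-off
  -- `φ₀(δ 2^{-j} ·)` equals `1`
  obtain ⟨N, hN⟩ : ∃ N : ℕ, 2 / min (1 - ρ) δ⁻¹ < 2 ^ N :=
    pow_unbounded_of_one_lt _ (by norm_num)
  have hmin : 0 < min (1 - ρ) δ⁻¹ := lt_min (by linarith) (by positivity)
  have hsmall : ∀ (j k : ℕ) (m : ℤ), k + N ≤ j → m ∈ freqSet k →
      |(m : ℝ)| < min (1 - ρ) δ⁻¹ * 2 ^ j := by
    intro j k m hkj hm
    have hm1 : |(m : ℝ)| ≤ 2 ^ (k + 1) := by exact_mod_cast abs_le_of_mem_freqSet hm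
    rw [div_lt_iff₀ hmin] at hN
    calc |(m : ℝ)| ≤ 2 ^ k * 2 := by rw [← pow_succ]; exact hm1
      _ < 2 ^ k * (2 ^ N * min (1 - ρ) δ⁻¹) := by gcongr
      _ = min (1 - ρ) δ⁻¹ * 2 ^ (k + N) := by rw [pow_add]; ring
      _ ≤ _ := by gcongr; norm_num
  refine ⟨M * C, ENNReal.mul_ne_top hM2.ne hC, N, fun j k c hkj => ?_⟩
  have hQ : ∀ m ∈ freqSet k, ∀ x, quasiInterp v w j (fourier m) x =
      fourierCoeff (v j) m * fourierCoeff (w j) m * fourier m x := fun m hm x =>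
    quasiInterp_fourier_of_small hv hρv ((hsmall j k m hkj hm).trans_le
      (mul_le_mul_of_nonneg_right (min_le_left _ _) (by positivity))) x
  refine ⟨hQ, ?_⟩
  set G : Circ → ℂ := trig (freqSet k) fun m => (((m : ℝ) / 2 ^ k : ℝ) : ℂ) ^ (s : ℂ) * c m
  set a : ℝ := (2 : ℝ) ^ (-(s * ((j - k : ℕ) : ℝ)))
  have hE : (fun x => trig (freqSet k) c x - quasiInterp v w j (trig (freqSet k) c) x) =
      trig (freqSet k) fun m => (1 - fourierCoeff (v j) m * fourierCoeff (w j) m) * c m := by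
    funext x
    rw [quasiInterp_trig hw]
    unfold trig
    rw [← Finset.sum_sub_distrib]
    refine Finset.sum_congr rfl fun m hm => ?_
    rw [hQ m hm]; ring
  rw [hE]
  have hGc : Continuous fun x => (a : ℂ) * G x := continuous_const.mul (continuous_trig _ _)
  have hmul : ∀ m : ℤ, fourierCoeff (trig (freqSet k) fun m =>
      (1 - fourierCoeff (v j) m * fourierCoeff (w j) m) * c m) m =
      ((1 - fourierCoeff (v j) m * fourierCoeff (w j) m) /
        (((m : ℝ) / 2 ^ j : ℝ) : ℂ) ^ (s : ℂ) * φ 0 (δ * ((m : ℝ) / 2 ^ j))) *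
        fourierCoeff (fun x => (a : ℂ) * G x) m := by
    intro m
    have e1 : (fun x => (a : ℂ) * G x) = trig (freqSet k) fun m =>
        (a : ℂ) * ((((m : ℝ) / 2 ^ k : ℝ) : ℂ) ^ (s : ℂ) * c m) := by
      funext x
      simp only [G, trig, Finset.mul_sum, mul_assoc]
    rw [e1, fourierCoeff_trig, fourierCoeff_trig]
    split_ifs with hm
    · rcases eq_or_ne m 0 with rfl | hm0
      · rw [h1]; simp
      have hφ1 : φ 0 (δ * ((m : ℝ) / 2 ^ j)) = 1 := by
        apply hφ.zero_eq_one
        rw [abs_mul, abs_div, abs_of_pos hδ, abs_of_pos (by positivity : (0 : ℝ) < 2 ^ j),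
          ← mul_div_assoc, div_lt_one (by positivity)]
        have h3 := (hsmall j k m hkj hm).trans_le
          (mul_le_mul_of_nonneg_right (min_le_right _ _) (by positivity : (0 : ℝ) ≤ 2 ^ j))
        calc δ * |(m : ℝ)| < δ * (δ⁻¹ * 2 ^ j) := by gcongr
          _ = 2 ^ j := by field_simp
      have hz : (((m : ℝ) / 2 ^ k : ℝ) : ℂ) ≠ 0 := by
        have : (m : ℝ) ≠ 0 := by exact_mod_cast hm0
        exact Complex.ofReal_ne_zero.2 (div_ne_zero this (by positivity))
      -- rescaling from `2^j` to `2^k` produces the factor `2^{-s(j-k)}`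
      have hpow : (((m : ℝ) / 2 ^ j : ℝ) : ℂ) ^ (s : ℂ) =
          (a : ℂ) * (((m : ℝ) / 2 ^ k : ℝ) : ℂ) ^ (s : ℂ) := by
        have e2 : (((m : ℝ) / 2 ^ j : ℝ) : ℂ) =
            (((2 : ℝ) ^ (-((j - k : ℕ) : ℝ)) : ℝ) : ℂ) * (((m : ℝ) / 2 ^ k : ℝ) : ℂ) := by
          rw [← Complex.ofReal_mul]
          congr 1
          obtain ⟨i, rfl⟩ := Nat.exists_eq_add_of_le (le_trans (Nat.le_add_right k N) hkj)
          rw [Nat.add_sub_cancel_left, Real.rpow_neg (by norm_num), Real.rpow_natCast, pow_add]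
          field_simp
        rw [e2, ofReal_mul_cpow (by positivity) hz, ← Real.rpow_mul (by norm_num)]
        congr 4
        ring
      have ha : (a : ℂ) ≠ 0 := by
        have : 0 < a := Real.rpow_pos_of_pos (by norm_num) _
        exact_mod_cast this.ne'
      have hz' : (((m : ℝ) / 2 ^ k : ℝ) : ℂ) ^ (s : ℂ) ≠ 0 := by
        rw [Ne, Complex.cpow_eq_zero_iff]; tauto
      rw [hφ1, hpow]
      field_simp
    · simp
  have h4 := eLpNorm_le_of_multiplierNorm_lt hp
    ((le_iSup (fun j : ℕ => multiplierNorm p (fun k : ℤ =>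
      (1 - fourierCoeff (v j) k * fourierCoeff (w j) k) /
        (((k : ℝ) / 2 ^ j : ℝ) : ℂ) ^ (s : ℂ) * φ 0 (δ * ((k : ℝ) / 2 ^ j)))) j).trans_lt hM1)
    hGc (continuous_trig _ _) hmul
  refine h4.trans ?_
  rw [eLpNorm_const_mul]
  have ha : ‖(a : ℂ)‖ₑ = 2 ^ (-(s * ((j - k : ℕ) : ℝ))) := by
    rw [← ofReal_norm, Complex.norm_real, Real.norm_of_nonneg (by positivity),
      ← ENNReal.ofReal_rpow_of_pos (by norm_num)]
    simp
  rw [ha]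
  calc _ ≤ (M : ℝ≥0∞) * (2 ^ (-(s * ((j - k : ℕ) : ℝ))) *
        (C * eLpNorm (trig (freqSet k) c) p volume)) := by gcongr; exact hcpow k c
    _ = _ := by ring

theorem increment_trig (hw : ∀ j, Integrable (w j) volume) (j : ℕ) (S : Finset ℤ) (c : ℤ → ℂ)
    (x : Circ) :
    increment (quasiInterp v w) j (trig S c) x =
      ∑ m ∈ S, c m * increment (quasiInterp v w) j (fourier m) x := by
  cases j with
  | zero => exact quasiInterp_trig hw 0 S c x
  | succ j =>
    change quasiInterp v w (j + 1) (trig S c) x - quasiInterp v w j (trig S c) x = _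
    rw [quasiInterp_trig hw, quasiInterp_trig hw, ← Finset.sum_sub_distrib]
    refine Finset.sum_congr rfl fun m _ => ?_
    rw [← mul_sub]; rfl

/-- The increments of `Q_j` on a block of frequencies of size `2^k`.  For `j` well above `k`,
both `Q_j` and `Q_{j-1}` are close to the identity; for the other `j`, uniform boundedness
suffices, since `(j - k)_+` is bounded there. -/
theorem exists_eLpNorm_increment_le (hp : 1 ≤ p) (hpp' : 1 / p + 1 / p' = 1) {s : ℝ} (hs : 0 < s)
    {φ : ℕ → ℝ → ℂ} (hφ : IsResolution φ) (hv : ∀ j, v j ∈ trigPoly j) {ρ : ℝ} (hρ : ρ < 1)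
    (hρv : ∀ (j : ℕ) (k : ℤ), ρ * 2 ^ j < |(k : ℝ)| → fourierCoeff (v j) k = 0)
    (hM : (⨆ j, multiplierNorm p (fun k => fourierCoeff (v j) k)) < ∞)
    (hw : ∀ j, Measurable (w j)) (hwi : ∀ j, Integrable (w j) volume) {B : ℝ≥0∞} (hB : B ≠ ∞)
    (hwB : ∀ j, eLpNorm (nodeMean j (w j)) p' volume ≤ B) (hvw : Compatible p s (φ 0) v w) :
    ∃ C : ℝ≥0∞, C ≠ ∞ ∧ ∀ (j k : ℕ) (c : ℤ → ℂ),
      eLpNorm (fun x => ∑ m ∈ freqSet k, c m * increment (quasiInterp v w) j (fourier m) x)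
          p volume ≤
        C * 2 ^ (-(s * ((j - k : ℕ) : ℝ))) * eLpNorm (trig (freqSet k) c) p volume := by
  obtain ⟨C₁, hC₁, hQ⟩ := exists_eLpNorm_quasiInterp_le hp hpp' hv hM hw hB hwB
  obtain ⟨C₂, hC₂, N, hlow⟩ := exists_eLpNorm_trig_sub_le hp hφ hv hρ hρv hwi hvw
  have h2s : (2 : ℝ≥0∞) ^ s ≠ ∞ := ENNReal.rpow_ne_top_of_nonneg hs.le (by simp)
  have h2sN : (2 : ℝ≥0∞) ^ (s * (N + 1)) ≠ ∞ :=
    ENNReal.rpow_ne_top_of_nonneg (by positivity) (by simp)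
  refine ⟨C₂ * (1 + 2 ^ s) + 2 * C₁ * 2 ^ (s * (N + 1)), by finiteness, fun j k c => ?_⟩
  simp only [← increment_trig hwi]
  have hvc := fun j => continuous_of_trigPoly (hv j)
  set f := trig (freqSet k) c
  have hfc : Continuous f := continuous_trig _ _
  have hQc : ∀ j, Continuous (quasiInterp v w j f) := fun j => continuous_const.mul
    (continuous_finsetSum _ fun k _ => continuous_const.mul
      ((hvc j).comp (continuous_sub_right _)))
  -- in the first case both `j` and `j - 1` are in the range of the multiplier estimate
  by_cases hjk : k + N + 1 ≤ j
  · obtain ⟨j, rfl⟩ : ∃ i, j = i + 1 := ⟨j - 1, by omega⟩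
    have h1 := (hlow (j + 1) k c (by omega)).2
    have h2 := (hlow j k c (by omega)).2
    have e : increment (quasiInterp v w) (j + 1) f =
        (fun x => f x - quasiInterp v w j f x) - fun x => f x - quasiInterp v w (j + 1) f x := by
      funext x
      change quasiInterp v w (j + 1) f x - quasiInterp v w j f x = _
      simp only [Pi.sub_apply]; ring
    have hpow : (2 : ℝ≥0∞) ^ (-(s * ((j - k : ℕ) : ℝ))) =
        2 ^ s * 2 ^ (-(s * ((j + 1 - k : ℕ) : ℝ))) := by
      rw [← two_rpow_add]
      congr 1
      rw [Nat.succ_sub (by omega)]; push_cast; ring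
    calc eLpNorm (increment (quasiInterp v w) (j + 1) f) p volume ≤ _ := by
          rw [e]
          exact eLpNorm_sub_le (hfc.sub (hQc _)).aestronglyMeasurable
            (hfc.sub (hQc _)).aestronglyMeasurable hp
      _ ≤ _ := add_le_add h2 h1
      _ = C₂ * (1 + 2 ^ s) * 2 ^ (-(s * ((j + 1 - k : ℕ) : ℝ))) * eLpNorm f p volume := by
          rw [hpow]; ring
      _ ≤ _ := by gcongr; exact le_self_add
  · have h1 : eLpNorm (increment (quasiInterp v w) j f) p volume ≤ 2 * C₁ * eLpNorm f p volume := by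
      cases j with
      | zero =>
        refine (hQ 0 f hfc).trans ?_
        gcongr
        exact le_mul_of_one_le_left' (by norm_num)
      | succ j =>
        calc _ ≤ eLpNorm (quasiInterp v w (j + 1) f) p volume +
              eLpNorm (quasiInterp v w j f) p volume :=
              eLpNorm_sub_le (hQc _).aestronglyMeasurable (hQc _).aestronglyMeasurable hp
          _ ≤ _ := add_le_add (hQ _ f hfc) (hQ _ f hfc)
          _ = _ := by ring
    have hpow : (1 : ℝ≥0∞) ≤ 2 ^ (s * (N + 1)) * 2 ^ (-(s * ((j - k : ℕ) : ℝ))) := by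
      rw [← two_rpow_add]
      rw [← ENNReal.rpow_zero (x := 2)]
      refine ENNReal.rpow_le_rpow_of_exponent_le (by norm_num) ?_
      have : ((j - k : ℕ) : ℝ) ≤ N + 1 := by
        have : j - k ≤ N + 1 := by omega
        exact_mod_cast this
      nlinarith
    calc _ ≤ 2 * C₁ * eLpNorm f p volume * 1 := by rw [mul_one]; exact h1
      _ ≤ 2 * C₁ * eLpNorm f p volume *
          (2 ^ (s * (N + 1)) * 2 ^ (-(s * ((j - k : ℕ) : ℝ)))) := by gcongr
      _ = 2 * C₁ * 2 ^ (s * (N + 1)) * 2 ^ (-(s * ((j - k : ℕ) : ℝ))) * eLpNorm f p volume := by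
          ring
      _ ≤ _ := by gcongr; exact le_add_self

/-- Every frequency lies in some dyadic block. -/
theorem exists_mem_freqSet (m : ℤ) : ∃ k, m ∈ freqSet k := by
  rcases eq_or_ne m 0 with rfl | hm
  · exact ⟨0, by simp [freqSet]⟩
  · refine ⟨Nat.log 2 m.natAbs, Finset.mem_filter.2 ⟨?_, Or.inr ?_⟩⟩
    · have h := Nat.lt_pow_succ_log_self (b := 2) (by norm_num) m.natAbs
      have h' : |m| < 2 ^ (Nat.log 2 m.natAbs + 1) := by
        rw [Int.abs_eq_natAbs]; exact_mod_cast h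
      exact Finset.mem_Icc.2 (abs_le.1 h'.le)
    · have h := Nat.pow_log_le_self 2 (Int.natAbs_ne_zero.2 hm)
      have h' : (2 : ℤ) ^ (Nat.log 2 m.natAbs) ≤ |m| := by
        rw [Int.abs_eq_natAbs]; exact_mod_cast h
      linarith [abs_nonneg m]

theorem eLpNorm_fourier (m : ℤ) (p : ℝ≥0∞) :
    eLpNorm (fun x : Circ => fourier m x) p volume = eLpNorm (fun _ : Circ => (1 : ℂ)) p volume :=
  eLpNorm_congr_norm_ae (Filter.Eventually.of_forall fun x => by
    rw [norm_fourier_apply, norm_one])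

/-- The increments of `Q_j` sum up to the identity on every character. -/
theorem hasSum_increment (hp : 1 ≤ p) {s : ℝ} (hs : 0 < s) {φ : ℕ → ℝ → ℂ}
    (hφ : IsResolution φ) (hv : ∀ j, v j ∈ trigPoly j) {ρ : ℝ} (hρ : ρ < 1)
    (hρv : ∀ (j : ℕ) (k : ℤ), ρ * 2 ^ j < |(k : ℝ)| → fourierCoeff (v j) k = 0)
    (hw : ∀ j, Integrable (w j) volume) (hvw : Compatible p s (φ 0) v w) (m : ℤ) (x : Circ) :
    (Summable fun j => ‖increment (quasiInterp v w) j (fourier m) x‖) ∧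
      HasSum (fun j => increment (quasiInterp v w) j (fourier m) x) (fourier m x) := by
  obtain ⟨C, hC, N, hlow⟩ := exists_eLpNorm_trig_sub_le hp hφ hv hρ hρv hw hvw
  obtain ⟨k, hk⟩ := exists_mem_freqSet m
  set E : ℕ → ℂ := fun j => fourier m x - quasiInterp v w j (fourier m) x
  have htrig : trig (freqSet k) (Pi.single m 1) = fun y => fourier m y := by
    funext y
    unfold trig
    rw [Finset.sum_eq_single m]
    · simp
    · intro b _ hb; simp [hb]
    · intro h; exact absurd hk h
  have hE : ∀ i : ℕ, ‖E (i + (k + N))‖ₑ ≤ C * 2 ^ (-(s * (i : ℝ))) := by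
    intro i
    obtain ⟨h1, h2⟩ := hlow (i + (k + N)) k (Pi.single m 1) (by omega)
    rw [htrig] at h2
    set μ : ℂ := 1 - fourierCoeff (v (i + (k + N))) m * fourierCoeff (w (i + (k + N))) m
    have h3 : ∀ y, fourier m y - quasiInterp v w (i + (k + N)) (fun y => fourier m y) y =
        μ * fourier m y := by
      intro y
      have := h1 m hk y
      change fourier m y - quasiInterp v w (i + (k + N)) (fourier m) y = _
      rw [this]; simp only [μ]; ring
    simp only [h3] at h2
    rw [eLpNorm_const_mul, eLpNorm_fourier] at h2
    have hne : eLpNorm (fun _ : Circ => (1 : ℂ)) p volume ≠ 0 := by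
      rw [eLpNorm_const _ (zero_lt_one.trans_le hp).ne' (NeZero.ne _)]
      simp only [enorm_one, one_mul]
      exact (ENNReal.rpow_pos (NeZero.pos _) (measure_ne_top _ _)).ne'
    have hnt : eLpNorm (fun _ : Circ => (1 : ℂ)) p volume ≠ ∞ :=
      (memLp_of_continuous continuous_const p).2.ne
    rw [ENNReal.mul_le_mul_iff_left hne hnt] at h2
    have h4 : E (i + (k + N)) = μ * fourier m x := h3 x
    rw [h4, enorm_mul, ← ofReal_norm (fourier m x), norm_fourier_apply, ENNReal.ofReal_one, mul_one]
    refine h2.trans ?_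
    gcongr
    · norm_num
    · omega
  have hEs : Summable fun i => ‖E i‖ := by
    rw [← summable_nat_add_iff (k + N)]
    have h5 : ∑' i : ℕ, ‖E (i + (k + N))‖ₑ ≠ ∞ := by
      refine ne_top_of_le_ne_top ?_ (ENNReal.tsum_le_tsum hE)
      rw [ENNReal.tsum_mul_left]
      exact ENNReal.mul_ne_top hC (tsum_two_rpow_ne_top hs)
    have h6 := ENNReal.summable_toReal h5
    simpa using h6
  have hinc : ∀ j, increment (quasiInterp v w) (j + 1) (fourier m) x = E j - E (j + 1) := by
    intro j
    change quasiInterp v w (j + 1) (fourier m) x - quasiInterp v w j (fourier m) x = _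
    simp only [E]; ring
  have hsum : Summable fun j => ‖increment (quasiInterp v w) j (fourier m) x‖ := by
    rw [← summable_nat_add_iff 1]
    refine Summable.of_nonneg_of_le (fun _ => norm_nonneg _) (fun j => ?_)
      (hEs.add ((summable_nat_add_iff 1).2 hEs))
    rw [hinc]; exact norm_sub_le _ _
  refine ⟨hsum, ?_⟩
  have hpart : ∀ n, ∑ j ∈ Finset.range (n + 1), increment (quasiInterp v w) j (fourier m) x =
      fourier m x - E n := by
    intro n
    induction n with
    | zero => simp [increment, E]
    | succ n ih => rw [Finset.sum_range_succ, ih, hinc]; ring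
  have ht : Filter.Tendsto (fun n => ∑ j ∈ Finset.range (n + 1),
      increment (quasiInterp v w) j (fourier m) x) Filter.atTop (nhds (fourier m x)) := by
    simp only [hpart]
    simpa using tendsto_const_nhds.sub hEs.of_norm.tendsto_atTop_zero
  have h7 := hsum.of_norm.hasSum
  have h8 := (Filter.tendsto_add_atTop_iff_nat 1).2 h7.tendsto_sum_nat
  rwa [tendsto_nhds_unique h8 ht] at h7

end Bounds

/-! ### Dyadic schemes -/

/-- What the multivariate argument uses about a family of univariate operators `Y_j` on the circle:
the increments `Y_j - Y_{j-1}` are integral operators with kernels `D_j(x, ·) ∈ L_{p'}`, map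
characters to trigonometric polynomials of degree at most `2^j`, sum up to the identity on every
character, and decay like `2^{-s (j - k)_+}` on the `k`-th dyadic block.  The hypothesis on `F` in
`increment_eq` is a form of `F ∈ L_p` that passes to slices of functions on the torus. -/
structure IsDyadicScheme (p p' : ℝ≥0∞) (s : ℝ) (Y : ℕ → (Circ → ℂ) → Circ → ℂ)
    (D : ℕ → Circ → Circ → ℂ) (C : ℝ≥0∞) : Prop where
  measurable : ∀ j, Measurable (Function.uncurry (D j))
  memLp : ∀ j x, MemLp (D j x) p' volume
  increment_eq : ∀ (j : ℕ) (F : Circ → ℂ) (x : Circ),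
    (∀ g : Circ → ℂ, MemLp g p' volume → Integrable (fun t => F t * g t) volume) →
    increment Y j F x = ∫ t, F t * D j x t
  reproduced : ∀ (j : ℕ) (m : ℤ), Reproduced (2 ^ j) (increment Y j (fourier m))
  summable : ∀ (m : ℤ) (x : Circ), Summable fun j => ‖increment Y j (fourier m) x‖
  hasSum : ∀ (m : ℤ) (x : Circ), HasSum (fun j => increment Y j (fourier m) x) (fourier m x)
  eLpNorm_le : ∀ (j k : ℕ) (c : ℤ → ℂ),
    eLpNorm (fun x => ∑ m ∈ freqSet k, c m * increment Y j (fourier m) x) p volume ≤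
      C * 2 ^ (-(s * ((j - k : ℕ) : ℝ))) * eLpNorm (trig (freqSet k) c) p volume

section Kernel

variable {v w : ℕ → Circ → ℂ} {p p' : ℝ≥0∞}

/-- The kernel of `Q_j`. -/
noncomputable def quasiInterpKernel (v w : ℕ → Circ → ℂ) (j : ℕ) (x t : Circ) : ℂ :=
  ((2 : ℂ) ^ j)⁻¹ * ∑ k ∈ indexSet j,
    ((2 * Real.pi : ℝ) : ℂ)⁻¹ * v j (x - nodePt j k) * w j (nodePt j k - t)

/-- The kernel of `Q_j - Q_{j-1}`. -/
noncomputable def incrementKernel (v w : ℕ → Circ → ℂ) : ℕ → Circ → Circ → ℂ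
  | 0 => quasiInterpKernel v w 0
  | j + 1 => fun x t => quasiInterpKernel v w (j + 1) x t - quasiInterpKernel v w j x t

theorem measurable_quasiInterpKernel (hv : ∀ j, v j ∈ trigPoly j) (hw : ∀ j, Measurable (w j))
    (j : ℕ) : Measurable (Function.uncurry (quasiInterpKernel v w j)) := by
  have h : Function.uncurry (quasiInterpKernel v w j) = fun z : Circ × Circ => ((2 : ℂ) ^ j)⁻¹ *
      ∑ k ∈ indexSet j, ((2 * Real.pi : ℝ) : ℂ)⁻¹ * v j (z.1 - nodePt j k) *
        w j (nodePt j k - z.2) := rfl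
  rw [h]
  refine Measurable.const_mul (Finset.measurable_fun_sum _ fun k _ => Measurable.mul ?_ ?_) _
  · exact ((continuous_of_trigPoly (hv j)).measurable.comp
      ((measurable_id.sub_const (nodePt j k)).comp measurable_fst)).const_mul _
  · exact (hw j).comp ((measurable_const (a := nodePt j k)).sub measurable_snd)

theorem memLp_comp_sub_left {g : Circ → ℂ} (hg : MemLp g p' volume) (a : Circ) :
    MemLp (fun t => g (a - t)) p' volume :=
  hg.comp_measurePreserving (Measure.measurePreserving_sub_left volume a)

theorem memLp_quasiInterpKernel (hw : ∀ j, MemLp (w j) p' volume) (j : ℕ) (x : Circ) :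
    MemLp (quasiInterpKernel v w j x) p' volume := by
  have h : ∀ k ∈ indexSet j, MemLp (fun t => ((2 * Real.pi : ℝ) : ℂ)⁻¹ * v j (x - nodePt j k) *
      w j (nodePt j k - t)) p' volume := fun k _ =>
    (memLp_comp_sub_left (hw j) (nodePt j k)).const_mul _
  exact (memLp_finsetSum (indexSet j) h).const_mul (((2 : ℂ) ^ j)⁻¹)

theorem quasiInterp_eq_integral (hw : ∀ j, MemLp (w j) p' volume) (j : ℕ) {F : Circ → ℂ}
    (x : Circ) (hF : ∀ g : Circ → ℂ, MemLp g p' volume → Integrable (fun t => F t * g t) volume) :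
    quasiInterp v w j F x = ∫ t, F t * quasiInterpKernel v w j x t := by
  have h : ∀ t, F t * quasiInterpKernel v w j x t = ((2 : ℂ) ^ j)⁻¹ *
      ∑ k ∈ indexSet j, ((2 * Real.pi : ℝ) : ℂ)⁻¹ * v j (x - nodePt j k) *
        (F t * w j (nodePt j k - t)) := fun t => by
    unfold quasiInterpKernel
    rw [mul_left_comm, Finset.mul_sum]
    congr 1
    exact Finset.sum_congr rfl fun k _ => by ring
  simp only [h]
  rw [integral_const_mul, integral_finsetSum _ fun k _ =>
    (hF _ (memLp_comp_sub_left (hw j) (nodePt j k))).const_mul _]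
  unfold quasiInterp
  congr 1
  refine Finset.sum_congr rfl fun k _ => ?_
  rw [integral_const_mul, conv_eq]
  change _ * v j (x - nodePt j k) = _
  rw [mul_right_comm]; rfl

theorem increment_eq_integral (hw : ∀ j, MemLp (w j) p' volume) (j : ℕ) {F : Circ → ℂ}
    (x : Circ) (hF : ∀ g : Circ → ℂ, MemLp g p' volume → Integrable (fun t => F t * g t) volume) :
    increment (quasiInterp v w) j F x = ∫ t, F t * incrementKernel v w j x t := by
  cases j with
  | zero => exact quasiInterp_eq_integral hw 0 x hF
  | succ j =>
    change quasiInterp v w (j + 1) F x - quasiInterp v w j F x = _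
    rw [quasiInterp_eq_integral hw _ x hF, quasiInterp_eq_integral hw _ x hF,
      ← integral_sub (hF _ (memLp_quasiInterpKernel hw _ x))
        (hF _ (memLp_quasiInterpKernel hw _ x))]
    exact integral_congr_ae (Filter.Eventually.of_forall fun t => (mul_sub _ _ _).symm)

theorem measurable_incrementKernel (hv : ∀ j, v j ∈ trigPoly j) (hw : ∀ j, Measurable (w j))
    (j : ℕ) : Measurable (Function.uncurry (incrementKernel v w j)) := by
  cases j with
  | zero => exact measurable_quasiInterpKernel hv hw 0
  | succ j =>
    exact (measurable_quasiInterpKernel hv hw (j + 1)).sub (measurable_quasiInterpKernel hv hw j)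

theorem memLp_incrementKernel (hw : ∀ j, MemLp (w j) p' volume) (j : ℕ) (x : Circ) :
    MemLp (incrementKernel v w j x) p' volume := by
  cases j with
  | zero => exact memLp_quasiInterpKernel hw 0 x
  | succ j => exact (memLp_quasiInterpKernel hw (j + 1) x).sub (memLp_quasiInterpKernel hw j x)

theorem quasiInterp_congr_ae {w' : ℕ → Circ → ℂ} (h : ∀ j, w j =ᵐ[volume] w' j) :
    quasiInterp v w = quasiInterp v w' := by
  funext j f x
  unfold quasiInterp
  rw [conv_congr_ae (h j)]

/-- Under the assumptions of the theorem the operators `Q_j` form a dyadic scheme of order `s`. -/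
theorem exists_isDyadicScheme (hp : 1 ≤ p) (hpp' : 1 / p + 1 / p' = 1) {s : ℝ} (hs : 0 < s)
    {φ : ℕ → ℝ → ℂ} (hφ : IsResolution φ) (hv : ∀ j, v j ∈ trigPoly j)
    (hv_band : ∃ ρ : ℝ, ρ < 1 ∧ ∀ (j : ℕ) (k : ℤ), ρ * 2 ^ j < |(k : ℝ)| →
      fourierCoeff (v j) k = 0)
    (hM : (⨆ j, multiplierNorm p (fun k => fourierCoeff (v j) k)) < ∞)
    (hw : ∀ j, MemLp (w j) p' volume) (hwN : (⨆ j, scaledNorm p' j (w j)) < ∞)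
    (hvw : Compatible p s (φ 0) v w) :
    ∃ (D : ℕ → Circ → Circ → ℂ) (C : ℝ≥0∞), C ≠ ∞ ∧
      IsDyadicScheme p p' s (quasiInterp v w) D C := by
  obtain ⟨ρ, hρ, hρv⟩ := hv_band
  have hp' : 1 ≤ p' := by
    have h : 1 / p' ≤ 1 := le_add_self.trans_eq hpp'
    simpa using h
  -- a measurable representative of the averaging functions gives the same operators
  set w' : ℕ → Circ → ℂ := fun j => (hw j).1.mk (w j)
  have hae : ∀ j, w j =ᵐ[volume] w' j := fun j => (hw j).1.ae_eq_mk
  have hw'm : ∀ j, Measurable (w' j) := fun j => (hw j).1.stronglyMeasurable_mk.measurable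
  have hw' : ∀ j, MemLp (w' j) p' volume := fun j => (hw j).ae_eq (hae j)
  have hw'i : ∀ j, Integrable (w' j) volume := fun j => (hw' j).integrable hp'
  have hB : ∀ j, eLpNorm (nodeMean j (w' j)) p' volume ≤ ⨆ j, scaledNorm p' j (w j) := fun j => by
    rw [← eLpNorm_congr_ae (nodeMean_congr_ae j (hae j))]
    exact (eLpNorm_nodeMean_le j (hw j).1 hp').trans (le_iSup (fun j => scaledNorm p' j (w j)) j)
  have hcoef : ∀ j k, fourierCoeff (w' j) k = fourierCoeff (w j) k := fun j k => by
    rw [fourierCoeff_eq_integral, fourierCoeff_eq_integral]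
    congr 1
    refine integral_congr_ae ?_
    filter_upwards [hae j] with t ht
    rw [ht]
  have hvw' : Compatible p s (φ 0) v w' := by
    unfold Compatible at hvw ⊢; simpa only [hcoef] using hvw
  obtain ⟨C, hC, hbound⟩ := exists_eLpNorm_increment_le hp hpp' hs hφ hv hρ hρv hM hw'm hw'i
    hwN.ne hB hvw'
  rw [quasiInterp_congr_ae hae]
  have hsum := hasSum_increment hp hs hφ hv hρ hρv hw'i hvw'
  exact ⟨incrementKernel v w', C, hC,
    { measurable := measurable_incrementKernel hv hw'm
      memLp := memLp_incrementKernel hw'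
      increment_eq := fun j F x hF => increment_eq_integral hw' j x hF
      reproduced := fun j m => reproduced_increment hv j m
      summable := fun m x => (hsum m x).1
      hasSum := fun m x => (hsum m x).2
      eLpNorm_le := hbound }⟩

end Kernel

/-! ### The torus as a product -/

/-- Splitting off the first variable. -/
noncomputable def consEquiv (d : ℕ) : Circ × Torus d ≃ᵐ Torus (d + 1) :=
  (MeasurableEquiv.piFinSuccAbove (fun _ : Fin (d + 1) => Circ) 0).symm

theorem consEquiv_apply {d : ℕ} (z : Circ × Torus d) :
    consEquiv d z = (Fin.cons z.1 z.2 : Torus (d + 1)) :=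
  Fin.insertNth_zero' (β := Circ) z.1 z.2

theorem measurePreserving_consEquiv (d : ℕ) :
    MeasurePreserving (consEquiv d) ((volume : Measure Circ).prod (volume : Measure (Torus d)))
      volume :=
  (volume_preserving_piFinSuccAbove (fun _ : Fin (d + 1) => Circ) 0).symm _

theorem lintegral_torus_succ {d : ℕ} (F : Torus (d + 1) → ℝ≥0∞) :
    ∫⁻ x, F x = ∫⁻ z, F (Fin.cons z.1 z.2)
      ∂((volume : Measure Circ).prod (volume : Measure (Torus d))) := by
  simpa only [consEquiv_apply] using ((measurePreserving_consEquiv d).lintegral_comp_emb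
    (consEquiv d).measurableEmbedding F).symm

theorem integral_torus_succ {d : ℕ} (F : Torus (d + 1) → ℂ) :
    ∫ x, F x = ∫ z, F (Fin.cons z.1 z.2)
      ∂((volume : Measure Circ).prod (volume : Measure (Torus d))) := by
  simpa only [consEquiv_apply] using ((measurePreserving_consEquiv d).integral_comp
    (consEquiv d).measurableEmbedding F).symm

theorem aestronglyMeasurable_torus_succ {d : ℕ} {F : Torus (d + 1) → ℂ} :
    AEStronglyMeasurable F volume ↔ AEStronglyMeasurable
      (fun z : Circ × Torus d => F (Fin.cons z.1 z.2))
      ((volume : Measure Circ).prod (volume : Measure (Torus d))) := by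
  simpa only [consEquiv_apply, Function.comp_def] using
    ((measurePreserving_consEquiv d).aestronglyMeasurable_comp_iff
      (consEquiv d).measurableEmbedding (g := F)).symm

theorem eLpNorm_torus_succ {d : ℕ} {F : Torus (d + 1) → ℂ} (p : ℝ≥0∞) :
    eLpNorm F p volume = eLpNorm (fun z : Circ × Torus d => F (Fin.cons z.1 z.2)) p
      ((volume : Measure Circ).prod (volume : Measure (Torus d))) := by
  have h := (consEquiv d).measurableEmbedding.eLpNorm_map_measure (p := p) (g := F)
    (μ := (volume : Measure Circ).prod (volume : Measure (Torus d)))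
  rw [(measurePreserving_consEquiv d).map_eq] at h
  simpa only [consEquiv_apply, Function.comp_def] using h

theorem memLp_torus_succ {d : ℕ} {F : Torus (d + 1) → ℂ} {p : ℝ≥0∞} :
    MemLp F p volume ↔ MemLp (fun z : Circ × Torus d => F (Fin.cons z.1 z.2)) p
      ((volume : Measure Circ).prod (volume : Measure (Torus d))) := by
  unfold MemLp
  rw [aestronglyMeasurable_torus_succ, eLpNorm_torus_succ]

section Product

variable {X Y : Type*} [MeasurableSpace X] [MeasurableSpace Y] {μ : Measure X} {ν : Measure Y}
  [SFinite ν] {p : ℝ≥0∞}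

theorem memLp_mul_prod {f : X → ℂ} {g : Y → ℂ} (hf : MemLp f p μ) (hg : MemLp g p ν) :
    MemLp (fun z : X × Y => f z.1 * g z.2) p (μ.prod ν) := by
  refine ⟨hf.1.comp_fst.mul hg.1.comp_snd, ?_⟩
  rcases eq_or_ne p 0 with rfl | hp0
  · simp
  rcases eq_or_ne p ∞ with rfl | hpt
  · have h1 : ∀ᵐ z ∂μ.prod ν, ‖f z.1‖ₑ ≤ eLpNormEssSup f μ :=
      Measure.quasiMeasurePreserving_fst.ae (enorm_ae_le_eLpNormEssSup f μ)
    have h2 : ∀ᵐ z ∂μ.prod ν, ‖g z.2‖ₑ ≤ eLpNormEssSup g ν :=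
      Measure.quasiMeasurePreserving_snd.ae (enorm_ae_le_eLpNormEssSup g ν)
    have hf2 := hf.2
    have hg2 := hg.2
    rw [eLpNorm_exponent_top] at hf2 hg2 ⊢
    refine lt_of_le_of_lt (eLpNormEssSup_le_of_ae_enorm_bound ?_) (ENNReal.mul_lt_top hf2 hg2)
    filter_upwards [h1, h2] with z hz1 hz2
    rw [enorm_mul]
    exact mul_le_mul' hz1 hz2
  · rw [eLpNorm_lt_top_iff_lintegral_rpow_enorm_lt_top hp0 hpt]
    have h1 := (eLpNorm_lt_top_iff_lintegral_rpow_enorm_lt_top hp0 hpt).1 hf.2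
    have h2 := (eLpNorm_lt_top_iff_lintegral_rpow_enorm_lt_top hp0 hpt).1 hg.2
    simp only [enorm_mul]
    simp only [ENNReal.mul_rpow_of_nonneg _ _ ENNReal.toReal_nonneg]
    rw [lintegral_prod_mul (f := fun x => ‖f x‖ₑ ^ p.toReal) (g := fun y => ‖g y‖ₑ ^ p.toReal)
      (hf.1.enorm.pow_const _) (hg.1.enorm.pow_const _)]
    exact ENNReal.mul_lt_top h1 h2

theorem ae_memLp_slice {F : X × Y → ℂ} (hF : MemLp F p (μ.prod ν)) :
    ∀ᵐ x ∂μ, MemLp (fun y => F (x, y)) p ν := by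
  have hm : ∀ᵐ x ∂μ, AEStronglyMeasurable (fun y => F (x, y)) ν := hF.1.prodMk_left
  rcases eq_or_ne p 0 with rfl | hp0
  · filter_upwards [hm] with x hx
    exact ⟨hx, by simp⟩
  rcases eq_or_ne p ∞ with rfl | hpt
  · filter_upwards [hm, Measure.ae_ae_of_ae_prod (enorm_ae_le_eLpNormEssSup F (μ.prod ν))]
      with x hx hx'
    refine ⟨hx, ?_⟩
    have h2 := hF.2
    rw [eLpNorm_exponent_top] at h2 ⊢
    exact (eLpNormEssSup_le_of_ae_enorm_bound hx').trans_lt h2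
  · have h2 := (eLpNorm_lt_top_iff_lintegral_rpow_enorm_lt_top hp0 hpt).1 hF.2
    have hae : AEMeasurable (fun z => ‖F z‖ₑ ^ p.toReal) (μ.prod ν) := hF.1.enorm.pow_const _
    rw [lintegral_prod _ hae] at h2
    filter_upwards [hm, ae_lt_top' hae.lintegral_prod_right' h2.ne] with x hx hx'
    exact ⟨hx, (eLpNorm_lt_top_iff_lintegral_rpow_enorm_lt_top hp0 hpt).2 hx'⟩

/-- An inequality between `L_p`-norms that holds for all slices holds on the product. -/
theorem eLpNorm_le_of_slice [SFinite μ] {F G : X × Y → ℂ} (hF : Measurable F) (hG : Measurable G)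
    {C : ℝ≥0∞} (h : ∀ x, eLpNorm (fun y => F (x, y)) p ν ≤ C * eLpNorm (fun y => G (x, y)) p ν) :
    eLpNorm F p (μ.prod ν) ≤ C * eLpNorm G p (μ.prod ν) := by
  rcases eq_or_ne p 0 with rfl | hp0
  · simp
  rcases eq_or_ne p ∞ with rfl | hpt
  · simp only [eLpNorm_exponent_top] at h ⊢
    refine eLpNormEssSup_le_of_ae_enorm_bound ?_
    rw [Measure.ae_prod_iff_ae_ae (measurableSet_le hF.enorm measurable_const)]
    filter_upwards [Measure.ae_ae_of_ae_prod (enorm_ae_le_eLpNormEssSup G (μ.prod ν))] with x hx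
    have h1 : eLpNormEssSup (fun y => G (x, y)) ν ≤ eLpNormEssSup G (μ.prod ν) :=
      eLpNormEssSup_le_of_ae_enorm_bound hx
    filter_upwards [enorm_ae_le_eLpNormEssSup (fun y => F (x, y)) ν] with y hy
    exact (hy.trans (h x)).trans (mul_le_mul_right h1 _)
  · have hp : 0 < p.toReal := ENNReal.toReal_pos hp0 hpt
    simp only [eLpNorm_eq_lintegral_rpow_enorm_toReal hp0 hpt] at h ⊢
    rw [one_div, ENNReal.rpow_inv_le_iff hp, ENNReal.mul_rpow_of_nonneg _ _ hp.le,
      ← ENNReal.rpow_mul, inv_mul_cancel₀ hp.ne', ENNReal.rpow_one,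
      lintegral_prod _ (hF.enorm.pow_const _).aemeasurable,
      lintegral_prod _ (hG.enorm.pow_const _).aemeasurable,
      ← lintegral_const_mul _ (hG.enorm.pow_const _).lintegral_prod_right']
    refine lintegral_mono fun x => ?_
    have h1 := h x
    rwa [one_div, ENNReal.rpow_inv_le_iff hp, ENNReal.mul_rpow_of_nonneg _ _ hp.le,
      ← ENNReal.rpow_mul, inv_mul_cancel₀ hp.ne', ENNReal.rpow_one] at h1

end Product

theorem memLp_prod_pi {p : ℝ≥0∞} {d : ℕ} {g : Fin d → Circ → ℂ} (hg : ∀ i, MemLp (g i) p volume) :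
    MemLp (fun t : Torus d => ∏ i, g i (t i)) p volume := by
  induction d with
  | zero => simp
  | succ d ih =>
    rw [memLp_torus_succ]
    simp only [Fin.prod_univ_succ, Fin.cons_zero, Fin.cons_succ]
    exact memLp_mul_prod (hg 0) (ih fun i => hg i.succ)

theorem holderTriple_one {p p' : ℝ≥0∞} (h : 1 / p + 1 / p' = 1) : ENNReal.HolderTriple p p' 1 :=
  ⟨by simpa using h⟩

theorem integrable_mul_of_memLp {X : Type*} [MeasurableSpace X] {μ : Measure X} {p p' : ℝ≥0∞}
    (hpp' : 1 / p + 1 / p' = 1) {f g : X → ℂ}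
    (hf : MemLp f p μ) (hg : MemLp g p' μ) : Integrable (fun t => f t * g t) μ := by
  have := holderTriple_one hpp'
  exact memLp_one_iff_integrable.1 (hg.mul hf)

/-! ### Kernels of the tensor products -/

theorem foldr_inVariable_cons {d : ℕ} (A : Fin (d + 1) → (Circ → ℂ) → Circ → ℂ)
    (f : Torus (d + 1) → ℂ) (t : Circ) (L : List (Fin d)) (x : Torus d) :
    (L.map Fin.succ).foldr (fun i F => inVariable i (A i) F) f (Fin.cons t x : Torus (d + 1)) =
      L.foldr (fun i F => inVariable i (A i.succ) F) (fun y => f (Fin.cons t y : Torus (d + 1)))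
        x := by
  induction L generalizing x with
  | nil => rfl
  | cons i L ih =>
    simp only [List.map_cons, List.foldr_cons, inVariable, Fin.cons_succ, ← Fin.cons_update, ih]

/-- The increment in `d + 1` variables applies the increment in the first variable last. -/
theorem tensorIncrement_cons {d : ℕ} (Y : ℕ → (Circ → ℂ) → Circ → ℂ) (j : Fin (d + 1) → ℕ)
    (f : Torus (d + 1) → ℂ) (a : Circ) (x : Torus d) :
    tensorIncrement Y j f (Fin.cons a x : Torus (d + 1)) =
      increment Y (j 0) (fun t => tensorIncrement Y (fun i => j i.succ)
        (fun y => f (Fin.cons t y : Torus (d + 1))) x) a := by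
  unfold tensorIncrement
  rw [List.finRange_succ, List.foldr_cons]
  unfold inVariable
  rw [Fin.cons_zero]
  congr 1
  funext t
  rw [Fin.update_cons_zero]
  exact foldr_inVariable_cons (fun i => increment Y (j i)) f t _ x

/-- A composition of univariate operators is the integral operator with the product kernel, for
every point `x` and every `f ∈ L_p`. -/
theorem tensorIncrement_eq_integral {p p' : ℝ≥0∞} (hpp' : 1 / p + 1 / p' = 1) {s : ℝ}
    {Y : ℕ → (Circ → ℂ) → Circ → ℂ} {D : ℕ → Circ → Circ → ℂ} {C : ℝ≥0∞}
    (hY : IsDyadicScheme p p' s Y D C) {d : ℕ} (j : Fin d → ℕ) {f : Torus d → ℂ}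
    (hf : MemLp f p volume) (x : Torus d) :
    tensorIncrement Y j f x = ∫ t, f t * ∏ i, D (j i) (x i) (t i) := by
  induction d with
  | zero =>
    simp only [tensorIncrement, List.finRange_zero, List.foldr_nil, Finset.univ_eq_empty,
      Finset.prod_empty, mul_one]
    have : ∀ t : Torus 0, f t = f x := fun t => by rw [Subsingleton.elim t x]
    simp [this, measureReal_def, volume_pi]
  | succ d ih =>
    obtain ⟨a, x, rfl⟩ : ∃ a y, x = (Fin.cons a y : Torus (d + 1)) :=
      ⟨x 0, Fin.tail x, (Fin.cons_self_tail x).symm⟩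
    rw [tensorIncrement_cons, integral_torus_succ]
    rw [memLp_torus_succ] at hf
    simp only [Fin.prod_univ_succ, Fin.cons_zero, Fin.cons_succ]
    set P : Torus d → ℂ := fun t => ∏ i, D (j i.succ) (x i) (t i)
    have hP : MemLp P p' volume := memLp_prod_pi fun i => hY.memLp _ _
    have hint : ∀ g : Circ → ℂ, MemLp g p' volume → Integrable (fun z : Circ × Torus d =>
        f (Fin.cons z.1 z.2 : Torus (d + 1)) * (g z.1 * P z.2)) (volume.prod volume) :=
      fun g hg => integrable_mul_of_memLp hpp' hf (memLp_mul_prod hg hP)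
    have hslice : ∀ᵐ t ∂(volume : Measure Circ), tensorIncrement Y (fun i => j i.succ)
        (fun y => f (Fin.cons t y : Torus (d + 1))) x =
          ∫ y, f (Fin.cons t y : Torus (d + 1)) * P y := by
      filter_upwards [ae_memLp_slice hf] with t ht
      exact ih (fun i => j i.succ) ht x
    have hpull : ∀ (g : Circ → ℂ) (t : Circ), ∫ y, f (Fin.cons t y : Torus (d + 1)) *
        (g t * P y) = (∫ y, f (Fin.cons t y : Torus (d + 1)) * P y) * g t := fun g t => by
      rw [← integral_mul_const]
      congr 1; funext y; ring
    rw [hY.increment_eq (j 0) _ a, integral_prod _ (hint _ (hY.memLp (j 0) a))]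
    · refine integral_congr_ae ?_
      filter_upwards [hslice] with t ht
      rw [ht]
      exact (hpull (D (j 0) a) t).symm
    · intro g hg
      refine (hint g hg).integral_prod_left.congr ?_
      filter_upwards [hslice] with t ht
      rw [ht]
      exact hpull g t

theorem aestronglyMeasurable_tensorIncrement {p p' : ℝ≥0∞} (hpp' : 1 / p + 1 / p' = 1) {s : ℝ}
    {Y : ℕ → (Circ → ℂ) → Circ → ℂ} {D : ℕ → Circ → Circ → ℂ} {C : ℝ≥0∞}
    (hY : IsDyadicScheme p p' s Y D C) {d : ℕ} (j : Fin d → ℕ) {f : Torus d → ℂ}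
    (hf : MemLp f p volume) : AEStronglyMeasurable (tensorIncrement Y j f) volume := by
  have h : tensorIncrement Y j f = fun x => ∫ t, f t * ∏ i, D (j i) (x i) (t i) :=
    funext (tensorIncrement_eq_integral hpp' hY j hf)
  rw [h]
  have hm1 : ∀ i, Measurable fun z : Torus d × Torus d => (z.1 i, z.2 i) := fun i =>
    ((measurable_pi_apply i).comp measurable_fst).prodMk
      ((measurable_pi_apply i).comp measurable_snd)
  have hm : Measurable fun z : Torus d × Torus d => ∏ i, D (j i) (z.1 i) (z.2 i) :=
    Finset.measurable_prod _ fun i _ => (hY.measurable (j i)).comp (hm1 i)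
  exact (hf.1.comp_snd.mul hm.aestronglyMeasurable).integral_prod_right'

/-! ### Tensor products on finite sets of frequencies -/

theorem sum_piFinset_succ {M : Type*} [AddCommMonoid M] {d : ℕ} (S : Fin (d + 1) → Finset ℤ)
    (F : (Fin (d + 1) → ℤ) → M) :
    ∑ m ∈ Fintype.piFinset S, F m =
      ∑ a ∈ S 0, ∑ b ∈ Fintype.piFinset fun i => S i.succ, F (Fin.cons a b) := by
  rw [← Finset.sum_product']
  symm
  refine Finset.sum_nbij' (fun z => (Fin.cons z.1 z.2 : Fin (d + 1) → ℤ))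
    (fun m => (m 0, Fin.tail m)) ?_ ?_ ?_ ?_ ?_
  · intro z hz
    rw [Finset.mem_product, Fintype.mem_piFinset] at hz
    rw [Fintype.mem_piFinset]
    intro i
    refine Fin.cases ?_ (fun i => ?_) i
    · exact hz.1
    · exact hz.2 i
  · intro m hm
    rw [Fintype.mem_piFinset] at hm
    rw [Finset.mem_product, Fintype.mem_piFinset]
    exact ⟨hm 0, fun i => hm i.succ⟩
  · intro z _; simp
  · intro m _; simp
  · intro z _; rfl

/-- Univariate bounds for linear maps of trigonometric polynomials multiply under tensor
products: they are applied in one variable at a time, with the others frozen. -/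
theorem eLpNorm_tensor_le {p : ℝ≥0∞} {d : ℕ} {S : Fin d → Finset ℤ} {ψ : Fin d → ℤ → Circ → ℂ}
    (hψ : ∀ i m, Continuous (ψ i m)) {C : Fin d → ℝ≥0∞}
    (h : ∀ (i : Fin d) (c : ℤ → ℂ), eLpNorm (fun x => ∑ m ∈ S i, c m * ψ i m x) p volume ≤
      C i * eLpNorm (trig (S i) c) p volume) (c : (Fin d → ℤ) → ℂ) :
    eLpNorm (fun x : Torus d => ∑ m ∈ Fintype.piFinset S, c m * ∏ i, ψ i (m i) (x i)) p volume ≤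
      (∏ i, C i) * eLpNorm (fun x => ∑ m ∈ Fintype.piFinset S, c m * character m x) p volume := by
  induction d with
  | zero => simp [character]
  | succ d ih =>
    rw [eLpNorm_torus_succ, eLpNorm_torus_succ]
    simp only [sum_piFinset_succ, character, Fin.prod_univ_succ, Fin.cons_zero, Fin.cons_succ]
    set S' : Fin d → Finset ℤ := fun i => S i.succ
    set F : Circ × Torus d → ℂ := fun z => ∑ a ∈ S 0, ∑ b ∈ Fintype.piFinset S',
      c (Fin.cons a b) * (ψ 0 a z.1 * ∏ i, ψ i.succ (b i) (z.2 i))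
    set G : Circ × Torus d → ℂ := fun z => ∑ a ∈ S 0, ∑ b ∈ Fintype.piFinset S',
      c (Fin.cons a b) * (fourier a z.1 * ∏ i, ψ i.succ (b i) (z.2 i))
    set H : Circ × Torus d → ℂ := fun z => ∑ a ∈ S 0, ∑ b ∈ Fintype.piFinset S',
      c (Fin.cons a b) * (fourier a z.1 * ∏ i, fourier (b i) (z.2 i))
    have hcont : ∀ (α : ℤ → Circ → ℂ) (β : Fin d → ℤ → Circ → ℂ), (∀ m, Continuous (α m)) →
        (∀ i m, Continuous (β i m)) → Continuous fun z : Circ × Torus d => ∑ a ∈ S 0,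
          ∑ b ∈ Fintype.piFinset S', c (Fin.cons a b) * (α a z.1 * ∏ i, β i (b i) (z.2 i)) := by
      intro α β hα hβ
      refine continuous_finsetSum _ fun a _ => continuous_finsetSum _ fun b _ =>
        continuous_const.mul (((hα a).comp continuous_fst).mul
          (continuous_finsetProd _ fun i _ => (hβ i (b i)).comp
            ((continuous_apply i).comp continuous_snd)))
    have hFm : Measurable F := (hcont (ψ 0) (fun i => ψ i.succ) (hψ 0) fun i => hψ _).measurable
    have hGm : Measurable G := (hcont (fun m => fourier m) (fun i => ψ i.succ)
      (fun m => (fourier m).continuous) fun i => hψ _).measurable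
    have hHm : Measurable H := (hcont (fun m => fourier m) (fun _ m => fourier m)
      (fun m => (fourier m).continuous) fun _ m => (fourier m).continuous).measurable
    have h1 : eLpNorm F p (volume.prod volume) ≤ C 0 * eLpNorm G p (volume.prod volume) := by
      have e : ∀ F : Circ × Torus d → ℂ, Measurable F → eLpNorm F p (volume.prod volume) =
          eLpNorm (fun z : Torus d × Circ => F z.swap) p (volume.prod volume) := by
        intro F hF
        exact (eLpNorm_comp_measurePreserving (p := p) hF.aestronglyMeasurable
          (Measure.measurePreserving_swap (μ := (volume : Measure (Torus d)))
            (ν := (volume : Measure Circ)))).symm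
      rw [e F hFm, e G hGm]
      refine eLpNorm_le_of_slice (hFm.comp measurable_swap) (hGm.comp measurable_swap) fun x => ?_
      have h2 := h 0 fun a => ∑ b ∈ Fintype.piFinset S',
        c (Fin.cons a b) * ∏ i, ψ i.succ (b i) (x i)
      refine le_trans (le_of_eq ?_) (h2.trans_eq ?_)
      · congr 1
        funext t
        refine Finset.sum_congr rfl fun a _ => ?_
        rw [Finset.sum_mul]
        exact Finset.sum_congr rfl fun b _ => by simp only [Prod.swap]; ring
      · congr 2
        funext t
        refine Finset.sum_congr rfl fun a _ => ?_
        rw [Finset.sum_mul]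
        exact Finset.sum_congr rfl fun b _ => by simp only [Prod.swap]; ring
    have h2 : eLpNorm G p (volume.prod volume) ≤
        (∏ i : Fin d, C i.succ) * eLpNorm H p (volume.prod volume) := by
      refine eLpNorm_le_of_slice hGm hHm fun t => ?_
      have h3 := ih (S := S') (ψ := fun i => ψ i.succ) (C := fun i => C i.succ)
        (fun i m => hψ _ _) (fun i => h i.succ) fun b => ∑ a ∈ S 0, c (Fin.cons a b) * fourier a t
      refine le_trans (le_of_eq ?_) (h3.trans_eq ?_)
      · congr 1
        funext x
        simp only [G]
        rw [Finset.sum_comm]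
        refine Finset.sum_congr rfl fun b _ => ?_
        rw [Finset.sum_mul]
        exact Finset.sum_congr rfl fun a _ => by ring
      · congr 2
        funext x
        simp only [H]
        rw [Finset.sum_comm]
        refine Finset.sum_congr rfl fun b _ => ?_
        rw [Finset.sum_mul]
        exact Finset.sum_congr rfl fun a _ => by simp only [character]; ring
    calc _ ≤ C 0 * eLpNorm G p (volume.prod volume) := h1
      _ ≤ C 0 * ((∏ i : Fin d, C i.succ) * eLpNorm H p (volume.prod volume)) := by gcongr
      _ = _ := by rw [mul_assoc]

theorem summable_norm_mul {κ ι : Type*} {f : κ → ℂ} {g : ι → ℂ} (hf : Summable fun k => ‖f k‖)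
    (hg : Summable fun i => ‖g i‖) : Summable fun z : κ × ι => ‖f z.1 * g z.2‖ :=
  hf.mul_norm hg

/-- Products of absolutely convergent series, indexed by multi-indices. -/
theorem hasSum_prod_pi {d : ℕ} {a : Fin d → ℕ → ℂ} {b : Fin d → ℂ}
    (ha : ∀ i, Summable fun l => ‖a i l‖) (hb : ∀ i, HasSum (a i) (b i)) :
    (Summable fun k : Fin d → ℕ => ‖∏ i, a i (k i)‖) ∧
      HasSum (fun k : Fin d → ℕ => ∏ i, a i (k i)) (∏ i, b i) := by
  induction d with
  | zero =>
    refine ⟨(hasSum_fintype _).summable, ?_⟩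
    simp
  | succ d ih =>
    obtain ⟨h1, h2⟩ := ih (fun i => ha i.succ) fun i => hb i.succ
    have e : ∀ z : ℕ × (Fin d → ℕ), ∏ i, a i ((Fin.consEquiv fun _ : Fin (d + 1) => ℕ) z i) =
        a 0 z.1 * ∏ i : Fin d, a i.succ (z.2 i) := fun z => by
      rw [Fin.prod_univ_succ]; rfl
    have h3 := summable_norm_mul (ha 0) h1
    have h4 := (hb 0).mul h2 h3.of_norm
    constructor
    · have e' : (fun k : Fin (d + 1) → ℕ => ‖∏ i, a i (k i)‖) ∘
          (Fin.consEquiv fun _ : Fin (d + 1) => ℕ) =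
          fun z => ‖a 0 z.1 * ∏ i : Fin d, a i.succ (z.2 i)‖ :=
        funext fun z => congrArg norm (e z)
      rw [← (Fin.consEquiv fun _ : Fin (d + 1) => ℕ).summable_iff, e']
      exact h3
    · have e' : (fun k : Fin (d + 1) → ℕ => ∏ i, a i (k i)) ∘
          (Fin.consEquiv fun _ : Fin (d + 1) => ℕ) =
          fun z => a 0 z.1 * ∏ i : Fin d, a i.succ (z.2 i) := funext e
      rw [← (Fin.consEquiv fun _ : Fin (d + 1) => ℕ).hasSum_iff, e', Fin.prod_univ_succ]
      exact h4

/-! ### The dyadic blocks -/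

section Blocks

variable {φ : ℕ → ℝ → ℂ} {d : ℕ}

/-- The support conditions on a resolution of unity, at integers. -/
theorem IsResolution.eq_zero_of_notMem (hφ : IsResolution φ) {k : ℕ} {m : ℤ}
    (hm : m ∉ freqSet k) : φ k m = 0 := by
  by_contra hne
  apply hm
  have hsupp : (m : ℝ) ∈ tsupport (φ k) := subset_tsupport _ (Function.mem_support.2 hne)
  have hle : |(m : ℝ)| ≤ 2 ^ (k + 1) := by
    rcases Nat.eq_zero_or_pos k with rfl | hk
    · simpa using hφ.supp_zero hsupp
    · exact (hφ.supp_pos k hk hsupp).2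
  have hle' : |m| ≤ 2 ^ (k + 1) := by exact_mod_cast hle
  refine Finset.mem_filter.2 ⟨Finset.mem_Icc.2 (abs_le.1 hle'), ?_⟩
  rcases Nat.eq_zero_or_pos k with rfl | hk
  · exact Or.inl rfl
  · right
    have h1 := (hφ.supp_pos k hk hsupp).1
    have h2 : (2 : ℤ) ^ (k - 1) ≤ |m| := by exact_mod_cast h1
    obtain ⟨k, rfl⟩ : ∃ i, k = i + 1 := ⟨k - 1, by omega⟩
    rw [pow_succ]
    simp only [Nat.add_sub_cancel] at h2
    linarith

/-- The coefficients of the dyadic block. -/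
noncomputable def blockCoeff (φ : ℕ → ℝ → ℂ) (k : Fin d → ℕ) (f : Torus d → ℂ) (m : Fin d → ℤ) :
    ℂ := (∏ i, φ (k i) (m i)) * coeff f m

theorem blockCoeff_eq_zero (hφ : IsResolution φ) {k : Fin d → ℕ} {m : Fin d → ℤ}
    (hm : m ∉ Fintype.piFinset fun i => freqSet (k i)) (f : Torus d → ℂ) :
    blockCoeff φ k f m = 0 := by
  rw [Fintype.mem_piFinset, not_forall] at hm
  obtain ⟨i, hi⟩ := hm
  rw [blockCoeff, Finset.prod_eq_zero (Finset.mem_univ i) (hφ.eq_zero_of_notMem hi), zero_mul]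

theorem block_eq (hφ : IsResolution φ) (k : Fin d → ℕ) (f : Torus d → ℂ) :
    block φ k f = fun x => ∑ m ∈ Fintype.piFinset fun i => freqSet (k i),
      blockCoeff φ k f m * character m x := by
  funext x
  unfold block
  refine tsum_eq_sum fun m hm => ?_
  have := blockCoeff_eq_zero hφ hm f
  unfold blockCoeff at this
  rw [this, zero_mul]

theorem continuous_block (hφ : IsResolution φ) (k : Fin d → ℕ) (f : Torus d → ℂ) :
    Continuous (block φ k f) := by
  rw [block_eq hφ]
  exact continuous_finsetSum _ fun m _ => continuous_const.mul (continuous_character m)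

theorem integrable_of_continuous_torus {f : Torus d → ℂ} (hf : Continuous f) :
    Integrable f volume :=
  hf.integrable_of_hasCompactSupport (HasCompactSupport.of_compactSpace f)

theorem memLp_of_continuous_torus {f : Torus d → ℂ} (hf : Continuous f) (p : ℝ≥0∞) :
    MemLp f p volume := by
  obtain ⟨C, hC⟩ := (isCompact_range hf).isBounded.exists_norm_le
  exact MemLp.of_bound hf.aestronglyMeasurable C
    (Filter.Eventually.of_forall fun x => hC _ ⟨x, rfl⟩)

theorem norm_character (m : Fin d → ℤ) (x : Torus d) : ‖character m x‖ = 1 := by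
  unfold character
  rw [norm_prod]
  exact Finset.prod_eq_one fun i _ => norm_fourier_apply _ _

theorem coeff_character (m n : Fin d → ℤ) :
    coeff (character m) n = if m = n then 1 else 0 := by
  have hpi : ((2 * Real.pi : ℝ) : ℂ) ≠ 0 := by exact_mod_cast Real.two_pi_pos.ne'
  have h1 : ∀ x : Torus d, character m x * character (-n) x = ∏ i, fourier (m i - n i) (x i) := by
    intro x
    unfold character
    rw [← Finset.prod_mul_distrib]
    refine Finset.prod_congr rfl fun i _ => ?_
    rw [Pi.neg_apply, ← fourier_add, sub_eq_add_neg]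
  unfold coeff
  simp only [h1]
  rw [integral_fintype_prod_volume_eq_prod (fun i (t : Circ) => (fourier (m i - n i) t : ℂ))]
  simp only [integral_fourier, sub_eq_zero]
  split_ifs with h
  · subst h
    simp only [if_true, Finset.prod_const, Finset.card_univ, Fintype.card_fin]
    rw [← mul_pow, inv_mul_cancel₀ hpi, one_pow]
  · obtain ⟨i, hi⟩ := Function.ne_iff.1 h
    rw [Finset.prod_eq_zero (Finset.mem_univ i) (if_neg hi), mul_zero]

theorem coeff_sum (S : Finset (Fin d → ℤ)) (c : (Fin d → ℤ) → ℂ) (n : Fin d → ℤ) :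
    coeff (fun x => ∑ m ∈ S, c m * character m x) n = if n ∈ S then c n else 0 := by
  have h1 : coeff (fun x => ∑ m ∈ S, c m * character m x) n =
      ∑ m ∈ S, c m * coeff (character m) n := by
    unfold coeff
    simp only [Finset.sum_mul, mul_assoc]
    have hi : ∀ m ∈ S, Integrable (fun x => c m * (character m x * character (-n) x)) volume :=
      fun m _ => (integrable_of_continuous_torus
        ((continuous_character m).mul (continuous_character (-n)))).const_mul _
    rw [integral_finsetSum _ hi, Finset.mul_sum]
    refine Finset.sum_congr rfl fun m _ => ?_
    rw [integral_const_mul]; ring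
  rw [h1]
  simp only [coeff_character, mul_ite, mul_one, mul_zero]
  rw [Finset.sum_ite_eq']

theorem coeff_block (hφ : IsResolution φ) (k : Fin d → ℕ) (f : Torus d → ℂ) (n : Fin d → ℤ) :
    coeff (block φ k f) n = blockCoeff φ k f n := by
  rw [block_eq hφ, coeff_sum]
  split_ifs with h
  · rfl
  · exact (blockCoeff_eq_zero hφ h f).symm

theorem IsResolution.summable_norm (hφ : IsResolution φ) (m : ℤ) :
    Summable fun k => ‖φ k m‖ := by
  refine summable_of_hasFiniteSupport (Set.Finite.subset (Set.finite_le_nat (m.natAbs + 1)) ?_)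
  intro k hk
  rw [Function.mem_support, norm_ne_zero_iff] at hk
  have hm : m ∈ freqSet k := by
    by_contra h; exact hk (hφ.eq_zero_of_notMem h)
  rcases (Finset.mem_filter.1 hm).2 with h | h
  · simp [h]
  · have h1 : 2 ^ k ≤ 2 * m.natAbs := by
      rw [Int.abs_eq_natAbs] at h; exact_mod_cast h
    by_contra hlt
    simp only [Set.mem_ofPred_eq, not_le] at hlt
    obtain ⟨k, rfl⟩ : ∃ i, k = i + 1 := ⟨k - 1, by omega⟩
    have h2 : k < 2 ^ k := Nat.lt_two_pow_self
    rw [pow_succ] at h1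
    omega

theorem hasSum_blockCoeff (hφ : IsResolution φ) (f : Torus d → ℂ) (m : Fin d → ℤ) :
    HasSum (fun k => blockCoeff φ k f m) (coeff f m) := by
  have h := (hasSum_prod_pi (a := fun i k => φ k (m i)) (b := fun _ : Fin d => 1)
    (fun i => hφ.summable_norm (m i)) fun i => hφ.sum_eq_one _).2
  simpa [blockCoeff] using h.mul_right (coeff f m)

theorem measure_rpow_ne_top {X : Type*} [MeasurableSpace X] {μ : Measure X} [IsFiniteMeasure μ]
    {p q : ℝ≥0∞} (hq : 1 ≤ q) (hqp : q ≤ p) :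
    μ Set.univ ^ (1 / q.toReal - 1 / p.toReal) ≠ ∞ := by
  refine ENNReal.rpow_ne_top_of_nonneg ?_ (measure_ne_top _ _)
  rw [sub_nonneg]
  rcases eq_or_ne p ∞ with rfl | hpt
  · simp
  · have hqt : q ≠ ∞ := ne_top_of_le_ne_top hpt hqp
    exact one_div_le_one_div_of_le (ENNReal.toReal_pos (zero_lt_one.trans_le hq).ne' hqt)
      (ENNReal.toReal_mono hpt hqp)

/-- A series that converges absolutely in `L_p` converges absolutely almost everywhere. -/
theorem ae_summable_norm {ι X : Type*} [Countable ι] [MeasurableSpace X] {μ : Measure X}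
    [IsFiniteMeasure μ] {p : ℝ≥0∞} (hp : 1 ≤ p) {b : ι → X → ℂ} (hb : ∀ k, Measurable (b k))
    (h : ∑' k, eLpNorm (b k) p μ ≠ ∞) :
    eLpNorm (fun x => ∑' k, ‖b k x‖ₑ) p μ < ∞ ∧ ∀ᵐ x ∂μ, Summable fun k => ‖b k x‖ := by
  have h1 : eLpNorm (fun x => ∑' k, ‖b k x‖ₑ) p μ < ∞ := by
    refine (eLpNorm_tsum_le hp fun k => (hb k).enorm).trans_lt ?_
    simp only [eLpNorm_enorm']
    exact h.lt_top
  refine ⟨h1, ?_⟩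
  have hm : Measurable fun x => ∑' k, ‖b k x‖ₑ := Measurable.tsum fun k => (hb k).enorm
  have h2 := eLpNorm_le_eLpNorm_mul_rpow_measure_univ hp (μ := μ) hm.aestronglyMeasurable
  have h3 : eLpNorm (fun x => ∑' k, ‖b k x‖ₑ) 1 μ < ∞ := by
    exact h2.trans_lt (ENNReal.mul_lt_top h1 (measure_rpow_ne_top le_rfl hp).lt_top)
  rw [eLpNorm_one_eq_lintegral_enorm] at h3
  simp only [enorm_eq_self] at h3
  filter_upwards [ae_lt_top hm h3.ne] with x hx
  simpa using ENNReal.summable_toReal hx.ne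

/-- A function whose dyadic blocks are absolutely summable in `L_p` is the sum of the blocks. -/
theorem ae_eq_tsum_block (hφ : IsResolution φ) {p : ℝ≥0∞} (hp : 1 ≤ p) {f : Torus d → ℂ}
    (hf : Integrable f volume) (h : ∑' k, eLpNorm (block φ k f) p volume ≠ ∞) :
    MemLp f p volume ∧ f =ᵐ[volume] fun x => ∑' k, block φ k f x := by
  set b := fun k => block φ k f
  have hbc : ∀ k, Continuous (b k) := fun k => continuous_block hφ k f
  obtain ⟨h1, h2⟩ := ae_summable_norm hp (fun k => (hbc k).measurable) h
  have hgm : AEStronglyMeasurable (fun x => ∑' k, b k x) volume := by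
    refine aestronglyMeasurable_of_tendsto_ae (Filter.atTop : Filter (Finset (Fin d → ℕ)))
      (f := fun s x => ∑ k ∈ s, b k x) (fun s => (continuous_finsetSum _ fun k _ =>
        hbc k).aestronglyMeasurable) ?_
    filter_upwards [h2] with x hx
    exact hx.of_norm.hasSum
  have hg : MemLp (fun x => ∑' k, b k x) p volume := by
    refine ⟨hgm, lt_of_le_of_lt (eLpNorm_mono_enorm fun x => ?_) h1⟩
    rw [enorm_eq_self]
    exact enorm_tsum_le_tsum_enorm
  have hL1 : Summable fun k => ∫ x, ‖b k x‖ := by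
    have h3 : ∑' k, eLpNorm (b k) 1 (volume : Measure (Torus d)) ≠ ∞ := by
      refine ne_top_of_le_ne_top ?_ (ENNReal.tsum_le_tsum fun k =>
        eLpNorm_le_eLpNorm_mul_rpow_measure_univ hp (hbc k).aestronglyMeasurable)
      rw [ENNReal.tsum_mul_right]
      exact ENNReal.mul_ne_top h (measure_rpow_ne_top le_rfl hp)
    have h4 := ENNReal.summable_toReal h3
    refine h4.congr fun k => ?_
    rw [eLpNorm_one_eq_lintegral_enorm, integral_norm_eq_lintegral_enorm
      (hbc k).aestronglyMeasurable]
  have hae : f =ᵐ[volume] fun x => ∑' k, b k x := by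
    refine ae_eq_of_coeff_eq hf (hg.integrable hp) fun n => ?_
    have h5 := hasSum_integral_of_summable_integral_norm (μ := (volume : Measure (Torus d)))
      (F := fun k x => b k x * character (-n) x)
      (fun k => integrable_of_continuous_torus ((hbc k).mul (continuous_character _)))
      (by simpa only [norm_mul, norm_character, mul_one] using hL1)
    have h6 := h5.mul_left (((2 * Real.pi : ℝ) : ℂ)⁻¹ ^ d)
    have h7 : HasSum (fun k => blockCoeff φ k f n) (coeff (fun x => ∑' k, b k x) n) := by
      have e : ∀ k, blockCoeff φ k f n = ((2 * Real.pi : ℝ) : ℂ)⁻¹ ^ d *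
          ∫ x, b k x * character (-n) x := fun k => (coeff_block hφ k f n).symm
      simp only [e]
      unfold coeff
      simpa only [tsum_mul_right] using h6
    exact (hasSum_blockCoeff hφ f n).unique h7
  exact ⟨hg.ae_eq hae.symm, hae⟩

end Blocks

/-! ### The increments of the Smolyak algorithm on dyadic blocks -/

section Increments

variable {φ : ℕ → ℝ → ℂ} {d : ℕ} {p p' : ℝ≥0∞} {s : ℝ} {Y : ℕ → (Circ → ℂ) → Circ → ℂ}
  {D : ℕ → Circ → Circ → ℂ} {C : ℝ≥0∞}

/-- The increment with index `j` of the dyadic block with index `k` of `f`. -/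
noncomputable def blockIncrement (Y : ℕ → (Circ → ℂ) → Circ → ℂ) (φ : ℕ → ℝ → ℂ) (f : Torus d → ℂ)
    (j k : Fin d → ℕ) (x : Torus d) : ℂ :=
  ∑ m ∈ Fintype.piFinset fun i => freqSet (k i),
    blockCoeff φ k f m * ∏ i, increment Y (j i) (fourier (m i)) (x i)

theorem IsDyadicScheme.continuous (hY : IsDyadicScheme p p' s Y D C) (j : ℕ) (m : ℤ) :
    Continuous (increment Y j (fourier m)) := (hY.reproduced j m).1

theorem continuous_blockIncrement (hY : IsDyadicScheme p p' s Y D C) (f : Torus d → ℂ)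
    (j k : Fin d → ℕ) : Continuous (blockIncrement Y φ f j k) :=
  continuous_finsetSum _ fun _ _ => continuous_const.mul (continuous_finsetProd _ fun i _ =>
    (hY.continuous _ _).comp (continuous_apply i))

/-- `blockIncrement` is the image of the block under the product kernel. -/
theorem integral_block_mul (hpp' : 1 / p + 1 / p' = 1) (hY : IsDyadicScheme p p' s Y D C)
    (hφ : IsResolution φ) (f : Torus d → ℂ) (j k : Fin d → ℕ) (x : Torus d) :
    ∫ t, block φ k f t * ∏ i, D (j i) (x i) (t i) = blockIncrement Y φ f j k x := by
  have hP : MemLp (fun t : Torus d => ∏ i, D (j i) (x i) (t i)) p' volume :=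
    memLp_prod_pi fun i => hY.memLp _ _
  have hi : ∀ m ∈ Fintype.piFinset fun i => freqSet (k i), Integrable (fun t =>
      blockCoeff φ k f m * (character m t * ∏ i, D (j i) (x i) (t i))) volume := fun m _ =>
    (integrable_mul_of_memLp hpp' (memLp_of_continuous_torus (continuous_character m) p)
      hP).const_mul _
  rw [block_eq hφ]
  simp only [Finset.sum_mul, mul_assoc]
  rw [integral_finsetSum _ hi]
  refine Finset.sum_congr rfl fun m _ => ?_
  rw [integral_const_mul]
  congr 1
  simp only [character, ← Finset.prod_mul_distrib]
  rw [integral_fintype_prod_volume_eq_prod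
    (fun i (t : Circ) => (fourier (m i) t * D (j i) (x i) t : ℂ))]
  refine Finset.prod_congr rfl fun i _ => ?_
  exact (hY.increment_eq _ _ _ fun g hg =>
    integrable_mul_of_memLp hpp' (memLp_of_continuous (fourier (m i)).continuous p) hg).symm

theorem eLpNorm_blockIncrement_le (hY : IsDyadicScheme p p' s Y D C) (hφ : IsResolution φ)
    (f : Torus d → ℂ) (j k : Fin d → ℕ) :
    eLpNorm (blockIncrement Y φ f j k) p volume ≤
      (∏ i, C * 2 ^ (-(s * ((j i - k i : ℕ) : ℝ)))) * eLpNorm (block φ k f) p volume := by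
  rw [block_eq hφ]
  exact eLpNorm_tensor_le (S := fun i => freqSet (k i))
    (ψ := fun i m => increment Y (j i) (fourier m)) (fun i m => hY.continuous _ _)
    (fun i c => hY.eLpNorm_le (j i) (k i) c) _

/-- The increments of a dyadic block sum up to the block. -/
theorem hasSum_blockIncrement (hY : IsDyadicScheme p p' s Y D C) (hφ : IsResolution φ)
    (f : Torus d → ℂ) (k : Fin d → ℕ) (x : Torus d) :
    HasSum (fun j => blockIncrement Y φ f j k x) (block φ k f x) := by
  rw [block_eq hφ]
  refine hasSum_sum fun m _ => HasSum.mul_left _ ?_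
  exact (hasSum_prod_pi (a := fun i l => increment Y l (fourier (m i)) (x i))
    (fun i => hY.summable _ _) fun i => hY.hasSum _ _).2

/-- The increments of `f` are the sums of the increments of its dyadic blocks. -/
theorem hasSum_tensorIncrement (hp : 1 ≤ p) (hpp' : 1 / p + 1 / p' = 1)
    (hY : IsDyadicScheme p p' s Y D C)
    (hφ : IsResolution φ) {f : Torus d → ℂ} (hf : Integrable f volume)
    (h : ∑' k, eLpNorm (block φ k f) p volume ≠ ∞) (j : Fin d → ℕ) (x : Torus d) :
    HasSum (fun k => blockIncrement Y φ f j k x) (tensorIncrement Y j f x) := by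
  obtain ⟨hfp, hae⟩ := ae_eq_tsum_block hφ hp hf h
  rw [tensorIncrement_eq_integral hpp' hY j hfp]
  set P : Torus d → ℂ := fun t => ∏ i, D (j i) (x i) (t i)
  have hP : MemLp P p' volume := memLp_prod_pi fun i => hY.memLp _ _
  have hi : ∀ k, Integrable (fun t => block φ k f t * P t) volume := fun k =>
    integrable_mul_of_memLp hpp' (memLp_of_continuous_torus (continuous_block hφ k f) p) hP
  have hs : Summable fun k => ∫ t, ‖block φ k f t * P t‖ := by
    have h1 : ∀ k, ∫⁻ t, ‖block φ k f t * P t‖ₑ ≤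
        eLpNorm (block φ k f) p volume * eLpNorm P p' volume := by
      intro k
      have := holderTriple_one hpp'
      have h2 := eLpNorm_smul_le_mul_eLpNorm (p := p) (q := p') (r := 1) hP.1
        (continuous_block hφ k f).aestronglyMeasurable (μ := volume)
      rw [eLpNorm_one_eq_lintegral_enorm] at h2
      exact h2
    have h2 : ∑' k, ∫⁻ t, ‖block φ k f t * P t‖ₑ ≠ ∞ := by
      refine ne_top_of_le_ne_top ?_ (ENNReal.tsum_le_tsum h1)
      rw [ENNReal.tsum_mul_right]
      exact ENNReal.mul_ne_top h hP.2.ne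
    refine (ENNReal.summable_toReal h2).congr fun k => ?_
    rw [integral_norm_eq_lintegral_enorm (hi k).1]
  have h3 := hasSum_integral_of_summable_integral_norm hi hs
  have h4 : ∫ t, f t * P t = ∫ t, ∑' k, block φ k f t * P t := by
    refine integral_congr_ae ?_
    filter_upwards [hae] with t ht
    rw [ht, tsum_mul_right]
  rw [h4]
  simpa only [P, integral_block_mul hpp' hY hφ] using h3

/-- The sum over all dyadic blocks of the absolute values of the increments with index `j`. -/
noncomputable def incrementMajorant (Y : ℕ → (Circ → ℂ) → Circ → ℂ) (φ : ℕ → ℝ → ℂ)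
    (f : Torus d → ℂ) (j : Fin d → ℕ) (x : Torus d) : ℝ≥0∞ :=
  ∑' k, ‖blockIncrement Y φ f j k x‖ₑ

theorem measurable_incrementMajorant (hY : IsDyadicScheme p p' s Y D C) (f : Torus d → ℂ)
    (j : Fin d → ℕ) : Measurable (incrementMajorant Y φ f j) :=
  Measurable.tsum fun k => (continuous_blockIncrement hY f j k).measurable.enorm

/-- The increments with index `j` are trigonometric polynomials of degree at most `2^{j_i}` in
the variable `x_i`, hence reproduced by a tensor product kernel. -/
theorem incrementMajorant_le (hY : IsDyadicScheme p p' s Y D C) (f : Torus d → ℂ)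
    (j : Fin d → ℕ) (x : Torus d) :
    incrementMajorant Y φ f j x ≤
      ∫⁻ t, (∏ i, fejerKernel (2 ^ j i) (x i) (t i)) * incrementMajorant Y φ f j t := by
  have hK : Measurable fun t : Torus d => ∏ i, fejerKernel (2 ^ j i) (x i) (t i) :=
    Finset.measurable_prod _ fun i _ =>
      (Measurable.of_uncurry_left (measurable_fejerKernel (2 ^ j i))).comp (measurable_pi_apply i)
  unfold incrementMajorant
  simp only [← ENNReal.tsum_mul_left]
  have hKm : ∀ k, AEMeasurable (fun t : Torus d => (∏ i, fejerKernel (2 ^ j i) (x i) (t i)) *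
      ‖blockIncrement Y φ f j k t‖ₑ) volume := fun k =>
    (hK.mul (continuous_blockIncrement hY f j k).measurable.enorm).aemeasurable
  rw [lintegral_tsum hKm]
  refine ENNReal.tsum_le_tsum fun k => ?_
  have hrep : blockIncrement Y φ f j k x =
      ∫ t, (∏ i, reproKernel (2 ^ j i) (x i - t i)) * blockIncrement Y φ f j k t := by
    have hR : Continuous fun t : Torus d => ∏ i, reproKernel (2 ^ j i) (x i - t i) :=
      continuous_finsetProd _ fun i _ => (continuous_reproKernel _).comp
        (continuous_const.sub (continuous_apply i))
    have hi : ∀ m ∈ Fintype.piFinset fun i => freqSet (k i), Integrable (fun t : Torus d =>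
        blockCoeff φ k f m * ((∏ i, reproKernel (2 ^ j i) (x i - t i)) *
          ∏ i, increment Y (j i) (fourier (m i)) (t i))) volume := fun m _ =>
      (integrable_of_continuous_torus (hR.mul (continuous_finsetProd _ fun i _ =>
        (hY.continuous _ _).comp (continuous_apply i)))).const_mul _
    unfold blockIncrement
    simp only [Finset.mul_sum, mul_left_comm _ (blockCoeff _ _ _ _)]
    rw [integral_finsetSum _ hi]
    refine Finset.sum_congr rfl fun m _ => ?_
    rw [integral_const_mul]
    congr 1
    simp only [← Finset.prod_mul_distrib]
    rw [integral_fintype_prod_volume_eq_prod (fun i (t : Circ) =>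
      (reproKernel (2 ^ j i) (x i - t) * increment Y (j i) (fourier (m i)) t : ℂ))]
    exact Finset.prod_congr rfl fun i _ => ((hY.reproduced (j i) (m i)).2 (x i)).symm
  rw [hrep]
  refine (enorm_integral_le_lintegral_enorm _).trans (lintegral_mono fun t => ?_)
  rw [enorm_mul, ← ofReal_norm (∏ i, _), norm_prod,
    ENNReal.ofReal_prod_of_nonneg fun _ _ => norm_nonneg _]
  gcongr with i
  rw [ofReal_norm]
  exact enorm_reproKernel_le _ _ _

/-- The majorants inherit the Besov regularity of `f`: `2^{r|j|₁}` times their `L_p`-norms form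
an `ℓ_θ`-sequence `a`.  The decay `2^{-s(j_i - k_i)_+}` of the increments of the `k`-th block,
weighted by `2^{r(j_i - k_i)}`, is the decay matrix. -/
theorem exists_eLpNorm_incrementMajorant_le (hp : 1 ≤ p)
    (hY : IsDyadicScheme p p' s Y D C) (hφ : IsResolution φ) {r : ℝ} (hr : 0 < r) (hrs : r < s)
    {θ : ℝ≥0∞} (hθ : 1 ≤ θ) (d : ℕ) :
    ∃ C' : ℝ≥0∞, C' ≠ ∞ ∧ ∀ f : Torus d → ℂ, ∃ a : (Fin d → ℕ) → ℝ≥0∞,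
      ellNorm θ a ≤ C' * besovNorm φ r p θ f ∧
      ∀ j, eLpNorm (incrementMajorant Y φ f j) p volume ≤ C ^ d * (2 ^ (-(r * norm1 j)) * a j) := by
  obtain ⟨C', hC', h⟩ := ellNorm_decay_le d hr hrs hθ
  refine ⟨C', hC', fun f => ⟨fun j => ∑' k, (∏ i, decay s r (j i) (k i)) *
    (ENNReal.ofReal ((2 : ℝ) ^ (r * (norm1 k : ℝ))) * eLpNorm (block φ k f) p volume),
    h _, fun j => ?_⟩⟩
  refine (eLpNorm_tsum_le hp fun k =>
    (continuous_blockIncrement hY f j k).measurable.enorm).trans ?_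
  simp only [eLpNorm_enorm']
  rw [← ENNReal.tsum_mul_left, ← ENNReal.tsum_mul_left]
  refine ENNReal.tsum_le_tsum fun k => (eLpNorm_blockIncrement_le hY hφ f j k).trans_eq ?_
  have h2 : ENNReal.ofReal ((2 : ℝ) ^ (r * (norm1 k : ℝ))) = ∏ i, (2 : ℝ≥0∞) ^ (r * (k i : ℝ)) := by
    rw [← ENNReal.ofReal_rpow_of_pos (by norm_num)]
    have := two_rpow_norm1 (-r) k
    simpa using this
  rw [h2, two_rpow_norm1, Finset.prod_mul_distrib, Finset.prod_const, Finset.card_univ,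
    Fintype.card_fin, mul_assoc]
  congr 1
  rw [← mul_assoc, ← mul_assoc, ← Finset.prod_mul_distrib, ← Finset.prod_mul_distrib]
  congr 1
  refine Finset.prod_congr rfl fun i _ => ?_
  unfold decay
  rw [← two_rpow_add, ← two_rpow_add]
  congr 1; ring

theorem mem_smolyak_index {n : ℕ} {j : Fin d → ℕ} :
    j ∈ (Fintype.piFinset fun _ : Fin d => Finset.range (n + 1)).filter (fun j => norm1 j ≤ n) ↔
      norm1 j ≤ n := by
  rw [Finset.mem_filter, and_iff_right_of_imp]
  intro h
  rw [Fintype.mem_piFinset]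
  intro i
  have : j i ≤ norm1 j := Finset.single_le_sum (fun _ _ => Nat.zero_le _) (Finset.mem_univ i)
  rw [Finset.mem_range]; omega

/-- Almost everywhere, the error of the Smolyak algorithm is at most the sum of the majorants of
the increments that the algorithm leaves out. -/
theorem ae_enorm_sub_smolyak_le (hp : 1 ≤ p) (hpp' : 1 / p + 1 / p' = 1)
    (hY : IsDyadicScheme p p' s Y D C) (hφ : IsResolution φ) {f : Torus d → ℂ}
    (hf : Integrable f volume) (h : ∑' k, eLpNorm (block φ k f) p volume ≠ ∞)
    (hsum : ∑' j, eLpNorm (incrementMajorant Y φ f j) p volume ≠ ∞) (n : ℕ) :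
    ∀ᵐ x, ‖(f - smolyak Y n f) x‖ₑ ≤
      ∑' j, if n < norm1 j then incrementMajorant Y φ f j x else 0 := by
  obtain ⟨hfp, hae⟩ := ae_eq_tsum_block hφ hp hf h
  have hm : Measurable fun x => ∑' j, incrementMajorant Y φ f j x :=
    Measurable.tsum fun j => measurable_incrementMajorant hY f j
  have hfin : ∀ᵐ x : Torus d, ∑' j, incrementMajorant Y φ f j x < ∞ := by
    have h1 : eLpNorm (fun x => ∑' j, incrementMajorant Y φ f j x) p volume < ∞ :=
      (eLpNorm_tsum_le hp fun j => measurable_incrementMajorant hY f j).trans_lt hsum.lt_top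
    have h2 := (eLpNorm_le_eLpNorm_mul_rpow_measure_univ hp
      (μ := (volume : Measure (Torus d))) hm.aestronglyMeasurable).trans_lt
      (ENNReal.mul_lt_top h1 (measure_rpow_ne_top le_rfl hp).lt_top)
    rw [eLpNorm_one_eq_lintegral_enorm] at h2
    simp only [enorm_eq_self] at h2
    exact ae_lt_top hm h2.ne
  filter_upwards [hae, hfin] with x hx hx2
  have hs2 : Summable fun z : (Fin d → ℕ) × (Fin d → ℕ) =>
      blockIncrement Y φ f z.1 z.2 x := by
    refine Summable.of_norm ?_
    have h3 : ∑' z : (Fin d → ℕ) × (Fin d → ℕ), ‖blockIncrement Y φ f z.1 z.2 x‖ₑ ≠ ∞ := by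
      rw [ENNReal.tsum_prod']; exact hx2.ne
    simpa using ENNReal.summable_toReal h3
  have hsj : HasSum (fun j => tensorIncrement Y j f x) (f x) := by
    have h4 := hs2.hasSum.prod_fiberwise fun j =>
      hasSum_tensorIncrement hp hpp' hY hφ hf h j x
    have h5 := hs2.prod_symm.hasSum.prod_fiberwise fun k => hasSum_blockIncrement hY hφ f k x
    have h6 : f x = ∑' z : (Fin d → ℕ) × (Fin d → ℕ), blockIncrement Y φ f z.1 z.2 x := by
      rw [hx, h5.tsum_eq, ← (Equiv.prodComm _ _).tsum_eq]
      rfl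
    rwa [h6]
  have hle : ∀ j, ‖tensorIncrement Y j f x‖ₑ ≤ incrementMajorant Y φ f j x := fun j => by
    rw [← (hasSum_tensorIncrement hp hpp' hY hφ hf h j x).tsum_eq]
    exact enorm_tsum_le_tsum_enorm
  have htail : HasSum (fun j => if n < norm1 j then tensorIncrement Y j f x else 0)
      ((f - smolyak Y n f) x) := by
    set I := (Fintype.piFinset fun _ : Fin d => Finset.range (n + 1)).filter (fun j => norm1 j ≤ n)
    have h7 : HasSum (fun j => if j ∈ I then tensorIncrement Y j f x else 0)
        (∑ j ∈ I, tensorIncrement Y j f x) := by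
      have h8 : HasSum (fun j => if j ∈ I then tensorIncrement Y j f x else 0)
          (∑ j ∈ I, if j ∈ I then tensorIncrement Y j f x else 0) :=
        hasSum_sum_of_ne_finset_zero fun j hj => if_neg hj
      rwa [Finset.sum_congr rfl fun j hj => if_pos hj] at h8
    have h9 := hsj.sub h7
    have e1 : (f - smolyak Y n f) x = f x - ∑ j ∈ I, tensorIncrement Y j f x := by
      rw [Pi.sub_apply]
      unfold smolyak
      rw [Finset.sum_apply]
    rw [e1]
    have e2 : (fun j => if n < norm1 j then tensorIncrement Y j f x else 0) = fun j =>
        tensorIncrement Y j f x - if j ∈ I then tensorIncrement Y j f x else 0 := by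
      funext j
      by_cases hj : norm1 j ≤ n
      · rw [if_neg (not_lt.2 hj), if_pos (mem_smolyak_index.2 hj), sub_self]
      · rw [if_pos (not_le.1 hj), if_neg fun h => hj (mem_smolyak_index.1 h), sub_zero]
    rwa [e2]
  rw [← htail.tsum_eq]
  refine enorm_tsum_le_tsum_enorm.trans (ENNReal.tsum_le_tsum fun j => ?_)
  split_ifs
  · exact hle j
  · simp

end Increments

/-! ### Summation of the increments -/

/-- The tensor product of the kernels that dominate reproduction. -/
noncomputable def torusKernel {d : ℕ} (j : Fin d → ℕ) (x t : Torus d) : ℝ≥0∞ :=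
  ∏ i, fejerKernel (2 ^ j i) (x i) (t i)

theorem measurable_fejerKernel_coord {d : ℕ} (N : ℕ) (i : Fin d) :
    Measurable fun z : Torus d × Torus d => fejerKernel N (z.1 i) (z.2 i) := by
  have h : Measurable fun z : Torus d × Torus d => (z.1 i, z.2 i) :=
    ((measurable_pi_apply i).comp measurable_fst).prodMk
      ((measurable_pi_apply i).comp measurable_snd)
  simpa only [Function.comp_def, Function.uncurry_apply_pair] using
    (measurable_fejerKernel N).comp h

theorem measurable_torusKernel {d : ℕ} (j : Fin d → ℕ) :
    Measurable (Function.uncurry (torusKernel j)) := by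
  simp only [Function.uncurry_def, torusKernel]
  exact Finset.measurable_prod _ fun i _ => measurable_fejerKernel_coord (2 ^ j i) i

theorem lintegral_torusKernel {d : ℕ} (j : Fin d → ℕ) (x : Torus d) :
    ∫⁻ t, torusKernel j x t = 4 ^ d := by
  induction d with
  | zero => simp [torusKernel, volume_pi]
  | succ d ih =>
    obtain ⟨a, x, rfl⟩ : ∃ a y, x = (Fin.cons a y : Torus (d + 1)) :=
      ⟨x 0, Fin.tail x, (Fin.cons_self_tail x).symm⟩
    rw [lintegral_torus_succ]
    simp only [torusKernel, Fin.prod_univ_succ, Fin.cons_zero, Fin.cons_succ]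
    have h1 : Measurable fun t => fejerKernel (2 ^ j 0) a t :=
      Measurable.of_uncurry_left (measurable_fejerKernel (2 ^ j 0))
    have h2 : Measurable fun t => torusKernel (fun i : Fin d => j i.succ) x t :=
      Measurable.of_uncurry_left (measurable_torusKernel _)
    have h3 := lintegral_prod_mul (μ := (volume : Measure Circ))
      (ν := (volume : Measure (Torus d))) h1.aemeasurable h2.aemeasurable
    rw [ih, lintegral_fejerKernel_right Nat.one_le_two_pow] at h3
    rw [pow_succ', ← h3]
    rfl

theorem torusKernel_le {d : ℕ} (j : Fin d → ℕ) (x t : Torus d) :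
    torusKernel j x t ≤ 2 ^ ((norm1 j : ℕ) : ℝ) := by
  rw [ENNReal.rpow_natCast, norm1, ← Finset.prod_pow_eq_pow_sum]
  refine Finset.prod_le_prod' fun i _ => (fejerKernel_le _ _ _).trans ?_
  push_cast; exact le_rfl

/-- The embedding `B^{1/p-1/q}_{p,q}(𝕋ᵈ) ⊂ L_q(𝕋ᵈ)`, from the univariate one by tensor products. -/
theorem kernelEmbedding_torus {p q : ℝ} (hp : 1 ≤ p) (hpq : p < q) (d : ℕ) :
    ∃ C : ℝ≥0∞, C ≠ ∞ ∧ KernelEmbedding (volume : Measure (Torus d)) torusKernel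
      (fun j => ∏ i, (2 : ℝ≥0∞) ^ ((j i : ℝ) * (1 / p - 1 / q))) p q C := by
  have hq : 0 < q := by linarith
  have hp0 : 0 < p := by linarith
  obtain ⟨C₁, hC₁, h1⟩ := kernelEmbedding_fejer hp hpq
  induction d with
  | zero =>
    refine ⟨1, by simp, fun h hh => ?_⟩
    simp only [lintegral_unique, tsum_fintype, Finset.univ_unique, Finset.sum_singleton,
      torusKernel, Finset.univ_eq_empty, Finset.prod_empty, one_mul]
    simp only [volume_pi, Measure.pi_empty_univ, mul_one]
    rw [← ENNReal.rpow_mul, ← ENNReal.rpow_mul, ← mul_assoc, mul_one_div_cancel hp0.ne', one_mul]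
  | succ d ih =>
    obtain ⟨C₂, hC₂, h2⟩ := ih
    have hprod := h1.prod (fun j => measurable_fejerKernel (2 ^ j)) measurable_torusKernel hp hq h2
    refine ⟨C₁ * C₂, ENNReal.mul_ne_top hC₁ hC₂, fun h hh => ?_⟩
    have h3 := hprod (fun z t => h (Fin.cons z.1 z.2) (Fin.cons t.1 t.2)) fun z => by
      have := (hh (Fin.cons z.1 z.2)).comp (consEquiv d).measurable
      simpa only [Function.comp_def, consEquiv_apply] using this
    have hk : ∀ (z : ℕ × (Fin d → ℕ)) (x t : Circ × Torus d),
        torusKernel (Fin.cons z.1 z.2 : Fin (d + 1) → ℕ) (Fin.cons x.1 x.2 : Torus (d + 1))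
          (Fin.cons t.1 t.2 : Torus (d + 1)) =
        fejerKernel (2 ^ z.1) x.1 t.1 * torusKernel z.2 x.2 t.2 := fun z x t => by
      simp only [torusKernel, Fin.prod_univ_succ, Fin.cons_zero, Fin.cons_succ]
    have ht : ∀ g : (Fin (d + 1) → ℕ) → ℝ≥0∞, ∑' j, g j =
        ∑' z : ℕ × (Fin d → ℕ), g (Fin.cons z.1 z.2) := fun g => by
      rw [tsum_fin_succ, ENNReal.tsum_prod']
    rw [lintegral_torus_succ]
    simp only [ht, lintegral_torus_succ, hk, Fin.prod_univ_succ, Fin.cons_zero, Fin.cons_succ]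
    exact h3

theorem prod_two_rpow {d : ℕ} (ε : ℝ) (j : Fin d → ℕ) :
    ∏ i, (2 : ℝ≥0∞) ^ ((j i : ℝ) * ε) = 2 ^ (ε * norm1 j) := by
  have h := two_rpow_norm1 (-ε) j
  simp only [neg_mul, neg_neg] at h
  rw [h]
  exact Finset.prod_congr rfl fun i _ => by rw [mul_comm]

theorem ofReal_two_rpow_mul_rpow {n : ℕ} (hn : 1 ≤ n) (x y : ℝ) :
    ENNReal.ofReal ((2 : ℝ) ^ x * (n : ℝ) ^ y) = 2 ^ x * (n : ℝ≥0∞) ^ y := by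
  have hn' : (0 : ℝ) < n := by exact_mod_cast hn
  rw [ENNReal.ofReal_mul (by positivity), ← ENNReal.ofReal_rpow_of_pos (by norm_num),
    ← ENNReal.ofReal_rpow_of_pos hn']
  simp

theorem toReal_one_div_le_one {θ : ℝ≥0∞} (hθ : 1 ≤ θ) : (1 / θ).toReal ≤ 1 := by
  rw [← ENNReal.toReal_one]
  refine ENNReal.toReal_mono ENNReal.one_ne_top ?_
  simpa using hθ

theorem toReal_one_div (p : ℝ≥0∞) : (1 / p).toReal = 1 / p.toReal := by
  rw [one_div, ENNReal.toReal_inv, one_div]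

/-- Bounds for the sum of a family `h_j` of nonnegative functions over `|j|₁ > n`, from bounds for
`‖h_j‖_p` and the property that `h_j` is dominated by its image under a kernel of degree `2^{j_i}`
in the variable `x_i`.  The three regimes of the rate use the triangle inequality in `L_p`
(`q ≤ p`), the Nikolskii inequality (`q = ∞`), and the embedding for kernels (`p < q < ∞`). -/
theorem exists_eLpNorm_tsum_tail_le (d : ℕ) {p q θ : ℝ≥0∞} (hp : 1 ≤ p) (hq : 1 ≤ q) (hθ : 1 ≤ θ)
    {r : ℝ} (hr : max ((1 / p).toReal - (1 / q).toReal) 0 < r) :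
    ∃ C : ℝ≥0∞, C ≠ ∞ ∧ ∀ (h : (Fin (d + 1) → ℕ) → Torus (d + 1) → ℝ≥0∞)
      (a : (Fin (d + 1) → ℕ) → ℝ≥0∞) (M : ℝ≥0∞), (∀ j, Measurable (h j)) →
      (∀ j x, h j x ≤ ∫⁻ t, torusKernel j x t * h j t) →
      (∀ j, eLpNorm (h j) p volume ≤ M * (2 ^ (-(r * norm1 j)) * a j)) → ∀ n : ℕ, 1 ≤ n →
      eLpNorm (fun x => ∑' j, if n < norm1 j then h j x else 0) q volume ≤
        C * ENNReal.ofReal (rate (d + 1) p q θ r n) * (M * ellNorm θ a) := by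
  have hr0 : 0 < r := (le_max_right _ _).trans_lt hr
  have hcast : ((d + 1 : ℕ) : ℝ) - 1 = d := by push_cast; ring
  have hmax : max ((1 / (1 : ℝ≥0∞)).toReal - (1 / θ).toReal) 0 = 1 - (1 / θ).toReal := by
    rw [div_one, ENNReal.toReal_one, max_eq_left (sub_nonneg.2 (toReal_one_div_le_one hθ))]
  have hg : ∀ (h : (Fin (d + 1) → ℕ) → Torus (d + 1) → ℝ≥0∞) (n : ℕ), (∀ j, Measurable (h j)) →
      ∀ j, Measurable fun x => if n < norm1 j then h j x else 0 := fun h n hm j => by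
    split_ifs
    · exact hm j
    · exact measurable_const
  -- the bound for a sum of the norms
  have hone : ∀ ε : ℝ, 0 < ε → ∃ C : ℝ≥0∞, C ≠ ∞ ∧ ∀ n : ℕ, 1 ≤ n →
      ∀ a : (Fin (d + 1) → ℕ) → ℝ≥0∞,
      ∑' j, (if n < norm1 j then (2 : ℝ≥0∞) ^ (-(ε * norm1 j)) * a j else 0) ≤
        C * (2 ^ (-(ε * n)) * (n : ℝ≥0∞) ^ ((d : ℝ) * (1 - (1 / θ).toReal))) * ellNorm θ a := by
    intro ε hε
    obtain ⟨C, hC, h⟩ := eLpNorm_tail_le d hε le_rfl ENNReal.one_ne_top hθ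
    refine ⟨C, hC, fun n hn a => ?_⟩
    have h1 := h n hn a
    rw [eLpNorm_one_eq_lintegral_enorm, lintegral_count, hmax] at h1
    simpa only [enorm_eq_self] using h1
  rcases le_or_gt q p with hqp | hpq
  · obtain ⟨C, hC, htail⟩ := hone r hr0
    refine ⟨(volume (Set.univ : Set (Torus (d + 1)))) ^ (1 / q.toReal - 1 / p.toReal) * C,
      ENNReal.mul_ne_top (measure_rpow_ne_top hq hqp) hC, fun h a M hm _ hb n hn => ?_⟩
    have hrate : ENNReal.ofReal (rate (d + 1) p q θ r n) =
        2 ^ (-(r * n)) * (n : ℝ≥0∞) ^ ((d : ℝ) * (1 - (1 / θ).toReal)) := by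
      rw [rate, if_pos hqp, hcast, ofReal_two_rpow_mul_rpow hn, neg_mul]
    calc _ ≤ eLpNorm (fun x => ∑' j, if n < norm1 j then h j x else 0) p volume * _ :=
          eLpNorm_le_eLpNorm_mul_rpow_measure_univ hqp
            (Measurable.tsum (hg h n hm)).aestronglyMeasurable
      _ ≤ (∑' j, M * if n < norm1 j then 2 ^ (-(r * norm1 j)) * a j else 0) * _ := by
          gcongr
          refine (eLpNorm_tsum_le hp (hg h n hm)).trans (ENNReal.tsum_le_tsum fun j => ?_)
          split_ifs
          · exact hb j
          · simp
      _ ≤ (M * (C * (2 ^ (-(r * n)) * (n : ℝ≥0∞) ^ ((d : ℝ) * (1 - (1 / θ).toReal))) *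
            ellNorm θ a)) * _ := by
          rw [ENNReal.tsum_mul_left]
          gcongr
          exact htail n hn a
      _ = _ := by rw [hrate]; ring
  · have hpt : p ≠ ∞ := hpq.ne_top
    have hp0 : p ≠ 0 := (zero_lt_one.trans_le hp).ne'
    have hp1 : 1 ≤ p.toReal := by
      rw [← ENNReal.toReal_one]; exact ENNReal.toReal_mono hpt hp
    rcases eq_or_ne q ∞ with rfl | hqt
    · have hε : 0 < r - (1 / p).toReal := by
        have := (le_max_left _ _).trans_lt hr
        simp only [ENNReal.div_top, ENNReal.toReal_zero, sub_zero] at this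
        linarith
      obtain ⟨C, hC, htail⟩ := hone _ hε
      refine ⟨(4 ^ (d + 1)) ^ (1 - 1 / p.toReal) * C, ENNReal.mul_ne_top
        (ENNReal.rpow_ne_top_of_nonneg (sub_nonneg.2 ((div_le_one (by linarith)).2 hp1))
          (by simp)) hC, fun h a M hm hrep hb n hn => ?_⟩
      have hrate : ENNReal.ofReal (rate (d + 1) p ∞ θ r n) =
          2 ^ (-((r - (1 / p).toReal) * n)) * (n : ℝ≥0∞) ^ ((d : ℝ) * (1 - (1 / θ).toReal)) := by
        rw [rate, if_neg (not_le.2 hpq), if_neg (lt_irrefl _), hcast,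
          ofReal_two_rpow_mul_rpow hn, neg_mul]
      have hpt : ∀ j x, h j x ≤ (4 ^ (d + 1)) ^ (1 - 1 / p.toReal) *
          (M * (2 ^ (-((r - (1 / p).toReal) * norm1 j)) * a j)) := by
        intro j x
        refine (hrep j x).trans ((lintegral_mul_le_of_bdd hp1
          (Measurable.of_uncurry_left (measurable_torusKernel j)) (hm j)
          (lintegral_torusKernel j x).le (torusKernel_le j x)).trans ?_)
        have h1 := hb j
        rw [eLpNorm_eq_lintegral_rpow_enorm_toReal hp0 hpt] at h1
        simp only [enorm_eq_self] at h1
        calc _ ≤ (4 ^ (d + 1)) ^ (1 - 1 / p.toReal) * (2 ^ ((norm1 j : ℕ) : ℝ)) ^ (1 / p.toReal) *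
              (M * (2 ^ (-(r * norm1 j)) * a j)) := by gcongr
          _ = (4 ^ (d + 1)) ^ (1 - 1 / p.toReal) * (M * (((2 ^ ((norm1 j : ℕ) : ℝ)) ^
              (1 / p.toReal) * 2 ^ (-(r * norm1 j))) * a j)) := by ring
          _ = _ := by
              rw [← ENNReal.rpow_mul, ← two_rpow_add, toReal_one_div]
              congr 5; ring
      rw [eLpNorm_exponent_top]
      refine eLpNormEssSup_le_of_ae_enorm_bound (Filter.Eventually.of_forall fun x => ?_)
      rw [enorm_eq_self]
      calc _ ≤ ∑' j, (4 ^ (d + 1)) ^ (1 - 1 / p.toReal) * (M *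
            if n < norm1 j then 2 ^ (-((r - (1 / p).toReal) * norm1 j)) * a j else 0) := by
            refine ENNReal.tsum_le_tsum fun j => ?_
            split_ifs
            · exact hpt j x
            · simp
        _ ≤ (4 ^ (d + 1)) ^ (1 - 1 / p.toReal) * (M * (C * (2 ^ (-((r - (1 / p).toReal) * n)) *
              (n : ℝ≥0∞) ^ ((d : ℝ) * (1 - (1 / θ).toReal))) * ellNorm θ a)) := by
            rw [ENNReal.tsum_mul_left, ENNReal.tsum_mul_left]
            gcongr
            exact htail n hn a
        _ = _ := by rw [hrate]; ring
    · have hq0 : q ≠ 0 := (zero_lt_one.trans_le hq).ne'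
      have hpq' : p.toReal < q.toReal := (ENNReal.toReal_lt_toReal hpt hqt).2 hpq
      have hqr : 0 < q.toReal := by linarith
      set ε : ℝ := r - (1 / p).toReal + (1 / q).toReal
      have hε : 0 < ε := by
        have := (le_max_left _ _).trans_lt hr
        simp only [ε]; linarith
      obtain ⟨C₁, hC₁, hemb⟩ := kernelEmbedding_torus hp1 hpq' (d + 1)
      obtain ⟨C₂, hC₂, htail⟩ := eLpNorm_tail_le d hε hq hqt hθ
      refine ⟨C₁ ^ (1 / q.toReal) * C₂, ENNReal.mul_ne_top
        (ENNReal.rpow_ne_top_of_nonneg (by positivity) hC₁) hC₂, fun h a M hm hrep hb n hn => ?_⟩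
      have hrate : ENNReal.ofReal (rate (d + 1) p q θ r n) =
          2 ^ (-(ε * n)) * (n : ℝ≥0∞) ^
            ((d : ℝ) * max ((1 / q).toReal - (1 / θ).toReal) 0) := by
        rw [rate, if_neg (not_le.2 hpq), if_pos (lt_top_iff_ne_top.2 hqt), hcast,
          ofReal_two_rpow_mul_rpow hn, neg_mul]
      set g : (Fin (d + 1) → ℕ) → Torus (d + 1) → ℝ≥0∞ :=
        fun j x => if n < norm1 j then h j x else 0
      have h1 := hemb g (hg h n hm)
      have h2 : ∀ x, ∑' j, g j x ≤ ∑' j, ∫⁻ t, torusKernel j x t * g j t := by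
        intro x
        refine ENNReal.tsum_le_tsum fun j => ?_
        by_cases hj : n < norm1 j
        · simp only [g, if_pos hj]; exact hrep j x
        · simp only [g, if_neg hj]; exact zero_le
      have h3 : ∀ j, (∏ i, (2 : ℝ≥0∞) ^ ((j i : ℝ) * (1 / p.toReal - 1 / q.toReal))) *
          (∫⁻ t, g j t ^ p.toReal) ^ (1 / p.toReal) ≤
          M * ‖if n < norm1 j then (2 : ℝ≥0∞) ^ (-(ε * norm1 j)) * a j else 0‖ₑ := by
        intro j
        rw [prod_two_rpow, enorm_eq_self]
        by_cases hj : n < norm1 j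
        · have h4 := hb j
          rw [eLpNorm_eq_lintegral_rpow_enorm_toReal hp0 hpt] at h4
          simp only [enorm_eq_self] at h4
          simp only [g, if_pos hj]
          calc _ ≤ 2 ^ ((1 / p.toReal - 1 / q.toReal) * norm1 j) *
                (M * (2 ^ (-(r * norm1 j)) * a j)) := by gcongr
            _ = M * ((2 ^ ((1 / p.toReal - 1 / q.toReal) * norm1 j) * 2 ^ (-(r * norm1 j))) *
                a j) := by ring
            _ = _ := by
                rw [← two_rpow_add]
                congr 3
                simp only [ε, toReal_one_div]; ring
        · have hpr : p.toReal ≠ 0 := by linarith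
          simp [g, if_neg hj, ENNReal.zero_rpow_of_pos (by linarith : 0 < p.toReal),
            ENNReal.zero_rpow_of_pos (by positivity : 0 < p.toReal⁻¹)]
      calc eLpNorm (fun x => ∑' j, g j x) q volume
          ≤ (C₁ * ∑' j, (M * ‖if n < norm1 j then (2 : ℝ≥0∞) ^ (-(ε * norm1 j)) * a j
              else 0‖ₑ) ^ q.toReal) ^ (1 / q.toReal) := by
            rw [eLpNorm_eq_lintegral_rpow_enorm_toReal hq0 hqt]
            simp only [enorm_eq_self]
            refine ENNReal.rpow_le_rpow ?_ (by positivity)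
            refine (lintegral_mono fun x => ENNReal.rpow_le_rpow (h2 x) hqr.le).trans (h1.trans ?_)
            exact mul_le_mul_right (ENNReal.tsum_le_tsum fun j =>
              ENNReal.rpow_le_rpow (h3 j) hqr.le) _
        _ = C₁ ^ (1 / q.toReal) * (M * eLpNorm (fun j => if n < norm1 j then
              (2 : ℝ≥0∞) ^ (-(ε * norm1 j)) * a j else 0) q Measure.count) := by
            rw [eLpNorm_eq_lintegral_rpow_enorm_toReal hq0 hqt, lintegral_count]
            simp only [ENNReal.mul_rpow_of_nonneg _ _ hqr.le]
            rw [ENNReal.tsum_mul_left, ENNReal.mul_rpow_of_nonneg _ _ (by positivity),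
              ENNReal.mul_rpow_of_nonneg _ _ (by positivity), ← ENNReal.rpow_mul,
              mul_one_div_cancel hqr.ne', ENNReal.rpow_one]
        _ ≤ C₁ ^ (1 / q.toReal) * (M * (C₂ * (2 ^ (-(ε * n)) * (n : ℝ≥0∞) ^
              ((d : ℝ) * max ((1 / q).toReal - (1 / θ).toReal) 0)) * ellNorm θ a)) := by
            gcongr
            exact htail n hn a
        _ = _ := by rw [hrate]; ring

/-! ### The error of the Smolyak algorithm -/

/-- The blocks of a function from a Besov space of positive order are absolutely summable in
`L_p`. -/
theorem tsum_eLpNorm_block_ne_top {d : ℕ} {φ : ℕ → ℝ → ℂ} {r : ℝ} (hr : 0 < r) {p θ : ℝ≥0∞}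
    (hθ : 1 ≤ θ) {f : Torus d → ℂ} (hf : besovNorm φ r p θ f ≠ ∞) :
    ∑' k, eLpNorm (block φ k f) p volume ≠ ∞ := by
  have h := tsum_two_rpow_mul_le hr hθ hf
  have e : ∀ k : Fin d → ℕ, (2 : ℝ≥0∞) ^ (-(r * norm1 k)) *
      (ENNReal.ofReal ((2 : ℝ) ^ (r * (norm1 k : ℝ))) * eLpNorm (block φ k f) p volume) =
      eLpNorm (block φ k f) p volume := fun k => by
    rw [← ENNReal.ofReal_rpow_of_pos (by norm_num), ← mul_assoc, ENNReal.ofReal_ofNat,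
      ← two_rpow_add, neg_add_cancel, ENNReal.rpow_zero, one_mul]
  simpa only [e] using h

/-- The error bound for the Smolyak algorithm based on any dyadic scheme. -/
theorem exists_eLpNorm_sub_smolyak_le (d : ℕ) {p q θ p' : ℝ≥0∞} (hp : 1 ≤ p) (hq : 1 ≤ q)
    (hθ : 1 ≤ θ) (hpp' : 1 / p + 1 / p' = 1) {r s : ℝ}
    (hr : max ((1 / p).toReal - (1 / q).toReal) 0 < r) (hrs : r < s)
    {φ : ℕ → ℝ → ℂ} (hφ : IsResolution φ) {Y : ℕ → (Circ → ℂ) → Circ → ℂ}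
    {D : ℕ → Circ → Circ → ℂ} {C : ℝ≥0∞} (hC : C ≠ ∞) (hY : IsDyadicScheme p p' s Y D C) :
    ∃ K : ℝ≥0∞, K ≠ ∞ ∧ ∀ f : Torus (d + 1) → ℂ, MemBesov φ r p θ f → ∀ n : ℕ, 1 ≤ n →
      AEStronglyMeasurable (f - smolyak Y n f) volume ∧
      eLpNorm (f - smolyak Y n f) q volume ≤
        K * ENNReal.ofReal (rate (d + 1) p q θ r n) * besovNorm φ r p θ f := by
  have hr0 : 0 < r := (le_max_right _ _).trans_lt hr
  obtain ⟨C₁, hC₁, hmaj⟩ := exists_eLpNorm_incrementMajorant_le hp hY hφ hr0 hrs hθ (d + 1)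
  obtain ⟨C₂, hC₂, htail⟩ := exists_eLpNorm_tsum_tail_le d hp hq hθ hr
  refine ⟨C₂ * (C ^ (d + 1) * C₁), ENNReal.mul_ne_top hC₂
    (ENNReal.mul_ne_top (ENNReal.pow_ne_top hC) hC₁), fun f hf n hn => ?_⟩
  obtain ⟨a, ha, hb⟩ := hmaj f
  have hblock := tsum_eLpNorm_block_ne_top hr0 hθ hf.2.ne
  have hfin : ellNorm θ a ≠ ∞ := ne_top_of_le_ne_top (ENNReal.mul_ne_top hC₁ hf.2.ne) ha
  have hsum : ∑' j, eLpNorm (incrementMajorant Y φ f j) p volume ≠ ∞ := by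
    refine ne_top_of_le_ne_top ?_ (ENNReal.tsum_le_tsum hb)
    rw [ENNReal.tsum_mul_left]
    exact ENNReal.mul_ne_top (ENNReal.pow_ne_top hC) (tsum_two_rpow_mul_le hr0 hθ hfin)
  have hfp := (ae_eq_tsum_block hφ hp hf.1 hblock).1
  refine ⟨hfp.1.sub ?_, ?_⟩
  · exact Finset.aestronglyMeasurable_sum _ fun j _ =>
      aestronglyMeasurable_tensorIncrement hpp' hY j hfp
  · calc eLpNorm (f - smolyak Y n f) q volume
        ≤ eLpNorm (fun x => ∑' j, if n < norm1 j then incrementMajorant Y φ f j x else 0) q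
            volume := by
          refine eLpNorm_mono_enorm_ae ?_
          filter_upwards [ae_enorm_sub_smolyak_le hp hpp' hY hφ hf.1 hblock hsum n] with x hx
          rwa [enorm_eq_self]
      _ ≤ C₂ * ENNReal.ofReal (rate (d + 1) p q θ r n) * (C ^ (d + 1) * ellNorm θ a) :=
          htail _ a _ (fun j => measurable_incrementMajorant hY f j)
            (fun j x => incrementMajorant_le hY f j x) hb n hn
      _ ≤ C₂ * ENNReal.ofReal (rate (d + 1) p q θ r n) *
            (C ^ (d + 1) * (C₁ * besovNorm φ r p θ f)) := by gcongr
      _ = _ := by ring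

end Smolyak

theorem theorem4p2 (d : ℕ) (hd : 1 ≤ d) (p q θ p' : ℝ≥0∞) (hp : 1 ≤ p) (hq : 1 ≤ q) (hθ : 1 ≤ θ)
    (hpp' : 1 / p + 1 / p' = 1)
    (r s : ℝ) (hr : max ((1 / p).toReal - (1 / q).toReal) 0 < r) (hrs : r < s)
    (φ : ℕ → ℝ → ℂ) (hφ : Smolyak.IsResolution φ)
    (v w : ℕ → Smolyak.Circ → ℂ)
    (hv : ∀ j, v j ∈ Smolyak.trigPoly j)
    (hv_band : ∃ ρ : ℝ, ρ < 1 ∧ ∀ (j : ℕ) (k : ℤ), ρ * 2 ^ j < |(k : ℝ)| →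
      fourierCoeff (v j) k = 0)
    (hv_mult : (⨆ j, Smolyak.multiplierNorm p (fun k => fourierCoeff (v j) k)) < ∞)
    (hw : ∀ j, MemLp (w j) p' volume)
    (hw_norm : (⨆ j, Smolyak.scaledNorm p' j (w j)) < ∞)
    (hvw : Smolyak.Compatible p s (φ 0) v w) :
    ∃ C : ℝ, 0 < C ∧ ∀ f : Smolyak.Torus d → ℂ, Smolyak.MemBesov φ r p θ f →
      ∀ n : ℕ, 1 ≤ n →
        MemLp (f - Smolyak.smolyak (Smolyak.quasiInterp v w) n f) q volume ∧
        eLpNorm (f - Smolyak.smolyak (Smolyak.quasiInterp v w) n f) q volume ≤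
          ENNReal.ofReal (C * Smolyak.rate d p q θ r n) * Smolyak.besovNorm φ r p θ f := by
  obtain ⟨d, rfl⟩ : ∃ e, d = e + 1 := ⟨d - 1, by omega⟩
  have hs : 0 < s := ((le_max_right _ _).trans_lt hr).trans hrs
  obtain ⟨D, C, hC, hY⟩ := Smolyak.exists_isDyadicScheme hp hpp' hs hφ hv hv_band hv_mult hw
    hw_norm hvw
  obtain ⟨K, hK, h⟩ := Smolyak.exists_eLpNorm_sub_smolyak_le d hp hq hθ hpp' hr hrs hφ hC hY
  refine ⟨K.toReal + 1, by positivity, fun f hf n hn => ?_⟩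
  obtain ⟨hm, hle⟩ := h f hf n hn
  have hle' : eLpNorm (f - Smolyak.smolyak (Smolyak.quasiInterp v w) n f) q volume ≤
      ENNReal.ofReal ((K.toReal + 1) * Smolyak.rate (d + 1) p q θ r n) *
        Smolyak.besovNorm φ r p θ f := by
    refine hle.trans ?_
    rw [ENNReal.ofReal_mul (by positivity)]
    gcongr
    exact (ENNReal.ofReal_toReal hK).ge.trans (ENNReal.ofReal_le_ofReal (by linarith))
  exact ⟨⟨hm, hle'.trans_lt (ENNReal.mul_lt_top ENNReal.ofReal_lt_top hf.2)⟩, hle'⟩
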